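/- An \emph{affine manifold} modelled on a finite-dimensional real vector space $A$ is a manifold with an atlas of $A$-valued charts whose coordinate changes are locally affine; affine maps are the maps which are locally affine in such charts. It is \emph{complete} if it is the quotient of $A$ by a group of affine transformations acting properly and freely. Let $(N,\nabla_N)$ and $(F,\nabla_F)$ be compact complete affine manifolds modelled on $A$ and $B$ respectively. Let $\mathrm{Aff}(F)$ be the group of affine automorphisms of $F$, and let $T_F\subset \mathrm{Aff}(F)$ be the (commutative, normal) subgroup of those automorphisms which lift to translations of $B$; $T_F$ carries the affine structure for which the map sending a vector $a\in B$ such that the translation by $a$ descends to $F$ to the automorphism it induces is a local affine isomorphism. Let $p_F$ be a flat principal $\mathrm{Aff}(F)/T_F$-bundle on $N$ (structure group taken with the discrete topology), and let $p'_F$ be the flat bundle of groups with fibre $T_F$ associated with $p_F$ through the conjugation action of $\mathrm{Aff}(F)/T_F$ on $T_F$. For an open subset $U\subseteq N$, an affinely locally trivial $F$-affine bundle over $U$ is an affine map $e\colon E\to U$ from an affine manifold such that every point of $U$ has an open neighbourhood $V$ with $e^{-1}(V)$ affinely isomorphic over $V$ to $V\times F$. Its affine frames $F\to E_x$ modulo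 $T_F$ form a flat $\mathrm{Aff}(F)/T_F$-bundle on $U$ (the classes of the frames given by a local affine trivialization being flat sections). Let $C_F(U)$ be the category whose objects are the affinely locally trivial $F$-affine bundles over $U$ together with an isomorphism of the induced flat $\mathrm{Aff}(F)/T_F$-bundle with $p_F|_U$, and whose morphisms are the affine isomorphisms of bundles over $U$ which induce the identity of $p_F|_U$. For $U\subseteq N$ let $L_F(U)$ be the group of affine sections of $p'_F$ over $U$. Then: (1) $U\mapsto C_F(U)$, with restriction of bundles, is a gerbe on $N$: it is a sheaf of categories (gluing for arrows and for objects), all its arrows are invertible, and every open subset of $N$ is covered by open subsets $V$ such that $C_F(V)$ is not empty and any two objects of $C_F(V)$ are isomorphic. (2) $L_F$ is a sheaf of commutative groups, and $C_F$ is bounded by $L_F$: for each object $E$ of $C_F(U)$ there is an isomorphism of groups $L_F(U)\to \mathrm{Hom}_U(E,E)$, compatible with restrictions and with morphisms between objects. Explicitly, a section $s$ acts on the fibre $E_x$ as $\varphi\circ s_x(\bar\varphi)\circ\varphi^{-1}$, where $\varphi\colon F\to E_x$ is any frame, $\bar\varphi$ is its class in the fibre of $p_F$ at $x$, and $s_x(\bar\varphi)\in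 T_F$ is the value of $s_x$ read through $\bar\varphi$. (3) There are an open cover $(U_i)$ of $N$, objects $x_i$ of $C_F(U_i)$ and isomorphisms $u_{ij}\colon x_j|_{U_i\cap U_j}\to x_i|_{U_i\cap U_j}$. For every such choice $c_{ijk}=u_{ik}^{-1}u_{ij}u_{jk}$ is a \v{C}ech $2$-cocycle with values in $L_F$; its class in $\check H^2(N,L_F)$ does not depend on the choices, and it vanishes if and only if there exists an affinely locally trivial $F$-affine bundle over all of $N$ whose induced flat bundle is isomorphic to $p_F$. -/

import Mathlib

open TopologicalSpace Topology CategoryTheory Opposite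

universe u v w v' u'

noncomputable section

namespace AffineGerbe

/-! ### Affine manifolds, as manifolds with an atlas whose coordinate changes are affine -/

section AffineManifolds

/-- Being locally the restriction of an affine map. -/
def affinePregroupoid (V : Type v) [NormedAddCommGroup V] [NormedSpace ℝ V]
    [FiniteDimensional ℝ V] : Pregroupoid V where
  property f s := ∀ x ∈ s, ∃ L : V →ᵃ[ℝ] V, ∀ᶠ y in 𝓝 x, f y = L y
  comp := by
    intro f g s t hf hg _ _ _ x hx
    obtain ⟨L, hL⟩ := hf x hx.1
    obtain ⟨L', hL'⟩ := hg (f x) hx.2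
    refine ⟨L'.comp L, ?_⟩
    have hc : ContinuousAt f x :=
      (L.continuous_of_finiteDimensional.continuousAt (x := x)).congr (hL.mono fun y hy => hy.symm)
    filter_upwards [hL, hc.eventually hL'] with y h1 h2
    simp only [Function.comp_apply, AffineMap.coe_comp]
    rw [h2, h1]
  id_mem := fun x _ => ⟨AffineMap.id ℝ V, Filter.Eventually.of_forall fun _ => rfl⟩
  locality := by
    intro f s _ h x hx
    obtain ⟨t, _, hxt, ht⟩ := h x hx
    exact ht x ⟨hx, hxt⟩
  congr := by
    intro f g s hs hfg hf x hx
    obtain ⟨L, hL⟩ := hf x hx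
    refine ⟨L, ?_⟩
    filter_upwards [hL, hs.mem_nhds hx] with y h1 h2
    rw [hfg y h2, h1]

/-- The groupoid of local homeomorphisms of `V` which are locally affine.  An affine manifold
modelled on `V` is a charted space `M` with `HasGroupoid M (affineGroupoid V)`. -/
def affineGroupoid (V : Type v) [NormedAddCommGroup V] [NormedSpace ℝ V]
    [FiniteDimensional ℝ V] : StructureGroupoid V :=
  (affinePregroupoid V).groupoid

instance (V : Type v) [NormedAddCommGroup V] [NormedSpace ℝ V] [FiniteDimensional ℝ V] :
    ClosedUnderRestriction (affineGroupoid V) where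
  closedUnderRestriction := by
    intro e he s hs
    refine ⟨fun x hx => he.1 x ?_, fun x hx => he.2 x ?_⟩
    · exact hx.1
    · exact hx.1

/-- The product of two charted spaces, charted on the product of the model spaces. -/
instance instChartedSpaceProd (V : Type v) [TopologicalSpace V] (W : Type w) [TopologicalSpace W]
    (M : Type u) [TopologicalSpace M] [ChartedSpace V M]
    (M' : Type u') [TopologicalSpace M'] [ChartedSpace W M'] : ChartedSpace (V × W) (M × M') :=
  prodChartedSpace V M W M'

variable (V : Type*) [NormedAddCommGroup V] [NormedSpace ℝ V]
  (V' : Type*) [NormedAddCommGroup V'] [NormedSpace ℝ V']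
  (V'' : Type*) [NormedAddCommGroup V''] [NormedSpace ℝ V'']
  {M : Type*} [TopologicalSpace M] [ChartedSpace V M]
  {M' : Type*} [TopologicalSpace M'] [ChartedSpace V' M']
  {M'' : Type*} [TopologicalSpace M''] [ChartedSpace V'' M'']

/-- Affine maps between affine manifolds: continuous maps which are affine in affine charts. -/
def IsAffineMap (f : M → M') : Prop :=
  ∀ x : M, ContinuousAt f x ∧
    ∃ L : V →ᵃ[ℝ] V', ∀ᶠ y in 𝓝 x, chartAt V' (f x) (f y) = L (chartAt V x y)

/-- Local affine isomorphisms: maps which in affine charts are affine isomorphisms.  Bijective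
ones are the same as affine isomorphisms, injective ones the same as affine isomorphisms onto
an open subset. -/
def IsLocalAffineIso (f : M → M') : Prop :=
  ∀ x : M, ContinuousAt f x ∧
    ∃ L : V ≃ᵃ[ℝ] V', ∀ᶠ y in 𝓝 x, chartAt V' (f x) (f y) = L (chartAt V x y)

variable {V V' V''}

theorem IsLocalAffineIso.isAffineMap {f : M → M'} (hf : IsLocalAffineIso V V' f) :
    IsAffineMap V V' f := fun x =>
  ⟨(hf x).1, let ⟨L, hL⟩ := (hf x).2; ⟨(L : V →ᵃ[ℝ] V'), hL⟩⟩

theorem IsAffineMap.continuous {f : M → M'} (hf : IsAffineMap V V' f) : Continuous f :=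
  continuous_iff_continuousAt.2 fun x => (hf x).1

theorem IsLocalAffineIso.continuous {f : M → M'} (hf : IsLocalAffineIso V V' f) : Continuous f :=
  hf.isAffineMap.continuous

theorem isLocalAffineIso_id : IsLocalAffineIso V V (id : M → M) := fun _ =>
  ⟨continuousAt_id, AffineEquiv.refl ℝ V, Filter.Eventually.of_forall fun _ => rfl⟩

theorem IsAffineMap.comp {g : M' → M''} {f : M → M'} (hg : IsAffineMap V' V'' g)
    (hf : IsAffineMap V V' f) : IsAffineMap V V'' (g ∘ f) := by
  intro x
  obtain ⟨hfc, L, hL⟩ := hf x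
  obtain ⟨hgc, L', hL'⟩ := hg (f x)
  refine ⟨hgc.comp hfc, L'.comp L, ?_⟩
  filter_upwards [hL, hfc.eventually hL'] with y h1 h2
  simp only [Function.comp_apply, AffineMap.coe_comp]
  rw [h2, h1]

theorem IsLocalAffineIso.comp {g : M' → M''} {f : M → M'} (hg : IsLocalAffineIso V' V'' g)
    (hf : IsLocalAffineIso V V' f) : IsLocalAffineIso V V'' (g ∘ f) := by
  intro x
  obtain ⟨hfc, L, hL⟩ := hf x
  obtain ⟨hgc, L', hL'⟩ := hg (f x)
  refine ⟨hgc.comp hfc, L.trans L', ?_⟩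
  filter_upwards [hL, hfc.eventually hL'] with y h1 h2
  simp only [Function.comp_apply, AffineEquiv.trans_apply]
  rw [h2, h1]

theorem isLocalAffineIso_val (s : Opens M) :
    IsLocalAffineIso V V (Subtype.val : s → M) := fun _ =>
  ⟨continuous_subtype_val.continuousAt, AffineEquiv.refl ℝ V,
    Filter.Eventually.of_forall fun _ => rfl⟩

theorem IsLocalAffineIso.codRestrict {f : M → M'} (hf : IsLocalAffineIso V V' f) (s : Opens M')
    (hs : ∀ x, f x ∈ s) : IsLocalAffineIso V V' (fun x => (⟨f x, hs x⟩ : s)) := by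
  intro x
  obtain ⟨hfc, L, hL⟩ := hf x
  exact ⟨hfc.codRestrict hs, L, hL⟩

theorem isLocalAffineIso_inclusion_prod {s t : Opens M} (h : s ≤ t) :
    IsLocalAffineIso (V × V') (V × V')
      (fun z : s × M' => ((⟨z.1.1, h z.1.2⟩, z.2) : t × M')) := fun _ =>
  ⟨by fun_prop, AffineEquiv.refl ℝ _, Filter.Eventually.of_forall fun _ => rfl⟩

end AffineManifolds

/-! ### Complete affine manifolds, their affine automorphisms and their translations -/

section Complete

variable (B : Type w) [NormedAddCommGroup B] [NormedSpace ℝ B]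
  (F : Type u) [TopologicalSpace F] [ChartedSpace B F]

variable {B F} in
/-- `q` exhibits `F` as the quotient of the affine space `B` by the group `Γ` of affine
transformations, which acts properly and freely. -/
structure IsAffineQuotient (Γ : Subgroup (B ≃ᵃ[ℝ] B)) (q : B → F) : Prop where
  free : ∀ γ ∈ Γ, ∀ x, γ x = x → γ = 1
  proper : ∀ K : Set B, IsCompact K → {γ : B ≃ᵃ[ℝ] B | γ ∈ Γ ∧ ((γ '' K) ∩ K).Nonempty}.Finite
  affine : IsLocalAffineIso B B q
  surjective : Function.Surjective q
  orbit : ∀ x y, q x = q y ↔ ∃ γ ∈ Γ, γ x = y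

/-- A complete affine manifold: a quotient of the affine space by a group of affine
transformations acting properly and freely. -/
class CompleteAffine : Prop where
  exists_quotient : ∃ (Γ : Subgroup (B ≃ᵃ[ℝ] B)) (q : B → F), IsAffineQuotient Γ q

/-- The group of affine automorphisms of `F`. -/
def affAut : Subgroup (Equiv.Perm F) where
  carrier := {g | IsLocalAffineIso B B g ∧ IsLocalAffineIso B B g.symm}
  mul_mem' := fun ha hb => ⟨ha.1.comp hb.1, hb.2.comp ha.2⟩
  one_mem' := ⟨isLocalAffineIso_id, isLocalAffineIso_id⟩
  inv_mem' := fun ha => ⟨ha.2, ha.1⟩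

variable {B F} in
theorem IsAffineQuotient.comp_aut {Γ : Subgroup (B ≃ᵃ[ℝ] B)} {q : B → F}
    (hq : IsAffineQuotient Γ q) (g : affAut B F) : IsAffineQuotient Γ (fun x => g.1 (q x)) where
  free := hq.free
  proper := hq.proper
  affine := g.2.1.comp hq.affine
  surjective := g.1.surjective.comp hq.surjective
  orbit := fun x y => by rw [g.1.injective.eq_iff, hq.orbit]

/-- The translation group of the complete affine manifold `F`: the affine automorphisms which lift
to translations of `B` (a condition which does not depend on the presentation of `F` as a
quotient of `B`). -/
def translations : Subgroup (affAut B F) where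
  carrier := {g | ∀ (Γ : Subgroup (B ≃ᵃ[ℝ] B)) (q : B → F), IsAffineQuotient Γ q →
    ∃ a : B, ∀ z, g.1 (q z) = q (a + z)}
  mul_mem' := by
    intro g h hg hh Γ q hq
    obtain ⟨a, ha⟩ := hg Γ q hq
    obtain ⟨b, hb⟩ := hh Γ q hq
    refine ⟨a + b, fun z => ?_⟩
    change g.1 (h.1 (q z)) = _
    rw [hb, ha, add_assoc]
  one_mem' := fun Γ q _ => ⟨0, fun z => by rw [zero_add]; rfl⟩
  inv_mem' := by
    intro g hg Γ q hq
    obtain ⟨a, ha⟩ := hg Γ q hq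
    refine ⟨-a, fun z => ?_⟩
    change g.1.symm (q z) = _
    rw [Equiv.symm_apply_eq, ha, add_neg_cancel_left]

instance : (translations B F).Normal where
  conj_mem := by
    intro t ht g Γ q hq
    obtain ⟨a, ha⟩ := ht Γ _ (hq.comp_aut g⁻¹)
    refine ⟨a, fun z => ?_⟩
    have h : t.1 (g.1.symm (q z)) = g.1.symm (q (a + z)) := ha z
    change g.1 (t.1 (g.1.symm (q z))) = _
    rw [h, Equiv.apply_symm_apply]

instance [CompleteAffine B F] : CommGroup (translations B F) where
  mul_comm := by
    intro s t
    obtain ⟨Γ, q, hq⟩ := CompleteAffine.exists_quotient (B := B) (F := F)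
    obtain ⟨a, ha⟩ := s.2 Γ q hq
    obtain ⟨b, hb⟩ := t.2 Γ q hq
    apply Subtype.ext
    apply Subtype.ext
    apply Equiv.ext
    intro f
    obtain ⟨z, rfl⟩ := hq.surjective f
    change s.1.1 (t.1.1 (q z)) = t.1.1 (s.1.1 (q z))
    rw [hb, ha, ha, hb, add_left_comm]

/-- The structure group of the flat bundles considered here. -/
abbrev OuterGroup : Type u := affAut B F ⧸ translations B F

end Complete

/-- A flat principal `G`-bundle over `X`: a principal bundle for the group `G` endowed with the
discrete topology, that is a covering of `X` with a right action of `G` which is simply transitive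
on the fibres (which are not empty). -/
structure FlatBundle (G : Type u) [Group G] (X : Type u) [TopologicalSpace X] where
  total : Type u
  [topology : TopologicalSpace total]
  [action : MulAction Gᵐᵒᵖ total]
  [continuous_action : ContinuousConstSMul Gᵐᵒᵖ total]
  proj : total → X
  isCoveringMap : IsCoveringMap proj
  surjective : Function.Surjective proj
  proj_smul : ∀ (g : Gᵐᵒᵖ) (p : total), proj (g • p) = proj p
  simply_transitive : ∀ p p' : total, proj p = proj p' → ∃! g : Gᵐᵒᵖ, p' = g • p

attribute [instance] FlatBundle.topology FlatBundle.action FlatBundle.continuous_action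

/-! ### Affinely locally trivial affine bundles -/

section Bundles

variable (A : Type v) [NormedAddCommGroup A] [NormedSpace ℝ A] [FiniteDimensional ℝ A]
  (B : Type w) [NormedAddCommGroup B] [NormedSpace ℝ B] [FiniteDimensional ℝ B]
  {N : Type u} [TopologicalSpace N] [ChartedSpace A N]
  (F : Type u) [TopologicalSpace F] [ChartedSpace B F]

variable {F} in
/-- `Φ` is an affine trivialization over `V` of the affine map `π` to the open subset `U`: an affine
isomorphism over `V` from the product `V × F` to the part of the total space over `V`. -/
structure IsTrivialization {E : Type u} [TopologicalSpace E] [ChartedSpace (A × B) E] (π : E → N)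
    (U V : Opens N) (Φ : V × F → E) : Prop where
  le : V ≤ U
  proj : ∀ z, π (Φ z) = z.1
  injective : Function.Injective Φ
  surjective : ∀ e, π e ∈ V → ∃ z, Φ z = e
  affine : IsLocalAffineIso (A × B) (A × B) Φ

/-- Affinely locally trivial affine bundles over the open subset `U` with typical fibre the affine
manifold `F`: affine maps `E → U` which are, locally over `U`, affinely isomorphic to the
product with `F`. -/
structure AffBundle (U : Opens N) where
  total : Type u
  [topology : TopologicalSpace total]
  [charted : ChartedSpace (A × B) total]
  [affine : HasGroupoid total (affineGroupoid (A × B))]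
  proj : total → N
  proj_mem : ∀ e, proj e ∈ U
  affine_proj : IsAffineMap (A × B) A proj
  locally_trivial : ∀ x ∈ U, ∃ (V : Opens N) (Φ : V × F → total),
    x ∈ V ∧ IsTrivialization A B proj U V Φ

attribute [instance] AffBundle.topology AffBundle.charted AffBundle.affine

variable {A B F}

/-- The frames of the bundle at `x`: the affine isomorphisms from `F` to the fibre at `x`
given by the local trivializations. The group of affine automorphisms of `F` acts on them simply
transitively by composition on the right. -/
def AffBundle.Frame {U : Opens N} (E : AffBundle A B F U) (x : N) : Type u :=
  {φ : F → E.total // ∃ (V : Opens N) (Φ : V × F → E.total) (hx : x ∈ V),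
    IsTrivialization A B E.proj U V Φ ∧ ∀ f, φ f = Φ (⟨x, hx⟩, f)}

/-- The frame at `x` given by a local trivialization. -/
def AffBundle.frameOf {U : Opens N} (E : AffBundle A B F U) {V : Opens N} {Φ : V × F → E.total}
    (hΦ : IsTrivialization A B E.proj U V Φ) (x : V) : E.Frame x.1 :=
  ⟨fun f => Φ (x, f), V, Φ, x.2, hΦ, fun _ => rfl⟩

/-- Affinely locally trivial affine bundles over `U` which induce the restriction to `U` of the flat
bundle `P`.

The flat bundle induced by `E` is the extension of the bundle of frames of `E` along the quotient
morphism from the affine automorphisms of `F` to `OuterGroup B F`: its fibre at `x` is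
the set of frames at `x` modulo the translation group, and its flat (that is, continuous) sections
are locally the classes of the frames given by a local trivialization.  An isomorphism from it to
the restriction of `P` is therefore a map `marking` from frames to `P`, over `U`, which is
equivariant along the quotient morphism, and which takes the frames given by a local trivialization
to a continuous section of `P`. -/
structure MarkedBundle (P : FlatBundle (OuterGroup B F) N) (U : Opens N)
    extends AffBundle A B F U where
  marking : ∀ x : N, toAffBundle.Frame x → P.total
  proj_marking : ∀ x φ, P.proj (marking x φ) = x
  marking_comp : ∀ (x : N) (φ ψ : toAffBundle.Frame x) (g : affAut B F),
    (∀ f, ψ.1 f = φ.1 (g.1 f)) →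
      marking x ψ = MulOpposite.op (g : OuterGroup B F) • marking x φ
  continuous_marking : ∀ (V : Opens N) (Φ : V × F → total)
    (hΦ : IsTrivialization A B proj U V Φ),
      Continuous fun x : V => marking x.1 (toAffBundle.frameOf hΦ x)

namespace MarkedBundle

variable {P : FlatBundle (OuterGroup B F) N} {U : Opens N}

/-- Isomorphisms of affine bundles over `U` which induce the identity of the restriction of `P`. -/
@[ext]
structure Hom (X Y : MarkedBundle (A := A) P U) where
  toEquiv : X.total ≃ Y.total
  affine : IsLocalAffineIso (A × B) (A × B) toEquiv
  affine_symm : IsLocalAffineIso (A × B) (A × B) toEquiv.symm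
  proj : ∀ e, Y.proj (toEquiv e) = X.proj e
  marking : ∀ (x : N) (φ : X.Frame x) (ψ : Y.Frame x), (∀ f, ψ.1 f = toEquiv (φ.1 f)) →
    Y.marking x ψ = X.marking x φ

/-- The image of a frame under an isomorphism of bundles. -/
theorem Hom.exists_frame {X Y : MarkedBundle (A := A) P U} (h : Hom X Y) {x : N} (φ : X.Frame x) :
    ∃ ψ : Y.Frame x, ∀ f, ψ.1 f = h.toEquiv (φ.1 f) := by
  obtain ⟨φ, V, Φ, hx, hΦ, hφ⟩ := φ
  refine ⟨⟨fun f => h.toEquiv (φ f), V, fun z => h.toEquiv (Φ z), hx, ?_, ?_⟩, fun f => rfl⟩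
  · refine ⟨hΦ.le, fun z => ?_, h.toEquiv.injective.comp hΦ.injective, fun e he => ?_,
      h.affine.comp hΦ.affine⟩
    · rw [h.proj, hΦ.proj]
    · obtain ⟨z, hz⟩ := hΦ.surjective (h.toEquiv.symm e)
        (by rw [← h.proj, Equiv.apply_symm_apply]; exact he)
      exact ⟨z, by rw [hz, Equiv.apply_symm_apply]⟩
  · intro f
    exact congrArg h.toEquiv (hφ f)

/-- The category of affinely locally trivial bundles over `U` inducing the restriction of `P`. -/
instance : Category.{u} (MarkedBundle (A := A) P U) where
  Hom := Hom
  id X :=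
    { toEquiv := Equiv.refl _
      affine := isLocalAffineIso_id
      affine_symm := isLocalAffineIso_id
      proj := fun _ => rfl
      marking := fun x φ ψ h => by
        have : ψ = φ := Subtype.ext (funext h)
        rw [this] }
  comp {X Y Z} h k :=
    { toEquiv := h.toEquiv.trans k.toEquiv
      affine := k.affine.comp h.affine
      affine_symm := h.affine_symm.comp k.affine_symm
      proj := fun e => (k.proj _).trans (h.proj _)
      marking := fun x φ ψ hψ => by
        obtain ⟨χ, hχ⟩ := h.exists_frame φ
        rw [← h.marking x φ χ hχ]
        refine k.marking x χ ψ fun f => ?_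
        rw [hψ, hχ]
        rfl }

@[ext]
theorem hom_ext {X Y : MarkedBundle (A := A) P U} {h k : X ⟶ Y}
    (H : ∀ e, h.toEquiv e = k.toEquiv e) : h = k :=
  Hom.ext (Equiv.ext H)

@[simp]
theorem id_toEquiv_apply (X : MarkedBundle (A := A) P U) (e : X.total) :
    (𝟙 X : X ⟶ X).toEquiv e = e := rfl

@[simp]
theorem comp_toEquiv_apply {X Y Z : MarkedBundle (A := A) P U} (h : X ⟶ Y) (k : Y ⟶ Z)
    (e : X.total) : (h ≫ k).toEquiv e = k.toEquiv (h.toEquiv e) := rfl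

/-- The inverse of a morphism. -/
def Hom.symm {X Y : MarkedBundle (A := A) P U} (h : X ⟶ Y) : Y ⟶ X where
  toEquiv := h.toEquiv.symm
  affine := h.affine_symm
  affine_symm := h.affine
  proj := fun e => by rw [← h.proj, Equiv.apply_symm_apply]
  marking := fun x φ ψ hψ => by
    refine (h.marking x ψ φ fun f => ?_).symm
    rw [hψ, Equiv.apply_symm_apply]

/-- Morphisms are isomorphisms. -/
def Hom.toIso {X Y : MarkedBundle (A := A) P U} (h : X ⟶ Y) : X ≅ Y where
  hom := h
  inv := Hom.symm h
  hom_inv_id := hom_ext fun e => h.toEquiv.symm_apply_apply e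
  inv_hom_id := hom_ext fun e => h.toEquiv.apply_symm_apply e

/-- The part of the total space over `V`. -/
def part (X : MarkedBundle (A := A) P U) (V : Opens N) : Opens X.total :=
  ⟨X.proj ⁻¹' V, V.2.preimage X.affine_proj.continuous⟩

theorem isTrivialization_val (X : MarkedBundle (A := A) P U) {V W : Opens N} (hV : V ≤ U)
    {Φ : W × F → X.part V}
    (hΦ : IsTrivialization A B (fun e : X.part V => X.proj e.1) V W Φ) :
    IsTrivialization A B X.proj U W (fun z => (Φ z).1) where
  le := hΦ.le.trans hV
  proj := hΦ.proj
  injective := Subtype.val_injective.comp hΦ.injective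
  surjective := fun e he => by
    obtain ⟨z, hz⟩ := hΦ.surjective ⟨e, hΦ.le he⟩ he
    exact ⟨z, by rw [hz]⟩
  affine := (isLocalAffineIso_val _).comp hΦ.affine

/-- Restriction of the underlying affine bundle to a smaller open subset. -/
def resBundle (X : MarkedBundle (A := A) P U) {V : Opens N} (hV : V ≤ U) : AffBundle A B F V where
  total := X.part V
  affine := Opens.instHasGroupoid (affineGroupoid (A × B)) (X.part V)
  proj e := X.proj e.1
  proj_mem e := e.2
  affine_proj := X.affine_proj.comp (isLocalAffineIso_val _).isAffineMap
  locally_trivial := by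
    intro x hx
    obtain ⟨W, Φ, hxW, hΦ⟩ := X.locally_trivial x (hV hx)
    have hle : W ⊓ V ≤ W := inf_le_left
    have hmem : ∀ z : ↥(W ⊓ V) × F, Φ (⟨z.1.1, hle z.1.2⟩, z.2) ∈ X.part V := fun z => by
      change X.proj _ ∈ V
      rw [hΦ.proj]
      exact z.1.2.2
    refine ⟨W ⊓ V, fun z => ⟨Φ (⟨z.1.1, hle z.1.2⟩, z.2), hmem z⟩, ⟨hxW, hx⟩,
      ⟨inf_le_right, fun z => hΦ.proj _, fun z z' h => ?_, fun e he => ?_, ?_⟩⟩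
    · have h1 := hΦ.injective (congrArg Subtype.val h)
      have h2 := congrArg (fun t => (t.1 : N)) h1
      have h3 := congrArg Prod.snd h1
      exact Prod.ext (Subtype.ext h2) h3
    · obtain ⟨z, hz⟩ := hΦ.surjective e.1 he.1
      refine ⟨(⟨z.1.1, z.1.2, ?_⟩, z.2), Subtype.ext hz⟩
      rw [← hΦ.proj, hz]
      exact e.2
    · exact (hΦ.affine.comp (isLocalAffineIso_inclusion_prod hle)).codRestrict _ hmem

/-- A frame of the restriction is a frame. -/
def frameVal (X : MarkedBundle (A := A) P U) {V : Opens N} (hV : V ≤ U) {x : N}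
    (φ : (X.resBundle hV).Frame x) : X.Frame x :=
  ⟨fun f => (φ.1 f : X.part V).1, by
    obtain ⟨φ, W, Φ, hx, hΦ, hφ⟩ := φ
    exact ⟨W, fun z => (Φ z : X.part V).1, hx, X.isTrivialization_val hV hΦ,
      fun f => congrArg (fun e : X.part V => e.1) (hφ f)⟩⟩

/-- Restriction to a smaller open subset. -/
def res (X : MarkedBundle (A := A) P U) {V : Opens N} (hV : V ≤ U) :
    MarkedBundle (A := A) P V where
  toAffBundle := X.resBundle hV
  marking x φ := X.marking x (X.frameVal hV φ)
  proj_marking x _ := X.proj_marking x _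
  marking_comp x _ _ g h := X.marking_comp x _ _ g
    fun f => congrArg (fun e : X.part V => e.1) (h f)
  continuous_marking W _ hΦ := X.continuous_marking W _ (X.isTrivialization_val hV hΦ)

/-- Restriction of morphisms to a smaller open subset. -/
def resHom {X Y : MarkedBundle (A := A) P U} (h : X ⟶ Y) {V : Opens N} (hV : V ≤ U) :
    X.res hV ⟶ Y.res hV where
  toEquiv := Equiv.subtypeEquiv (p := fun e => e ∈ X.part V) (q := fun e => e ∈ Y.part V)
    h.toEquiv fun e => by
      change X.proj e ∈ V ↔ Y.proj (h.toEquiv e) ∈ V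
      rw [h.proj]
  affine := (h.affine.comp (isLocalAffineIso_val (X.part V))).codRestrict (Y.part V) _
  affine_symm := (h.affine_symm.comp (isLocalAffineIso_val (Y.part V))).codRestrict (X.part V) _
  proj (e : X.part V) := h.proj e.1
  marking x φ ψ hψ := h.marking x (X.frameVal hV φ) (Y.frameVal hV ψ)
    fun f => congrArg (fun e : Y.part V => e.1) (hψ f)

/-- The restriction functor. -/
def resFunctor (P : FlatBundle (OuterGroup B F) N) {U V : Opens N} (hV : V ≤ U) :
    MarkedBundle (A := A) P U ⥤ MarkedBundle (A := A) P V where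
  obj X := X.res hV
  map h := resHom h hV
  map_id _ := hom_ext fun _ => rfl
  map_comp _ _ := hom_ext fun _ => rfl

/-- Restricting to the whole open subset changes nothing. -/
def resId (P : FlatBundle (OuterGroup B F) N) (U : Opens N) :
    resFunctor (A := A) P (le_refl U) ≅ 𝟭 _ :=
  NatIso.ofComponents (fun X => Hom.toIso (X := X.res (le_refl U)) (Y := X)
    { toEquiv := Equiv.subtypeUnivEquiv (p := fun e => e ∈ X.part U) X.proj_mem
      affine := isLocalAffineIso_val (X.part U)
      affine_symm := isLocalAffineIso_id.codRestrict (X.part U) X.proj_mem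
      proj := fun _ => rfl
      marking := fun x φ ψ h => by
        have : ψ = X.frameVal (le_refl U) φ := Subtype.ext (funext h)
        rw [this]
        rfl })
    (fun _ => hom_ext fun _ => rfl)

/-- Restricting in two steps. -/
def resComp (P : FlatBundle (OuterGroup B F) N) {U V W : Opens N} (hV : V ≤ U) (hW : W ≤ V) :
    resFunctor (A := A) P (hW.trans hV) ≅ resFunctor P hV ⋙ resFunctor P hW :=
  NatIso.ofComponents (fun X => Hom.toIso (X := X.res (hW.trans hV)) (Y := (X.res hV).res hW)
    { toEquiv :=
        { toFun := fun e : X.part W => (⟨⟨e.1, hW e.2⟩, e.2⟩ : (X.res hV).part W)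
          invFun := fun e : (X.res hV).part W => (⟨(e.1 : X.part V).1, e.2⟩ : X.part W)
          left_inv := fun _ => rfl
          right_inv := fun _ => rfl }
      affine := ((isLocalAffineIso_val (X.part W)).codRestrict (X.part V)
        fun e => hW e.2).codRestrict ((X.res hV).part W) fun e => e.2
      affine_symm := ((isLocalAffineIso_val (X.part V)).comp
        (isLocalAffineIso_val ((X.res hV).part W))).codRestrict (X.part W) fun e => e.2
      proj := fun _ => rfl
      marking := fun x φ ψ h => by
        have : X.frameVal hV ((X.res hV).frameVal hW ψ) = X.frameVal (hW.trans hV) φ :=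
          Subtype.ext (funext fun f =>
            congrArg (fun e : (X.res hV).part W => (e.1 : X.part V).1) (h f))
        exact congrArg (X.marking x) this })
    (fun _ => hom_ext fun _ => rfl)

end MarkedBundle

variable (A)

/-- The correspondence `U ↦ C_F(U)`, with the restriction functors. -/
def bundleStack (P : FlatBundle (OuterGroup B F) N) :
    Pseudofunctor (LocallyDiscrete (Opens N)ᵒᵖ) Cat.{u, max (u + 1) v w} :=
  LocallyDiscrete.mkPseudofunctor
    (fun U => Cat.of (MarkedBundle (A := A) P U.unop))
    (fun f => (MarkedBundle.resFunctor P f.unop.le).toCatHom)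
    (fun U => Cat.Hom.isoMk (MarkedBundle.resId P U.unop))
    (fun f g => Cat.Hom.isoMk (MarkedBundle.resComp P f.unop.le g.unop.le))
    (fun f g h => by
      ext1
      ext X
      refine MarkedBundle.hom_ext fun e => ?_
      rfl)
    (fun f => by
      ext1
      ext X
      refine MarkedBundle.hom_ext fun e => ?_
      rfl)
    (fun f => by
      ext1
      ext X
      refine MarkedBundle.hom_ext fun e => ?_
      rfl)

/-! ### The flat bundle of translation groups and its affine sections -/

section Band

variable [CompleteAffine B F]

/-- The fibre at `x` of the flat bundle of groups associated with `P` and with the action by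
conjugation of the affine automorphisms of `F` on the (commutative) translation group: the class
of `(p, t)` is the equivariant function on the fibre of `P` whose value at `p` is `t`. -/
def adFibre (P : FlatBundle (OuterGroup B F) N) (x : N) :
    Subgroup ({p : P.total // P.proj p = x} → translations B F) where
  carrier := {s | ∀ (p p' : {p : P.total // P.proj p = x}) (g : affAut B F),
    p'.1 = MulOpposite.op (g : OuterGroup B F) • p.1 →
      (s p' : affAut B F) = g⁻¹ * (s p : affAut B F) * g}
  mul_mem' := by
    intro s t hs ht p p' g h
    simp only [Pi.mul_apply, Subgroup.coe_mul]
    rw [hs p p' g h, ht p p' g h]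
    group
  one_mem' := by
    intro p p' g _
    simp
  inv_mem' := by
    intro s hs p p' g h
    simp only [Pi.inv_apply, Subgroup.coe_inv]
    rw [hs p p' g h]
    group

/-- Affine maps to the translation group of `F`, for the affine structure on this group such that
the map which takes a vector of `B` (normalizing the fundamental group of `F`) to the induced
translation of `F` is a local affine isomorphism. -/
def IsAffineTranslationMap {W : Opens N} (s : W → translations B F) : Prop :=
  ∀ (Γ : Subgroup (B ≃ᵃ[ℝ] B)) (q : B → F), IsAffineQuotient Γ q → ∀ x : W,
    ∃ a : A →ᵃ[ℝ] B, ∀ᶠ y in 𝓝 x, ∀ z : B, (s y).1.1 (q z) = q (a (chartAt A x y) + z)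

/-- The group of affine sections over `U` of the flat bundle of translation groups associated with
`P`: those which are given in the flat trivialization defined by any flat (that is, continuous)
local section of `P` by an affine map to the translation group. -/
def affineSections (P : FlatBundle (OuterGroup B F) N) (U : Opens N) :
    Subgroup (∀ x : U, adFibre P x.1) where
  carrier := {s | ∀ (W : Opens N) (hW : W ≤ U) (σ : W → P.total) (hσ : ∀ y, P.proj (σ y) = y.1),
    Continuous σ → IsAffineTranslationMap A fun y => (s ⟨y.1, hW y.2⟩).1 ⟨σ y, hσ y⟩}
  mul_mem' := by
    intro s t hs ht W hW σ hσ hc Γ q hq x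
    obtain ⟨a, ha⟩ := hs W hW σ hσ hc Γ q hq x
    obtain ⟨b, hb⟩ := ht W hW σ hσ hc Γ q hq x
    refine ⟨a + b, ?_⟩
    filter_upwards [ha, hb] with y h1 h2 z
    change ((s ⟨y.1, hW y.2⟩).1 ⟨σ y, hσ y⟩).1.1
      (((t ⟨y.1, hW y.2⟩).1 ⟨σ y, hσ y⟩).1.1 (q z)) = _
    rw [h2, h1, AffineMap.coe_add, Pi.add_apply, add_assoc]
  one_mem' := by
    intro W hW σ hσ hc Γ q hq x
    refine ⟨0, Filter.Eventually.of_forall fun y z => ?_⟩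
    change q z = q (0 + z)
    rw [zero_add]
  inv_mem' := by
    intro s hs W hW σ hσ hc Γ q hq x
    obtain ⟨a, ha⟩ := hs W hW σ hσ hc Γ q hq x
    refine ⟨-a, ?_⟩
    filter_upwards [ha] with y h1 z
    change ((s ⟨y.1, hW y.2⟩).1 ⟨σ y, hσ y⟩).1.1.symm (q z) = _
    rw [Equiv.symm_apply_eq, h1, AffineMap.coe_neg, Pi.neg_apply, add_neg_cancel_left]

/-- Restriction of affine sections. -/
def affineSectionsRes (P : FlatBundle (OuterGroup B F) N) {U V : Opens N} (h : V ≤ U) :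
    affineSections A P U →* affineSections A P V where
  toFun s := ⟨fun x => s.1 ⟨x.1, h x.2⟩, fun W hW σ hσ hc => s.2 W (hW.trans h) σ hσ hc⟩
  map_one' := rfl
  map_mul' _ _ := rfl

/-- The presheaf of affine sections of the flat bundle of translation groups associated with `P`. -/
def affineSectionsPresheaf (P : FlatBundle (OuterGroup B F) N) :
    (Opens N)ᵒᵖ ⥤ CommGrpCat.{u} where
  obj U := CommGrpCat.of (affineSections A P U.unop)
  map f := CommGrpCat.ofHom (affineSectionsRes A P f.unop.le)
  map_id _ := rfl
  map_comp _ _ := rfl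

end Band

end Bundles

/-! ### Gerbes over a topological space, bands and classifying cocycles -/

section Gerbes

variable {X : Type u} [TopologicalSpace X]

/-- The fibre over `U` of a presheaf of categories. -/
abbrev Fib (C : Pseudofunctor (LocallyDiscrete (Opens X)ᵒᵖ) Cat.{v', u'}) (U : Opens X) : Type u' :=
  C.obj (.mk (op U))

/-- The restriction functor. -/
abbrev restr (C : Pseudofunctor (LocallyDiscrete (Opens X)ᵒᵖ) Cat.{v', u'}) {U V : Opens X}
    (h : V ≤ U) : Fib C U ⥤ Fib C V :=
  (C.map (homOfLE h).op.toLoc).toFunctor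

/-- Gerbes: sheaves of categories, all of whose arrows are invertible, such that each open subset is
covered by open subsets over which objects exist and any two objects are isomorphic. -/
structure IsGerbe (C : Pseudofunctor (LocallyDiscrete (Opens X)ᵒᵖ) Cat.{v', u'}) : Prop where
  isStack : C.IsStack (Opens.grothendieckTopology X)
  isIso : ∀ (U : Opens X) (a b : Fib C U) (f : a ⟶ b), IsIso f
  locally_connected : ∀ (U : Opens X) (x : X), x ∈ U → ∃ V : Opens X, x ∈ V ∧ V ≤ U ∧
    Nonempty (Fib C V) ∧ ∀ a b : Fib C V, Nonempty (a ⟶ b)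

/-- `C` is bounded by the sheaf of groups `L`: the sections of `L` over `U` are identified with the
endomorphisms of each object over `U`, compatibly with restrictions and with morphisms between
objects. -/
structure Banding (C : Pseudofunctor (LocallyDiscrete (Opens X)ᵒᵖ) Cat.{v', u'})
    (L : (Opens X)ᵒᵖ ⥤ CommGrpCat.{u}) where
  iso : ∀ {U : Opens X} (a : Fib C U), L.obj (op U) ≃* End a
  iso_restr : ∀ {U V : Opens X} (h : V ≤ U) (a : Fib C U) (s : L.obj (op U)),
    (restr C h).map (iso a s) = iso ((restr C h).obj a) ((L.map (homOfLE h).op).hom s)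
  iso_comp : ∀ {U : Opens X} (a b : Fib C U) (f : a ⟶ b) (s : L.obj (op U)),
    (iso a s : a ⟶ a) ≫ f = f ≫ (iso b s : b ⟶ b)

/-- An open cover of `X` with objects over its members and isomorphisms between their
restrictions to the intersections of two members. -/
structure LocalObjects (C : Pseudofunctor (LocallyDiscrete (Opens X)ᵒᵖ) Cat.{v', u'}) where
  ι : Type u
  U : ι → Opens X
  cover : ⨆ i, U i = ⊤
  obj : ∀ i, Fib C (U i)
  iso : ∀ i j, (restr C (inf_le_right : U i ⊓ U j ≤ U j)).obj (obj j) ≅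
    (restr C (inf_le_left : U i ⊓ U j ≤ U i)).obj (obj i)

/-- The restriction to a smaller open subset `W` of an arrow `a|V ⟶ b|V`. -/
abbrev restrHom {C : Pseudofunctor (LocallyDiscrete (Opens X)ᵒᵖ) Cat.{v', u'}} {U U' V W : Opens X}
    {a : Fib C U} {b : Fib C U'} {h : V ≤ U} {h' : V ≤ U'}
    (f : (restr C h).obj a ⟶ (restr C h').obj b) (k : W ≤ V) :
    (restr C (k.trans h)).obj a ⟶ (restr C (k.trans h')).obj b :=
  Pseudofunctor.LocallyDiscreteOpToCat.pullHom f (homOfLE k) (homOfLE (k.trans h))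
    (homOfLE (k.trans h'))

namespace LocalObjects

variable {C : Pseudofunctor (LocallyDiscrete (Opens X)ᵒᵖ) Cat.{v', u'}} (D : LocalObjects C)

/-- The endomorphism `u_ik⁻¹ u_ij u_jk` of the restriction of the object with index `k` to the
intersection of the members of the cover with indices `i`, `j`, `k`. -/
def triangle (i j k : D.ι) :
    End ((restr C (inf_le_right : D.U i ⊓ D.U j ⊓ D.U k ≤ D.U k)).obj (D.obj k)) :=
  restrHom (D.iso j k).hom
      (le_inf (inf_le_left.trans inf_le_right) inf_le_right : _ ≤ D.U j ⊓ D.U k) ≫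
    restrHom (D.iso i j).hom (inf_le_left : D.U i ⊓ D.U j ⊓ D.U k ≤ D.U i ⊓ D.U j) ≫
    restrHom (D.iso i k).inv
      (le_inf (inf_le_left.trans inf_le_left) inf_le_right : _ ≤ D.U i ⊓ D.U k)

/-- The classifying cochain `c_ijk = u_ik⁻¹ u_ij u_jk` with values in the band. -/
def cochain {L : (Opens X)ᵒᵖ ⥤ CommGrpCat.{u}} (β : Banding C L) (i j k : D.ι) :
    L.obj (op (D.U i ⊓ D.U j ⊓ D.U k)) :=
  (β.iso _).symm (D.triangle i j k)

end LocalObjects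

/-! ### Cech cohomology in degree two -/

variable (L : (Opens X)ᵒᵖ ⥤ CommGrpCat.{u})

variable {L} in
/-- Restriction of sections. -/
abbrev secRes {U V : Opens X} (h : V ≤ U) (s : L.obj (op U)) : L.obj (op V) :=
  (L.map (homOfLE h).op).hom s

/-- Cech `2`-cochains on a family of open subsets. -/
abbrev CechCochain₂ {ι : Type u} (U : ι → Opens X) : Type u :=
  ∀ i j k, L.obj (op (U i ⊓ U j ⊓ U k))

variable {L} in
/-- The cocycle condition, on all open subsets of the intersections of four members. -/
def IsCechCocycle {ι : Type u} {U : ι → Opens X} (c : CechCochain₂ L U) : Prop :=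
  ∀ (i j k l : ι) (W : Opens X) (hi : W ≤ U i) (hj : W ≤ U j) (hk : W ≤ U k) (hl : W ≤ U l),
    secRes (le_inf (le_inf hj hk) hl) (c j k l) * secRes (le_inf (le_inf hi hj) hl) (c i j l) =
      secRes (le_inf (le_inf hi hk) hl) (c i k l) * secRes (le_inf (le_inf hi hj) hk) (c i j k)

/-- Cech `2`-cocycles on open covers of `X`. -/
structure CechCocycle where
  ι : Type u
  U : ι → Opens X
  cover : ⨆ i, U i = ⊤
  val : CechCochain₂ L U
  isCocycle : IsCechCocycle val

variable {L} in
/-- Two Cech `2`-cocycles are cohomologous if their restrictions to a common refinement of the two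
covers differ by the coboundary of a `1`-cochain. -/
def Cohomologous (c d : CechCocycle L) : Prop :=
  ∃ (κ : Type u) (W : κ → Opens X) (_ : ⨆ a, W a = ⊤)
    (σ : κ → c.ι) (hσ : ∀ a, W a ≤ c.U (σ a)) (τ : κ → d.ι) (hτ : ∀ a, W a ≤ d.U (τ a))
    (s : ∀ a a', L.obj (op (W a ⊓ W a'))), ∀ a a' a'',
      secRes (inf_le_inf (inf_le_inf (hσ a) (hσ a')) (hσ a'')) (c.val (σ a) (σ a') (σ a'')) =
        secRes (inf_le_inf (inf_le_inf (hτ a) (hτ a')) (hτ a'')) (d.val (τ a) (τ a') (τ a'')) *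
          (secRes (inf_le_left : W a ⊓ W a' ⊓ W a'' ≤ W a ⊓ W a') (s a a') *
            secRes (le_inf (inf_le_left.trans inf_le_right) inf_le_right : _ ≤ W a' ⊓ W a'')
              (s a' a'') *
            (secRes (le_inf (inf_le_left.trans inf_le_left) inf_le_right : _ ≤ W a ⊓ W a'')
              (s a a''))⁻¹)

/-- The second Cech cohomology of `X` with values in `L` (the colimit over the open covers). -/
def CechH2 : Type (u + 1) := Quot (Cohomologous (L := L))

/-- The trivial class. -/
instance : One (CechH2 L) :=
  ⟨Quot.mk _
    { ι := PUnit
      U := fun _ => ⊤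
      cover := by simp
      val := fun _ _ _ => 1
      isCocycle := fun _ _ _ _ _ _ _ _ _ => by simp [secRes] }⟩

variable {L}

/-- `κ` is the class of the gerbe `C` bounded by `L`: objects and isomorphisms as in
`LocalObjects C` exist, and the classifying cochain of each such choice is a
cocycle with class `κ`. -/
def IsGerbeClass {C : Pseudofunctor (LocallyDiscrete (Opens X)ᵒᵖ) Cat.{v', u'}} (β : Banding C L)
    (κ : CechH2 L) : Prop :=
  Nonempty (LocalObjects C) ∧
    ∀ D : LocalObjects C, ∃ h : IsCechCocycle (D.cochain β),
      Quot.mk _ ⟨D.ι, D.U, D.cover, D.cochain β, h⟩ = κ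

end Gerbes

end AffineGerbe

set_option linter.unusedSectionVars false

namespace AffineGerbe

/-! ### Affine maps at a point -/

section AffineCalculus

/-! Everything rests on the rigidity of affine maps. On a connected affine manifold they are
determined by their germ at one point (`IsAffineMap.eq_of_eventuallyEq`). A local lift to the
covering `B` of the complete manifold `F` is, in coordinates, an affine map of vector spaces, hence
defined everywhere. So an affine map to `F` from a connected manifold with a global affine
coordinate map lifts without monodromy (`IsAffineQuotient.exists_lift`).

Apply this to an affine family of automorphisms of `F` over a connected base. Its lift `L (y, z)` is
affine in the two variables together, so its linear part in `z` does not depend on `y`: two members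
of the family differ by a translation, affine in the parameter
(`IsAffineQuotient.exists_translation`). Hence the transition maps of a bundle have locally constant
classes in `OuterGroup B F`. Moreover, an automorphism preserving the marking is fibrewise a
translation, because the action on `P` is free, and the same lemma shows that this translation
varies affinely. This identifies automorphisms with `affineSections` (`MarkedBundle.secEquiv`);
commutativity of the translations makes the identification independent of the frame.

For the local structure, let `O` be the domain of a convex chart. Transition maps over smaller
convex pieces extend to automorphisms of `O × F` (`exists_prodAut`), so a bundle over `O` is given
by a constant cocycle with values in the discrete group `prodAut`. As `O` is simply connected, this
cocycle is a coboundary (`exists_locally_constant_cochain`), and the bundle is trivial. Two trivial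
bundles with the same flat bundle are isomorphic by a locally constant change of frame. Objects
exist locally: mark a product by a section of `P`.

Descent becomes concrete because restrictions are open parts of total spaces and the coherence
isomorphisms are the identity on points; morphisms and bundles are then glued as maps and as
quotients of disjoint unions.

The cohomological part is formal and holds for every gerbe with a commutative band. The band acts
simply transitively on the arrows between two isomorphic objects, and this action passes through
composition. Associativity of a triple composite gives the cocycle identity, comparison isomorphisms
between two systems of choices give a coboundary, a cobounding cochain corrects the `u_ij` into a
descent datum, and a global object gives a one-element cover with trivial cocycle. -/

theorem affineMap_eq_of_eventuallyEq {V V' : Type*} [NormedAddCommGroup V] [NormedSpace ℝ V]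
    [NormedAddCommGroup V'] [NormedSpace ℝ V'] {L L' : V →ᵃ[ℝ] V'} {p : V}
    (h : L =ᶠ[𝓝 p] L') : L = L' := by
  ext v
  have hc : Filter.Tendsto (fun t : ℝ => AffineMap.lineMap p v t) (𝓝[≠] 0) (𝓝 p) := by
    have : Filter.Tendsto (fun t : ℝ => AffineMap.lineMap p v t) (𝓝 0)
        (𝓝 (AffineMap.lineMap p v (0 : ℝ))) :=
      (AffineMap.lineMap_continuous (R := ℝ)).continuousAt
    rw [AffineMap.lineMap_apply_zero] at this
    exact this.mono_left nhdsWithin_le_nhds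
  -- The maps agree at `p` and at a second point of the line through `p` and `v`, hence at `v`.
  obtain ⟨t, ht, ht0⟩ := ((hc.eventually h).and self_mem_nhdsWithin).exists
  have hp := h.self_of_nhds
  rw [AffineMap.apply_lineMap, AffineMap.apply_lineMap, hp] at ht
  simpa [AffineMap.lineMap_apply, show t ≠ 0 from ht0] using ht

variable (V : Type*) [NormedAddCommGroup V] [NormedSpace ℝ V]
  (V' : Type*) [NormedAddCommGroup V'] [NormedSpace ℝ V']
  (V'' : Type*) [NormedAddCommGroup V''] [NormedSpace ℝ V'']
  {M : Type*} [TopologicalSpace M] [ChartedSpace V M]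
  {M' : Type*} [TopologicalSpace M'] [ChartedSpace V' M']
  {M'' : Type*} [TopologicalSpace M''] [ChartedSpace V'' M'']

/-- Maps which are affine in affine charts near a point. -/
def IsAffineAt (f : M → M') (x : M) : Prop :=
  ContinuousAt f x ∧
    ∃ L : V →ᵃ[ℝ] V', ∀ᶠ y in 𝓝 x, chartAt V' (f x) (f y) = L (chartAt V x y)

/-- Maps which are affine isomorphisms in affine charts near a point. -/
def IsIsoAt (f : M → M') (x : M) : Prop :=
  ContinuousAt f x ∧
    ∃ L : V ≃ᵃ[ℝ] V', ∀ᶠ y in 𝓝 x, chartAt V' (f x) (f y) = L (chartAt V x y)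

variable {V V' V''}

theorem IsIsoAt.isAffineAt {f : M → M'} {x : M} (hf : IsIsoAt V V' f x) : IsAffineAt V V' f x :=
  ⟨hf.1, let ⟨L, hL⟩ := hf.2; ⟨(L : V →ᵃ[ℝ] V'), hL⟩⟩

theorem IsLocalAffineIso.isIsoAt {f : M → M'} (hf : IsLocalAffineIso V V' f) (x : M) :
    IsIsoAt V V' f x := hf x

theorem IsAffineMap.isAffineAt {f : M → M'} (hf : IsAffineMap V V' f) (x : M) :
    IsAffineAt V V' f x := hf x

theorem IsAffineAt.comp {g : M' → M''} {f : M → M'} {x : M} (hg : IsAffineAt V' V'' g (f x))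
    (hf : IsAffineAt V V' f x) : IsAffineAt V V'' (fun y => g (f y)) x := by
  obtain ⟨hfc, L, hL⟩ := hf
  obtain ⟨hgc, L', hL'⟩ := hg
  refine ⟨hgc.comp hfc, L'.comp L, ?_⟩
  filter_upwards [hL, hfc.eventually hL'] with y h1 h2
  rw [h2, h1, AffineMap.comp_apply]

theorem IsIsoAt.comp {g : M' → M''} {f : M → M'} {x : M} (hg : IsIsoAt V' V'' g (f x))
    (hf : IsIsoAt V V' f x) : IsIsoAt V V'' (fun y => g (f y)) x := by
  obtain ⟨hfc, L, hL⟩ := hf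
  obtain ⟨hgc, L', hL'⟩ := hg
  refine ⟨hgc.comp hfc, L.trans L', ?_⟩
  filter_upwards [hL, hfc.eventually hL'] with y h1 h2
  rw [h2, h1, AffineEquiv.trans_apply]

theorem IsAffineAt.congr {f g : M → M'} {x : M} (hf : IsAffineAt V V' f x) (h : f =ᶠ[𝓝 x] g) :
    IsAffineAt V V' g x := by
  obtain ⟨hfc, L, hL⟩ := hf
  refine ⟨hfc.congr h, L, ?_⟩
  filter_upwards [hL, h] with y h1 h2
  rw [← h2, ← h.self_of_nhds, h1]

theorem IsIsoAt.congr {f g : M → M'} {x : M} (hf : IsIsoAt V V' f x) (h : f =ᶠ[𝓝 x] g) :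
    IsIsoAt V V' g x := by
  obtain ⟨hfc, L, hL⟩ := hf
  refine ⟨hfc.congr h, L, ?_⟩
  filter_upwards [hL, h] with y h1 h2
  rw [← h2, ← h.self_of_nhds, h1]

theorem isIsoAt_id (x : M) : IsIsoAt V V (fun y : M => y) x :=
  isLocalAffineIso_id x

theorem isIsoAt_val {s : Opens M} (x : s) : IsIsoAt V V (fun y : s => (y : M)) x :=
  isLocalAffineIso_val s x

theorem isAffineAt_const (c : M') (x : M) : IsAffineAt V V' (fun _ : M => c) x :=
  ⟨continuousAt_const, AffineMap.const ℝ V (chartAt V' c c),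
    Filter.Eventually.of_forall fun _ => rfl⟩

theorem IsAffineAt.prodMk {f : M → M'} {g : M → M''} {x : M} (hf : IsAffineAt V V' f x)
    (hg : IsAffineAt V V'' g x) : IsAffineAt V (V' × V'') (fun y => (f y, g y)) x := by
  obtain ⟨hfc, L, hL⟩ := hf
  obtain ⟨hgc, L', hL'⟩ := hg
  refine ⟨hfc.prodMk hgc, L.prod L', ?_⟩
  filter_upwards [hL, hL'] with y h1 h2
  exact Prod.ext h1 h2

theorem isAffineAt_fst (x : M × M') : IsAffineAt (V × V') V (fun y : M × M' => y.1) x :=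
  ⟨continuousAt_fst, AffineMap.fst, Filter.Eventually.of_forall fun _ => rfl⟩

theorem isAffineAt_snd (x : M × M') : IsAffineAt (V × V') V' (fun y : M × M' => y.2) x :=
  ⟨continuousAt_snd, AffineMap.snd, Filter.Eventually.of_forall fun _ => rfl⟩

variable [FiniteDimensional ℝ V] [FiniteDimensional ℝ V'] [FiniteDimensional ℝ V'']

theorem isAffineAt_affineMap (L : V →ᵃ[ℝ] V') (x : V) : IsAffineAt V V' L x :=
  ⟨L.continuous_of_finiteDimensional.continuousAt, L, Filter.Eventually.of_forall fun _ => rfl⟩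

theorem isIsoAt_affineEquiv (L : V ≃ᵃ[ℝ] V') (x : V) : IsIsoAt V V' L x :=
  ⟨(L : V →ᵃ[ℝ] V').continuous_of_finiteDimensional.continuousAt, L,
    Filter.Eventually.of_forall fun _ => rfl⟩

theorem map_nhds_affineEquiv (L : V ≃ᵃ[ℝ] V') (x : V) : Filter.map L (𝓝 x) = 𝓝 (L x) :=
  (AffineEquiv.toContinuousAffineEquiv L).toHomeomorph.map_nhds_eq x

/-- In the charts at `x` and `f x` the map is an affine isomorphism, thus a homeomorphism of the
models. This allows properties of maps out of the target to be tested after composition with a local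
isomorphism. -/
theorem IsIsoAt.map_nhds {f : M → M'} {x : M} (hf : IsIsoAt V V' f x) :
    Filter.map f (𝓝 x) = 𝓝 (f x) := by
  obtain ⟨hfc, L, hL⟩ := hf
  have h1 : Filter.map (fun y => chartAt V' (f x) (f y)) (𝓝 x) = 𝓝 (chartAt V' (f x) (f x)) := by
    rw [Filter.map_congr hL, hL.self_of_nhds, ← map_nhds_affineEquiv,
      ← (chartAt V x).map_nhds_eq (mem_chart_source V x), Filter.map_map]
    rfl
  have h2 : Filter.map f (𝓝 x) =
      Filter.map (fun y => (chartAt V' (f x)).symm (chartAt V' (f x) (f y))) (𝓝 x) := by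
    refine Filter.map_congr ?_
    filter_upwards [hfc.eventually ((chartAt V' (f x)).open_source.mem_nhds
      (mem_chart_source V' (f x)))] with y hy
    exact ((chartAt V' (f x)).left_inv hy).symm
  have h3 : Filter.map (fun y => (chartAt V' (f x)).symm (chartAt V' (f x) (f y))) (𝓝 x) =
      Filter.map (chartAt V' (f x)).symm (𝓝 (chartAt V' (f x) (f x))) := by
    rw [← h1, Filter.map_map]
    rfl
  rw [h2, h3, (chartAt V' (f x)).symm_map_nhds_eq (mem_chart_source V' (f x))]

theorem IsIsoAt.exists_injOn {f : M → M'} {x : M} (hf : IsIsoAt V V' f x) :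
    ∃ s ∈ 𝓝 x, Set.InjOn f s := by
  obtain ⟨hfc, L, hL⟩ := hf
  refine ⟨_, Filter.inter_mem hL ((chartAt V x).open_source.mem_nhds (mem_chart_source V x)), ?_⟩
  rintro y ⟨hy, hys⟩ z ⟨hz, hzs⟩ hyz
  refine (chartAt V x).injOn hys hzs (L.injective ?_)
  rw [← hy, ← hz, hyz]

theorem IsAffineAt.of_comp_isIsoAt {p : M' → M''} {ψ : M → M'} {x : M} (hψ : IsIsoAt V V' ψ x)
    (h : IsAffineAt V V'' (fun y => p (ψ y)) x) : IsAffineAt V' V'' p (ψ x) := by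
  have hm := hψ.map_nhds
  obtain ⟨-, K, hK⟩ := hψ
  obtain ⟨hc, L, hL⟩ := h
  refine ⟨?_, L.comp (K.symm : V' →ᵃ[ℝ] V), ?_⟩
  · rw [ContinuousAt, ← hm]
    exact Filter.tendsto_map'_iff.2 hc
  · rw [← hm, Filter.eventually_map]
    filter_upwards [hK, hL] with y h1 h2
    simp [h1, h2]

theorem IsIsoAt.of_comp_isIsoAt {p : M' → M''} {ψ : M → M'} {x : M} (hψ : IsIsoAt V V' ψ x)
    (h : IsIsoAt V V'' (fun y => p (ψ y)) x) : IsIsoAt V' V'' p (ψ x) := by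
  have hm := hψ.map_nhds
  obtain ⟨-, K, hK⟩ := hψ
  obtain ⟨hc, L, hL⟩ := h
  refine ⟨?_, K.symm.trans L, ?_⟩
  · rw [ContinuousAt, ← hm]
    exact Filter.tendsto_map'_iff.2 hc
  · rw [← hm, Filter.eventually_map]
    filter_upwards [hK, hL] with y h1 h2
    simp [h1, h2]

/-- A left inverse of a local affine isomorphism is a local affine isomorphism. -/
theorem IsIsoAt.leftInverse {f : M → M'} {g : M' → M} {x : M} (hf : IsIsoAt V V' f x)
    (h : ∀ᶠ y in 𝓝 x, g (f y) = y) : IsIsoAt V' V g (f x) :=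
  hf.of_comp_isIsoAt ((isIsoAt_id x).congr (h.mono fun _ hy => hy.symm))

/-- Continuity of `g` has to be given: `ψ` is only locally injective, and `g` could jump between its
sheets. -/
theorem IsIsoAt.of_isIsoAt_comp {ψ : M' → M''} {g : M → M'} {x : M}
    (hψ : IsIsoAt V' V'' ψ (g x)) (hg : ContinuousAt g x)
    (h : IsIsoAt V V'' (fun y => ψ (g y)) x) : IsIsoAt V V' g x := by
  obtain ⟨-, K, hK⟩ := hψ
  obtain ⟨hc, L, hL⟩ := h
  refine ⟨hg, L.trans K.symm, ?_⟩
  filter_upwards [hg.eventually hK, hL] with y h1 h2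
  simp [← h2, h1]

theorem affineMap_comp_eq_id {f : M → M'} {g : M' → M} {x : M} {L : V →ᵃ[ℝ] V'} {K : V' →ᵃ[ℝ] V}
    (hL : ∀ᶠ y in 𝓝 x, chartAt V' (f x) (f y) = L (chartAt V x y))
    (hK : ∀ᶠ y in 𝓝 x, chartAt V x (g (f y)) = K (chartAt V' (f x) (f y)))
    (h : ∀ᶠ y in 𝓝 x, g (f y) = y) : K.comp L = AffineMap.id ℝ V := by
  refine affineMap_eq_of_eventuallyEq (p := chartAt V x x) ?_
  rw [← (chartAt V x).map_nhds_eq (mem_chart_source V x)]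
  change ∀ᶠ y in Filter.map _ _, _
  rw [Filter.eventually_map]
  filter_upwards [hL, hK, h] with y h1 h2 h3
  rw [AffineMap.comp_apply, ← h1, ← h2, h3, AffineMap.id_apply]

/-- Affine maps which are inverse to each other are affine isomorphisms. -/
theorem IsAffineAt.isIsoAt {f : M → M'} {g : M' → M} {x : M} (hf : IsAffineAt V V' f x)
    (hg : IsAffineAt V' V g (f x)) (h : ∀ᶠ y in 𝓝 x, g (f y) = y)
    (h' : ∀ᶠ z in 𝓝 (f x), f (g z) = z) : IsIsoAt V V' f x := by
  obtain ⟨hfc, L, hL⟩ := hf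
  obtain ⟨hgc, K, hK⟩ := hg
  have hx : g (f x) = x := h.self_of_nhds
  have hgc' : Filter.Tendsto g (𝓝 (f x)) (𝓝 x) := by
    have := hgc.tendsto
    rwa [hx] at this
  rw [hx] at hK
  have h1 := affineMap_comp_eq_id hL (hfc.eventually hK) h
  have h2 : L.comp K = AffineMap.id ℝ V' := by
    refine affineMap_comp_eq_id (x := f x) (f := g) (g := f) ?_ ?_ h'
    · rw [hx]
      exact hK
    · rw [hx]
      exact hgc'.eventually hL
  refine ⟨hfc, ⟨⟨L, K, fun v => ?_, fun v => ?_⟩, ⟨L.linear, K.linear, fun v => ?_, fun v => ?_⟩,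
    fun p v => L.map_vadd p v⟩, hL⟩
  · exact congrArg (fun T : V →ᵃ[ℝ] V => T v) h1
  · exact congrArg (fun T : V' →ᵃ[ℝ] V' => T v) h2
  · exact congrArg (fun T : V →ᵃ[ℝ] V => T.linear v) h1
  · exact congrArg (fun T : V' →ᵃ[ℝ] V' => T.linear v) h2

theorem IsLocalAffineIso.isOpenMap {f : M → M'} (hf : IsLocalAffineIso V V' f) : IsOpenMap f :=
  isOpenMap_iff_nhds_le.2 fun x => (IsIsoAt.map_nhds (hf x)).ge

theorem IsLocalAffineIso.isOpenEmbedding {f : M → M'} (hf : IsLocalAffineIso V V' f)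
    (h : Function.Injective f) : IsOpenEmbedding f :=
  .of_continuous_injective_isOpenMap hf.continuous h hf.isOpenMap

theorem IsLocalAffineIso.symm {f : M ≃ M'} (hf : IsLocalAffineIso V V' f) :
    IsLocalAffineIso V' V f.symm := by
  intro y
  obtain ⟨x, rfl⟩ := f.surjective y
  exact (show IsIsoAt V V' f x from hf x).leftInverse
    (Filter.Eventually.of_forall fun z => f.symm_apply_apply z)

/-- Continuous lifts of affine isomorphisms through injective local affine isomorphisms. -/
theorem IsIsoAt.of_isLocalAffineIso_comp {ψ : M' → M''} (hψ : IsLocalAffineIso V' V'' ψ)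
    (hi : Function.Injective ψ) {g : M → M'} {x : M}
    (h : IsIsoAt V V'' (fun y => ψ (g y)) x) : IsIsoAt V V' g x :=
  .of_isIsoAt_comp (hψ _) ((hψ.isOpenEmbedding hi).isInducing.continuousAt_iff.2 h.1) h

/-! ### Charts -/

theorem exists_affineMap_of_mem_affineGroupoid {e : OpenPartialHomeomorph V V}
    (he : e ∈ affineGroupoid V) {v : V} (hv : v ∈ e.source) :
    ∃ L : V →ᵃ[ℝ] V, ∀ᶠ y in 𝓝 v, e y = L y :=
  (mem_groupoid_of_pregroupoid.1 he).1 v hv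

theorem mem_affineGroupoid {e : OpenPartialHomeomorph V V}
    (h : ∀ v ∈ e.source, IsAffineAt V V e v) (h' : ∀ v ∈ e.target, IsAffineAt V V e.symm v) :
    e ∈ affineGroupoid V :=
  mem_groupoid_of_pregroupoid.2 ⟨fun v hv => (h v hv).2, fun v hv => (h' v hv).2⟩

/-- The charts of the model space are the identity, so the expression of `e` in charts is the
coordinate change from the preferred chart at `x`, a member of the groupoid. -/
theorem isAffineAt_chart [HasGroupoid M (affineGroupoid V)] {e : OpenPartialHomeomorph M V}
    (he : e ∈ atlas V M) {x : M} (hx : x ∈ e.source) : IsAffineAt V V e x := by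
  refine ⟨e.continuousAt hx, ?_⟩
  have hg : (chartAt V x).symm.trans e ∈ affineGroupoid V :=
    HasGroupoid.compatible (chart_mem_atlas V x) he
  obtain ⟨L, hL⟩ := exists_affineMap_of_mem_affineGroupoid hg (v := chartAt V x x)
    (by simp [hx])
  refine ⟨L, ?_⟩
  filter_upwards [((chartAt V x).continuousAt (mem_chart_source V x)).eventually hL,
    (chartAt V x).open_source.mem_nhds (mem_chart_source V x)] with y h1 h2
  rw [← h1]
  exact congrArg e ((chartAt V x).left_inv h2).symm

theorem isAffineAt_chart_symm [HasGroupoid M (affineGroupoid V)] {e : OpenPartialHomeomorph M V}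
    (he : e ∈ atlas V M) {v : V} (hv : v ∈ e.target) : IsAffineAt V V e.symm v := by
  refine ⟨e.symm.continuousAt hv, ?_⟩
  have hg : e.symm.trans (chartAt V (e.symm v)) ∈ affineGroupoid V :=
    HasGroupoid.compatible he (chart_mem_atlas V _)
  obtain ⟨L, hL⟩ := exists_affineMap_of_mem_affineGroupoid hg (v := v) (by simp [hv])
  exact ⟨L, hL⟩

theorem isIsoAt_chart [HasGroupoid M (affineGroupoid V)] {e : OpenPartialHomeomorph M V}
    (he : e ∈ atlas V M) {x : M} (hx : x ∈ e.source) : IsIsoAt V V e x := by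
  refine (isAffineAt_chart he hx).isIsoAt (isAffineAt_chart_symm he (e.map_source hx)) ?_ ?_
  · filter_upwards [e.open_source.mem_nhds hx] with y hy using e.left_inv hy
  · filter_upwards [e.open_target.mem_nhds (e.map_source hx)] with y hy using e.right_inv hy

/-- A charted space whose charts are affine at each point is an affine manifold. -/
theorem hasGroupoid_of_isAffineAt
    (h : ∀ e ∈ atlas V M, ∀ e' ∈ atlas V M, ∀ v ∈ (e.symm.trans e').source,
      IsAffineAt V V (fun y => e' (e.symm y)) v) : HasGroupoid M (affineGroupoid V) where
  compatible {e e'} he he' := by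
    refine mem_affineGroupoid (fun v hv => h e he e' he' v hv) fun v hv => ?_
    rw [← OpenPartialHomeomorph.symm_source, OpenPartialHomeomorph.trans_symm_eq_symm_trans_symm,
      OpenPartialHomeomorph.symm_symm] at hv
    exact h e' he' e he v hv

instance instHasGroupoidProd [HasGroupoid M (affineGroupoid V)]
    [HasGroupoid M' (affineGroupoid V')] : HasGroupoid (M × M') (affineGroupoid (V × V')) := by
  refine hasGroupoid_of_isAffineAt ?_
  rintro _ ⟨e₁, he₁, e₂, he₂, rfl⟩ _ ⟨e₁', he₁', e₂', he₂', rfl⟩ v hv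
  simp only [OpenPartialHomeomorph.trans_source, OpenPartialHomeomorph.symm_source,
    OpenPartialHomeomorph.prod_target, OpenPartialHomeomorph.prod_source, Set.mem_inter_iff,
    Set.mem_preimage, Set.mem_prod] at hv
  obtain ⟨⟨h1, h2⟩, h3, h4⟩ := hv
  obtain ⟨c1, L1, hL1⟩ := (isAffineAt_chart he₁' (x := e₁.symm v.1) h3).comp
    (isAffineAt_chart_symm he₁ h1)
  obtain ⟨c2, L2, hL2⟩ := (isAffineAt_chart he₂' (x := e₂.symm v.2) h4).comp
    (isAffineAt_chart_symm he₂ h2)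
  refine ⟨(c1.comp continuousAt_fst).prodMk (c2.comp continuousAt_snd),
    (L1.comp AffineMap.fst).prod (L2.comp AffineMap.snd), ?_⟩
  filter_upwards [continuousAt_fst.eventually hL1, continuousAt_snd.eventually hL2] with y h5 h6
  exact Prod.ext h5 h6

/-! ### The identity theorem, and lifts through local affine isomorphisms -/

/-- Two affine maps on a connected affine manifold which agree near a point are equal. -/
theorem IsAffineMap.eq_of_eventuallyEq [PreconnectedSpace M] [T2Space M'] {f g : M → M'}
    (hf : IsAffineMap V V' f) (hg : IsAffineMap V V' g) {x₀ : M} (h : f =ᶠ[𝓝 x₀] g) : f = g := by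
  -- The locus where the germs agree is open for formal reasons; only its closedness uses
  -- affineness.
  have hcl : IsClosed {x | f =ᶠ[𝓝 x] g} := by
    refine isClosed_of_closure_subset fun x hx => ?_
    have hfg : f x = g x := by
      have : closure {x | f =ᶠ[𝓝 x] g} ⊆ {x | f x = g x} :=
        closure_minimal (fun y hy => hy.self_of_nhds)
          (isClosed_eq hf.continuous hg.continuous)
      exact this hx
    obtain ⟨hfc, L, hL⟩ := hf x
    obtain ⟨hgc, K, hK⟩ := hg x
    rw [← hfg] at hK
    have hs := (chartAt V x).open_source.mem_nhds (mem_chart_source V x)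
    have hs' := (chartAt V' (f x)).open_source.mem_nhds (mem_chart_source V' (f x))
    have hgc' : Filter.Tendsto g (𝓝 x) (𝓝 (f x)) := hfg ▸ hgc.tendsto
    -- A point of the locus so close to `x` that the chart expressions centred at `x` are valid
    -- around it. The affine maps `L` and `K` then agree on an open set, hence everywhere.
    obtain ⟨x₁, hx₁, hx₁s, hx₁'⟩ := ((mem_closure_iff_frequently.1 hx).and_eventually
      ((Filter.eventually_mem_set.2 hs).eventually_nhds.and (hL.and hK).eventually_nhds)).exists
    have hLK : L = K := by
      refine affineMap_eq_of_eventuallyEq (p := chartAt V x x₁) ?_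
      rw [← (chartAt V x).map_nhds_eq hx₁s.self_of_nhds]
      change ∀ᶠ y in Filter.map _ _, _
      rw [Filter.eventually_map]
      filter_upwards [hx₁', hx₁] with y h1 h2
      rw [← h1.1, ← h1.2, h2]
    filter_upwards [hL, hK, hfc.eventually hs', hgc'.eventually hs'] with y h1 h2 h3 h4
    exact (chartAt V' (f x)).injOn h3 h4 (by rw [h1, h2, hLK])
  have := IsClopen.eq_univ ⟨hcl, isOpen_setOfPred_eventually_nhds⟩ ⟨x₀, h⟩
  ext x
  have hx : x ∈ {x | f =ᶠ[𝓝 x] g} := this ▸ Set.mem_univ x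
  exact hx.self_of_nhds

/-- Affine maps lift locally through local affine isomorphisms from the model space. -/
theorem IsAffineAt.exists_lift {f : M → M'} {x : M} (hf : IsAffineAt V V' f x) {q : V' → M'}
    {z : V'} (hq : IsIsoAt V' V' q z) (hz : q z = f x) :
    ∃ L : V →ᵃ[ℝ] V', L (chartAt V x x) = z ∧ ∀ᶠ y in 𝓝 x, f y = q (L (chartAt V x y)) := by
  obtain ⟨hfc, L, hL⟩ := hf
  obtain ⟨hqc, K, hK⟩ := hq
  have hK' : ∀ᶠ y in 𝓝 z, chartAt V' (q z) (q y) = K y := hK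
  have hz' : (K.symm : V' →ᵃ[ℝ] V') (L (chartAt V x x)) = z := by
    rw [← hL.self_of_nhds, ← hz, hK'.self_of_nhds]
    exact K.symm_apply_apply z
  have hc : Filter.Tendsto (fun y => (K.symm : V' →ᵃ[ℝ] V') (L (chartAt V x y))) (𝓝 x) (𝓝 z) := by
    have h1 := (((K.symm : V' →ᵃ[ℝ] V').comp L).continuous_of_finiteDimensional.continuousAt
      (x := chartAt V x x)).comp ((chartAt V x).continuousAt (mem_chart_source V x))
    have h2 := h1.tendsto
    simp only [Function.comp_apply, AffineMap.comp_apply] at h2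
    rwa [hz'] at h2
  refine ⟨(K.symm : V' →ᵃ[ℝ] V').comp L, hz', ?_⟩
  have hs' := (chartAt V' (f x)).open_source.mem_nhds (mem_chart_source V' (f x))
  rw [← hz] at hL hs'
  have hs'' : (chartAt V' (q z)).source ∈ 𝓝 (f x) := by rw [← hz]; exact hs'
  filter_upwards [hL, hc.eventually hK', hfc.eventually hs'',
    (hqc.tendsto.comp hc).eventually hs'] with y h1 h2 h3 h4
  refine (chartAt V' (q z)).injOn h3 h4 ?_
  rw [h1, AffineMap.comp_apply]
  refine Eq.trans ?_ h2.symm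
  exact (K.apply_symm_apply _).symm

end AffineCalculus

/-! ### Lifts to the universal covering of a complete affine manifold -/

section Lifts

variable {A : Type*} [NormedAddCommGroup A] [NormedSpace ℝ A] [FiniteDimensional ℝ A]
  {B : Type*} [NormedAddCommGroup B] [NormedSpace ℝ B] [FiniteDimensional ℝ B]
  {N : Type u} [TopologicalSpace N] [ChartedSpace A N]
  {F : Type u} [TopologicalSpace F] [ChartedSpace B F]

theorem IsIsoAt.prodMap {N F : Type*} [TopologicalSpace N] [ChartedSpace A N]
    [TopologicalSpace F] [ChartedSpace B F] {A' : Type*} [NormedAddCommGroup A'] [NormedSpace ℝ A']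
    {B' : Type*} [NormedAddCommGroup B'] [NormedSpace ℝ B']
    {N' : Type*} [TopologicalSpace N'] [ChartedSpace A' N']
    {F' : Type*} [TopologicalSpace F'] [ChartedSpace B' F'] {f : N → N'} {g : F → F'}
    {x : N × F} (hf : IsIsoAt A A' f x.1) (hg : IsIsoAt B B' g x.2) :
    IsIsoAt (A × B) (A' × B') (fun y : N × F => (f y.1, g y.2)) x := by
  obtain ⟨hfc, L, hL⟩ := hf
  obtain ⟨hgc, K, hK⟩ := hg
  refine ⟨(hfc.comp continuousAt_fst).prodMk (hgc.comp continuousAt_snd), L.prodCongr K, ?_⟩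
  filter_upwards [continuousAt_fst.eventually hL, continuousAt_snd.eventually hK] with y h1 h2
  exact Prod.ext h1 h2

theorem IsAffineQuotient.preconnectedSpace {Γ : Subgroup (B ≃ᵃ[ℝ] B)} {q : B → F}
    (hq : IsAffineQuotient Γ q) : PreconnectedSpace F :=
  hq.surjective.denseRange.preconnectedSpace hq.affine.continuous

/-- At `z₀` the two lifts differ by some `γ`; local injectivity of `q` forces `f = γ ∘ g` near `z₀`,
and affine maps with the same germ are equal. -/
theorem IsAffineQuotient.eq_comp_of_eventuallyEq {Γ : Subgroup (B ≃ᵃ[ℝ] B)} {q : B → F}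
    (hq : IsAffineQuotient Γ q) {f g : B →ᵃ[ℝ] B} {z₀ : B}
    (h : ∀ᶠ z in 𝓝 z₀, q (f z) = q (g z)) : ∃ γ ∈ Γ, ∀ z, f z = γ (g z) := by
  obtain ⟨γ, hγ, hz⟩ := (hq.orbit _ _).1 h.self_of_nhds.symm
  obtain ⟨s, hs, hi⟩ := IsIsoAt.exists_injOn (hq.affine.isIsoAt (f z₀))
  have hg : Filter.Tendsto (((γ : B →ᵃ[ℝ] B).comp g)) (𝓝 z₀) (𝓝 (f z₀)) := by
    rw [← hz]
    exact ((γ : B →ᵃ[ℝ] B).comp g).continuous_of_finiteDimensional.continuousAt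
  have hf : Filter.Tendsto f (𝓝 z₀) (𝓝 (f z₀)) := f.continuous_of_finiteDimensional.continuousAt
  have he : f = (γ : B →ᵃ[ℝ] B).comp g := by
    refine affineMap_eq_of_eventuallyEq (p := z₀) ?_
    filter_upwards [h, hf hs, hg hs] with z h1 h2 h3
    refine hi h2 h3 ?_
    rw [h1]
    exact (hq.orbit _ _).2 ⟨γ, hγ, rfl⟩
  exact ⟨γ, hγ, fun z => (congrArg (fun T : B →ᵃ[ℝ] B => T z) he)⟩

/-- Affine maps to a complete affine manifold lift globally in affine coordinates. -/
theorem IsAffineQuotient.exists_lift [T2Space F] {Γ : Subgroup (B ≃ᵃ[ℝ] B)} {q : B → F}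
    (hq : IsAffineQuotient Γ q) {A : Type*} [NormedAddCommGroup A] [NormedSpace ℝ A]
    [FiniteDimensional ℝ A] {N : Type*} [TopologicalSpace N] [ChartedSpace A N]
    [PreconnectedSpace N] [Nonempty N] {c : N → A}
    (hc : IsLocalAffineIso A A c) {h : N → F} (hh : IsAffineMap A B h) :
    ∃ L : A →ᵃ[ℝ] B, ∀ y, h y = q (L (c y)) := by
  obtain ⟨y₀⟩ := ‹Nonempty N›
  obtain ⟨z, hz⟩ := hq.surjective (h y₀)
  -- A germ of lift at one point suffices: it is an affine map of vector spaces, and the identity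
  -- theorem makes it a lift over all of `N`.
  obtain ⟨L, -, hL⟩ := IsAffineAt.exists_lift (hh.isAffineAt y₀) (hq.affine.isIsoAt z) hz
  obtain ⟨-, K, hK⟩ := hc y₀
  have hK' : ∀ᶠ y in 𝓝 y₀, c y = K (chartAt A y₀ y) := hK
  refine ⟨L.comp (K.symm : A →ᵃ[ℝ] A), fun y => ?_⟩
  have ha : IsAffineMap A B fun y => q (L.comp (K.symm : A →ᵃ[ℝ] A) (c y)) := fun y =>
    (hq.affine.isAffineMap.isAffineAt _).comp
      ((isAffineAt_affineMap _ _).comp (hc.isAffineMap.isAffineAt y))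
  refine congrFun (hh.eq_of_eventuallyEq ha (x₀ := y₀) ?_) y
  filter_upwards [hL, hK'] with y h1 h2
  rw [h1, h2]
  simp

theorem IsAffineQuotient.exists_prod_lift [T2Space F] {Γ : Subgroup (B ≃ᵃ[ℝ] B)} {q : B → F}
    (hq : IsAffineQuotient Γ q) [PreconnectedSpace N] [Nonempty N] {c : N → A}
    (hc : IsLocalAffineIso A A c) {h : N × F → F} (hh : IsAffineMap (A × B) B h) :
    ∃ L : A × B →ᵃ[ℝ] B, ∀ y z, h (y, q z) = q (L (c y, z)) := by
  have hc' : ∀ w : N × B,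
      IsIsoAt (A × B) (A × B) (fun y : N × B => ((c y.1, y.2) : A × B)) w := fun w => by
    obtain ⟨h1, K, hK⟩ := IsIsoAt.prodMap (A := A) (B := B) (f := c) (g := fun z : B => z) (x := w)
      (hc.isIsoAt w.1)
      (isIsoAt_id w.2)
    exact ⟨h1, K, hK⟩
  obtain ⟨L, hL⟩ := hq.exists_lift (A := A × B) (h := fun y : N × B => h (y.1, q y.2))
    (c := fun y : N × B => ((c y.1, y.2) : A × B)) hc' fun w =>
    (hh.isAffineAt _).comp (IsIsoAt.prodMap (f := fun y : N => y) (g := q) (x := w) (isIsoAt_id _)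
      (hq.affine.isIsoAt _)).isAffineAt
  exact ⟨L, fun y z => hL (y, z)⟩

/-- Both maps lift to affine endomorphisms of `B`. The composites of the lifts cover the identity,
so they are deck transformations, and the lifts are bijective. Taking `g = id` compares two
presentations of `F`; taking them equal lifts an automorphism. -/
theorem IsAffineQuotient.exists_equiv_of_comp [T2Space F] {Γ Γ' : Subgroup (B ≃ᵃ[ℝ] B)}
    {q q' : B → F} (hq : IsAffineQuotient Γ q) (hq' : IsAffineQuotient Γ' q')
    {g g' : F → F} (hg : IsAffineMap B B g) (hg' : IsAffineMap B B g') (h : ∀ f, g (g' f) = f)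
    (h' : ∀ f, g' (g f) = f) : ∃ K : B ≃ᵃ[ℝ] B, ∀ z, g (q' z) = q (K z) := by
  obtain ⟨K, hK⟩ := hq.exists_lift isLocalAffineIso_id (hg.comp (V := B) hq'.affine.isAffineMap)
  obtain ⟨K', hK'⟩ := hq'.exists_lift isLocalAffineIso_id (hg'.comp (V := B) hq.affine.isAffineMap)
  simp only [Function.comp_apply, id_eq] at hK hK'
  obtain ⟨γ, -, hγ⟩ := hq.eq_comp_of_eventuallyEq (f := K.comp K') (g := AffineMap.id ℝ B) (z₀ := 0)
    (Filter.Eventually.of_forall fun z => by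
      rw [AffineMap.comp_apply, ← hK, ← hK', h, AffineMap.id_apply])
  obtain ⟨γ', -, hγ'⟩ := hq'.eq_comp_of_eventuallyEq (f := K'.comp K) (g := AffineMap.id ℝ B)
    (z₀ := 0) (Filter.Eventually.of_forall fun z => by
      rw [AffineMap.comp_apply, ← hK', ← hK, h', AffineMap.id_apply])
  have hb : Function.Bijective K := by
    constructor
    · intro z z' hz
      refine γ'.injective ?_
      have h1 := hγ' z
      have h2 := hγ' z'
      rw [AffineMap.comp_apply, AffineMap.id_apply] at h1 h2
      rw [← h1, ← h2, hz]
    · intro z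
      refine ⟨K' (γ.symm z), ?_⟩
      have h1 := hγ (γ.symm z)
      rw [AffineMap.comp_apply, AffineMap.id_apply] at h1
      rw [h1, AffineEquiv.apply_symm_apply]
  exact ⟨AffineEquiv.ofBijective hb, hK⟩

theorem IsAffineQuotient.exists_equiv [T2Space F] {Γ Γ' : Subgroup (B ≃ᵃ[ℝ] B)} {q q' : B → F}
    (hq : IsAffineQuotient Γ q) (hq' : IsAffineQuotient Γ' q') :
    ∃ K : B ≃ᵃ[ℝ] B, ∀ z, q' z = q (K z) :=
  hq.exists_equiv_of_comp hq' (g := id) (g' := id) isLocalAffineIso_id.isAffineMap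
    isLocalAffineIso_id.isAffineMap (fun _ => rfl) fun _ => rfl

/-- An automorphism which lifts to a translation for one presentation of `F` as a quotient of the
affine space belongs to the translation group. -/
theorem IsAffineQuotient.mem_translations [T2Space F] {Γ : Subgroup (B ≃ᵃ[ℝ] B)} {q : B → F}
    (hq : IsAffineQuotient Γ q) {g : affAut B F} {a : B} (h : ∀ z, g.1 (q z) = q (a + z)) :
    g ∈ translations B F := by
  intro Γ' q' hq'
  obtain ⟨K, hK⟩ := hq.exists_equiv hq'
  refine ⟨K.linear.symm a, fun z => ?_⟩
  have := K.map_vadd z (K.linear.symm a)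
  simp only [vadd_eq_add, LinearEquiv.apply_symm_apply] at this
  rw [hK, hK, h, this]

/-- One presentation is enough: another one differs from it by some `K : B ≃ᵃ[ℝ] B`, and conjugation
by `K` only changes translation vectors by the inverse of its linear part. -/
theorem IsAffineQuotient.isAffineTranslationMap [T2Space F] {Γ : Subgroup (B ≃ᵃ[ℝ] B)} {q : B → F}
    (hq : IsAffineQuotient Γ q) {W : Opens N} {s : W → translations B F}
    (h : ∀ x : W, ∃ a : A →ᵃ[ℝ] B, ∀ᶠ y in 𝓝 x, ∀ z : B,
      (s y).1.1 (q z) = q (a (chartAt A x y) + z)) : IsAffineTranslationMap A s := by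
  intro Γ' q' hq' x
  obtain ⟨K, hK⟩ := hq.exists_equiv hq'
  obtain ⟨a, ha⟩ := h x
  refine ⟨(K.linear.symm : B →ₗ[ℝ] B).toAffineMap.comp a, ?_⟩
  filter_upwards [ha] with y hy z
  have := K.map_vadd z (K.linear.symm (a (chartAt A x y)))
  simp only [vadd_eq_add, LinearEquiv.apply_symm_apply] at this
  rw [hK, hK, hy]
  exact congrArg q this.symm

/-- In an affine family of affine automorphisms, any two members differ by a translation, which
depends affinely on the parameter. -/
theorem IsAffineQuotient.exists_translation [T2Space F] {Γ : Subgroup (B ≃ᵃ[ℝ] B)} {q : B → F}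
    (hq : IsAffineQuotient Γ q) [PreconnectedSpace N] {c : N → A}
    (hc : IsLocalAffineIso A A c) {g : N → affAut B F}
    (hg : IsAffineMap (A × B) B fun w : N × F => (g w.1).1 w.2) (y₀ : N) :
    ∃ a : A →ᵃ[ℝ] B, ∀ y z, (g y * (g y₀)⁻¹).1 (q z) = q (a (c y) + z) := by
  have : Nonempty N := ⟨y₀⟩
  obtain ⟨L, hL⟩ := hq.exists_prod_lift hc hg
  have hL' : ∀ y z, (g y).1 (q z) = q (L (c y, z)) := hL
  obtain ⟨K, hK⟩ := hq.exists_equiv_of_comp hq (g := (g y₀).1) (g' := (g y₀).1.symm)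
    (g y₀).2.1.isAffineMap (g y₀).2.2.isAffineMap (g y₀).1.apply_symm_apply
    (g y₀).1.symm_apply_apply
  -- On the fibre over `y₀` the joint lift `L` agrees, up to a deck transformation, with the lift
  -- `K` of the automorphism `g y₀`; hence it is bijective on that fibre.
  let i : B →ᵃ[ℝ] A × B := (AffineMap.const ℝ B (c y₀)).prod (AffineMap.id ℝ B)
  obtain ⟨γ, hγ, hγK⟩ := hq.eq_comp_of_eventuallyEq (f := K) (g := L.comp i) (z₀ := 0)
    (Filter.Eventually.of_forall fun z => by
      have h1 := hK z
      rw [hL'] at h1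
      exact h1.symm)
  have hγK' : ∀ z, K z = γ (L (c y₀, z)) := hγK
  -- Since `L` is affine in both variables together, moving `y` with `z'` fixed adds the vector
  -- `L.linear (c y - c y₀, 0)`, which does not depend on `z'`.
  refine ⟨L.linear.toAffineMap.comp
    ((AffineMap.id ℝ A - AffineMap.const ℝ A (c y₀)).prod (AffineMap.const ℝ A 0)), fun y z => ?_⟩
  obtain ⟨z', rfl⟩ : ∃ z', z = L (c y₀, z') := by
    refine ⟨K.symm (γ z), γ.injective ?_⟩
    rw [← hγK', K.apply_symm_apply]
  change (g y).1 ((g y₀).1.symm _) = _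
  rw [← hL', Equiv.symm_apply_apply, hL']
  congr 1
  have := L.map_vadd (c y₀, z') (c y - c y₀, 0)
  simp only [vadd_eq_add, Prod.mk_add_mk, sub_add_cancel, zero_add] at this
  rw [this]
  rfl

theorem IsAffineQuotient.mul_inv_mem_translations [T2Space F] {Γ : Subgroup (B ≃ᵃ[ℝ] B)}
    {q : B → F} (hq : IsAffineQuotient Γ q) [PreconnectedSpace N] {c : N → A}
    (hc : IsLocalAffineIso A A c) {g : N → affAut B F}
    (hg : IsAffineMap (A × B) B fun w : N × F => (g w.1).1 w.2) (y₀ y : N) :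
    g y * (g y₀)⁻¹ ∈ translations B F := by
  obtain ⟨a, ha⟩ := hq.exists_translation hc hg y₀
  exact hq.mem_translations (ha y)

/-- The map `id × q` is a surjective local affine isomorphism, so affineness can be tested on `N ×
B`. -/
theorem IsAffineQuotient.isAffineMap_of_comp {Γ : Subgroup (B ≃ᵃ[ℝ] B)} {q : B → F}
    (hq : IsAffineQuotient Γ q) {C : Type*} [NormedAddCommGroup C] [NormedSpace ℝ C]
    [FiniteDimensional ℝ C]
    {M : Type*} [TopologicalSpace M] [ChartedSpace C M] {h : N × F → M}
    (hh : ∀ w : N × B, IsAffineAt (A × B) C (fun w : N × B => h (w.1, q w.2)) w) :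
    IsAffineMap (A × B) C h := by
  rintro ⟨y, f⟩
  obtain ⟨z, rfl⟩ := hq.surjective f
  exact IsAffineAt.of_comp_isIsoAt (p := h) (ψ := fun w : N × B => (w.1, q w.2)) (IsIsoAt.prodMap (f := fun y : N => y) (g := q)
    (x := (y, z)) (isIsoAt_id _) (hq.affine.isIsoAt _)) (hh (y, z))

/-- Affine maps to the translation group act affinely. -/
theorem IsAffineTranslationMap.isAffineMap {Γ : Subgroup (B ≃ᵃ[ℝ] B)} {q : B → F}
    (hq : IsAffineQuotient Γ q) {W : Opens N} {s : W → translations B F}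
    (hs : IsAffineTranslationMap A s) :
    IsAffineMap (A × B) B fun w : W × F => (s w.1).1.1 w.2 := by
  refine hq.isAffineMap_of_comp fun w => ?_
  obtain ⟨a, ha⟩ := hs Γ q hq w.1
  have h1 : IsAffineAt (A × B) B (fun v : W × B => a (chartAt A w.1 v.1) + v.2) w :=
    ⟨((a.continuous_of_finiteDimensional.continuousAt.comp
      ((chartAt A w.1).continuousAt (mem_chart_source A w.1))).comp continuousAt_fst).add
        continuousAt_snd, a.comp AffineMap.fst + AffineMap.snd,
        Filter.Eventually.of_forall fun _ => rfl⟩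
  have h2 : IsAffineAt B B q _ := hq.affine.isAffineMap (a (chartAt A w.1 w.1) + w.2)
  refine (IsAffineAt.comp (g := q) (f := fun v : W × B => a (chartAt A w.1 v.1) + v.2) h2 h1).congr ?_
  filter_upwards [continuousAt_fst.eventually ha] with v hv
  exact (hv v.2).symm

/-- Affine maps over a connected open subset extend to larger coordinate domains. -/
theorem IsAffineQuotient.exists_extension [T2Space F] {Γ : Subgroup (B ≃ᵃ[ℝ] B)} {q : B → F}
    (hq : IsAffineQuotient Γ q) {O W : Opens N} (hWO : W ≤ O) [PreconnectedSpace O]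
    [PreconnectedSpace W] [Nonempty W] {c : O → A} (hc : IsLocalAffineIso A A c) {h : W × F → F}
    (hh : IsAffineMap (A × B) B h) :
    ∃ H : O × F → F, IsAffineMap (A × B) B H ∧ ∀ (y : W) f, H (⟨y.1, hWO y.2⟩, f) = h (y, f) := by
  have hi : IsLocalAffineIso A A (fun y : W => (⟨y.1, hWO y.2⟩ : O)) :=
    (isLocalAffineIso_val W).codRestrict O _
  obtain ⟨L, hL⟩ := hq.exists_prod_lift (hc.comp hi) hh
  have hm : ∀ w : O × B, IsAffineAt (A × B) B (fun w : O × B => q (L (c w.1, w.2))) w := by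
    intro w
    obtain ⟨h1, K, hK⟩ := IsIsoAt.prodMap (A := A) (B := B) (f := c) (g := fun z : B => z) (x := w)
      (hc.isIsoAt w.1)
      (isIsoAt_id w.2)
    refine (hq.affine.isAffineMap.isAffineAt _).comp ?_
    exact ⟨L.continuous_of_finiteDimensional.continuousAt.comp h1, L.comp (K : A × B →ᵃ[ℝ] A × B),
      hK.mono fun y hy => congrArg L hy⟩
  -- Over `W` the lift descends to `F`, so `q ∘ L` is invariant under `Γ` there; by the identity
  -- theorem it stays invariant over the connected `O`, so the extended lift also descends.
  have hγ : ∀ γ ∈ Γ, ∀ (y : O) (z : B), q (L (c y, γ z)) = q (L (c y, z)) := by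
    intro γ hγ y z
    obtain ⟨y₀⟩ := ‹Nonempty W›
    have h1 : IsAffineMap (A × B) B (fun w : O × B => q (L (c w.1, γ w.2))) := fun w =>
      (hm (w.1, γ w.2)).comp (f := fun w : O × B => (w.1, γ w.2))
        (IsIsoAt.prodMap (A := A) (B := B) (f := fun y : O => y) (g := γ) (x := w) (isIsoAt_id _)
          (isIsoAt_affineEquiv γ _)).isAffineAt
    refine congrFun (h1.eq_of_eventuallyEq (g := fun w : O × B => q (L (c w.1, w.2))) hm
      (x₀ := (⟨y₀.1, hWO y₀.2⟩, 0)) ?_) (y, z)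
    have : ∀ᶠ w : O × B in 𝓝 (⟨y₀.1, hWO y₀.2⟩, 0), w.1.1 ∈ W :=
      (continuous_subtype_val.comp continuous_fst).continuousAt.eventually
        (W.2.mem_nhds y₀.2)
    filter_upwards [this] with w hw
    have h2 := hL ⟨w.1.1, hw⟩ (γ w.2)
    rw [(hq.orbit (γ w.2) w.2).2 ⟨γ⁻¹, Γ.inv_mem hγ, γ.symm_apply_apply _⟩, hL] at h2
    exact h2.symm
  have hH : ∀ (y : O) (z : B),
      q (L (c y, Function.surjInv hq.surjective (q z))) = q (L (c y, z)) := by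
    intro y z
    obtain ⟨γ, hγΓ, hz⟩ := (hq.orbit z (Function.surjInv hq.surjective (q z))).1
      (Function.surjInv_eq hq.surjective _).symm
    rw [← hz, hγ γ hγΓ]
  refine ⟨fun w => q (L (c w.1, Function.surjInv hq.surjective w.2)),
    hq.isAffineMap_of_comp fun w => ?_, fun y f => ?_⟩
  · exact (hm w).congr (Filter.Eventually.of_forall fun w => (hH w.1 w.2).symm)
  · obtain ⟨z, rfl⟩ := hq.surjective f
    rw [hL]
    exact hH _ z

end Lifts

/-! ### Convex charts -/

section ConvexCharts

variable {A : Type v} [NormedAddCommGroup A] [NormedSpace ℝ A] [FiniteDimensional ℝ A]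
  {N : Type u} [TopologicalSpace N] [ChartedSpace A N]

/-- Affine charts of open subsets which are onto convex subsets of the model space. -/
structure IsConvexChart {W : Opens N} (c : W → A) : Prop where
  affine : IsLocalAffineIso A A c
  injective : Function.Injective c
  convex : Convex ℝ (Set.range c)

namespace IsConvexChart

variable {W W' O : Opens N} {c : W → A}

/-- The homeomorphism onto the image. -/
def homeomorph (hc : IsConvexChart c) : W ≃ₜ Set.range c :=
  (hc.affine.isOpenEmbedding hc.injective).isEmbedding.toHomeomorph

theorem preconnectedSpace (hc : IsConvexChart c) : PreconnectedSpace W := by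
  have := isPreconnected_iff_preconnectedSpace.1 hc.convex.isPreconnected
  exact hc.homeomorph.symm.surjective.denseRange.preconnectedSpace hc.homeomorph.symm.continuous

theorem contractibleSpace (hc : IsConvexChart c) [Nonempty W] : ContractibleSpace W := by
  have := hc.convex.contractibleSpace (Set.range_nonempty c)
  exact hc.homeomorph.contractibleSpace

theorem locallyPathConnectedSpace (hc : IsConvexChart c) : LocallyPathConnectedSpace W := by
  have := (hc.affine.isOpenEmbedding hc.injective).isOpen_range.locallyPathConnectedSpace
  exact hc.homeomorph.isOpenEmbedding.locallyPathConnectedSpace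

end IsConvexChart

/-- As `c` is injective, the image of the intersection is the intersection of two convex sets.
Overlaps of convex pieces of one chart are therefore connected. -/
theorem IsConvexChart.inf {O W W' : Opens N} (hW : W ≤ O) (hW' : W' ≤ O) {c : O → A}
    (h : IsConvexChart fun y : W => c ⟨y.1, hW y.2⟩)
    (h' : IsConvexChart fun y : W' => c ⟨y.1, hW' y.2⟩) (hc : Function.Injective c) :
    IsConvexChart fun y : ↥(W ⊓ W') => c ⟨y.1, hW y.2.1⟩ where
  affine := h.affine.comp ((isLocalAffineIso_val (W ⊓ W')).codRestrict W fun y => y.2.1)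
  injective y z hyz := Subtype.ext (congrArg (fun t : O => t.1) (hc hyz))
  convex := by
    have : Set.range (fun y : ↥(W ⊓ W') => c ⟨y.1, hW y.2.1⟩) =
        Set.range (fun y : W => c ⟨y.1, hW y.2⟩) ∩ Set.range (fun y : W' => c ⟨y.1, hW' y.2⟩) := by
      ext a
      constructor
      · rintro ⟨y, rfl⟩
        exact ⟨⟨⟨y.1, y.2.1⟩, rfl⟩, ⟨⟨y.1, y.2.2⟩, rfl⟩⟩
      · rintro ⟨⟨y, rfl⟩, ⟨z, hz⟩⟩
        have hyz : z.1 = y.1 := congrArg Subtype.val (hc hz)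
        exact ⟨⟨y.1, y.2, hyz ▸ z.2⟩, rfl⟩
    rw [this]
    exact h.convex.inter h'.convex

/-- Restricting an injective affine chart to arbitrarily small convex neighbourhoods. -/
theorem exists_isConvexChart_of_injective {O : Opens N} {c : O → A} (hc : IsLocalAffineIso A A c)
    (hi : Function.Injective c) {O' : Opens N} {x : N} (hx : x ∈ O) (hx' : x ∈ O') :
    ∃ (W : Opens N) (hW : W ≤ O), x ∈ W ∧ W ≤ O' ∧ IsConvexChart fun y : W => c ⟨y.1, hW y.2⟩ := by
  have ho : IsOpen (c '' {y | y.1 ∈ O'}) :=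
    hc.isOpenMap _ (O'.2.preimage continuous_subtype_val)
  obtain ⟨r, hr, hb⟩ := Metric.isOpen_iff.1 ho (c ⟨x, hx⟩) ⟨_, hx', rfl⟩
  let W : Opens N := ⟨Subtype.val '' (c ⁻¹' Metric.ball (c ⟨x, hx⟩) r),
    O.2.isOpenMap_subtype_val _ (Metric.isOpen_ball.preimage hc.continuous)⟩
  have hW : W ≤ O := by
    rintro _ ⟨y, -, rfl⟩
    exact y.2
  refine ⟨W, hW, ⟨_, Metric.mem_ball_self hr, rfl⟩, ?_, ?_, ?_, ?_⟩
  · rintro _ ⟨y, hy, rfl⟩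
    obtain ⟨z, hz, hzy⟩ := hb hy
    rwa [← hi hzy]
  · exact hc.comp ((isLocalAffineIso_val W).codRestrict O fun y => hW y.2)
  · exact fun y z hyz => Subtype.ext (congrArg (fun t : O => t.1) (hi hyz))
  · convert! convex_ball (c ⟨x, hx⟩) r
    ext a
    constructor
    · rintro ⟨⟨_, y, hy, rfl⟩, rfl⟩
      exact hy
    · intro ha
      obtain ⟨z, -, rfl⟩ := hb ha
      exact ⟨⟨z.1, z, ha, rfl⟩, rfl⟩

theorem exists_isConvexChart [HasGroupoid N (affineGroupoid A)] {O : Opens N} {x : N}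
    (hx : x ∈ O) : ∃ (W : Opens N) (c : W → A), x ∈ W ∧ W ≤ O ∧ IsConvexChart c := by
  let O' : Opens N := ⟨(chartAt A x).source, (chartAt A x).open_source⟩
  obtain ⟨W, hW, hxW, hWO, h⟩ := exists_isConvexChart_of_injective (O := O')
    (c := fun y : O' => chartAt A x y.1)
    (fun y => (isIsoAt_chart (chart_mem_atlas A x) y.2).comp (isIsoAt_val y))
    (fun y z hyz => Subtype.ext ((chartAt A x).injOn y.2 z.2 hyz)) (mem_chart_source A x) hx
  exact ⟨W, _, hxW, hWO, h⟩

end ConvexCharts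

/-! ### Trivializations and frames -/

section Frames

variable {A : Type v} [NormedAddCommGroup A] [NormedSpace ℝ A] [FiniteDimensional ℝ A]
  {B : Type w} [NormedAddCommGroup B] [NormedSpace ℝ B] [FiniteDimensional ℝ B]
  {N : Type u} [TopologicalSpace N] [ChartedSpace A N]
  {F : Type u} [TopologicalSpace F] [ChartedSpace B F]

section

variable {E : Type u} [TopologicalSpace E] [ChartedSpace (A × B) E] {π : E → N} {U V : Opens N}
  {Φ Ψ : V × F → E}

theorem IsTrivialization.restrict (hΦ : IsTrivialization A B π U V Φ) {W : Opens N} (hW : W ≤ V) :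
    IsTrivialization A B π U W fun z => Φ (⟨z.1.1, hW z.1.2⟩, z.2) where
  le := hW.trans hΦ.le
  proj z := hΦ.proj _
  injective z z' h := by
    have h1 := hΦ.injective h
    have h2 := congrArg (fun t => (t.1 : N)) h1
    have h3 := congrArg Prod.snd h1
    exact Prod.ext (Subtype.ext h2) h3
  surjective e he := by
    obtain ⟨z, rfl⟩ := hΦ.surjective e (hW he)
    rw [hΦ.proj] at he
    exact ⟨(⟨z.1.1, he⟩, z.2), rfl⟩
  affine := hΦ.affine.comp (isLocalAffineIso_inclusion_prod hW)

theorem IsTrivialization.comp_equiv (hΦ : IsTrivialization A B π U V Φ) (k : V × F ≃ V × F)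
    (hk : IsLocalAffineIso (A × B) (A × B) k) (hk' : ∀ z, (k z).1 = z.1) :
    IsTrivialization A B π U V fun z => Φ (k z) where
  le := hΦ.le
  proj z := by rw [hΦ.proj, hk']
  injective := hΦ.injective.comp k.injective
  surjective e he := by
    obtain ⟨z, rfl⟩ := hΦ.surjective e he
    exact ⟨k.symm z, by rw [k.apply_symm_apply]⟩
  affine := hΦ.affine.comp hk

theorem IsTrivialization.comp_aut (hΦ : IsTrivialization A B π U V Φ) (g : affAut B F) :
    IsTrivialization A B π U V fun z => Φ (z.1, g.1 z.2) :=
  hΦ.comp_equiv (Equiv.prodCongr (Equiv.refl V) g.1)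
    (fun z => IsIsoAt.prodMap (A := A) (B := B) (f := fun y : V => y) (g := g.1) (x := z)
      (isIsoAt_id _) (g.2.1.isIsoAt _)) fun _ => rfl

/-- The fibres of an affine automorphism of a product over the first factor. -/
theorem exists_affAut_of_equiv (k : V × F ≃ V × F) (hk : IsLocalAffineIso (A × B) (A × B) k)
    (hk' : ∀ z, (k z).1 = z.1) : ∃ g : V → affAut B F, ∀ z, k z = (z.1, (g z.1).1 z.2) := by
  have hs : ∀ z, (k.symm z).1 = z.1 := fun z => by rw [← hk', k.apply_symm_apply]
  have hi : ∀ (y : V) (f : F), IsAffineAt B (A × B) (fun f : F => (y, f)) f := fun y f =>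
    (isAffineAt_const (V := B) (V' := A) y f).prodMk (isIsoAt_id f).isAffineAt
  have h1 : ∀ y : V, IsAffineMap B B fun f : F => (k (y, f)).2 := fun y f =>
    IsAffineAt.comp (f := fun f : F => (y, f)) (g := fun z : V × F => (k z).2)
      ((isAffineAt_snd _).comp (hk.isAffineMap.isAffineAt _)) (hi y f)
  have h2 : ∀ y : V, IsAffineMap B B fun f : F => (k.symm (y, f)).2 := fun y f =>
    IsAffineAt.comp (f := fun f : F => (y, f)) (g := fun z : V × F => (k.symm z).2)
      ((isAffineAt_snd _).comp (hk.symm.isAffineMap.isAffineAt _)) (hi y f)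
  have h3 : ∀ y f, (k.symm (y, (k (y, f)).2)).2 = f := fun y f => by
    have : (y, (k (y, f)).2) = k (y, f) := Prod.ext (hk' (y, f)).symm rfl
    rw [this, k.symm_apply_apply]
  have h4 : ∀ y f, (k (y, (k.symm (y, f)).2)).2 = f := fun y f => by
    have : (y, (k.symm (y, f)).2) = k.symm (y, f) := Prod.ext (hs (y, f)).symm rfl
    rw [this, k.apply_symm_apply]
  refine ⟨fun y => ⟨⟨fun f => (k (y, f)).2, fun f => (k.symm (y, f)).2, h3 y, h4 y⟩, ?_, ?_⟩,
    fun z => Prod.ext (hk' z) rfl⟩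
  · exact fun f => ((h1 y).isAffineAt f).isIsoAt ((h2 y).isAffineAt _)
      (Filter.Eventually.of_forall (h3 y)) (Filter.Eventually.of_forall (h4 y))
  · exact fun f => ((h2 y).isAffineAt f).isIsoAt ((h1 y).isAffineAt _)
      (Filter.Eventually.of_forall (h4 y)) (Filter.Eventually.of_forall (h3 y))

/-- Two trivializations over the same open subset differ by an affine family of affine
automorphisms of the fibre. -/
theorem IsTrivialization.exists_transition {U' : Opens N} (hΦ : IsTrivialization A B π U V Φ)
    (hΨ : IsTrivialization A B π U' V Ψ) :
    ∃ g : V → affAut B F, (∀ z, Φ z = Ψ (z.1, (g z.1).1 z.2)) ∧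
      IsAffineMap (A × B) B fun z : V × F => (g z.1).1 z.2 := by
  have hm : ∀ z, π (Φ z) ∈ V := fun z => hΦ.proj z ▸ z.1.2
  -- `k` is `Ψ⁻¹ ∘ Φ`; it is a local affine isomorphism because `Ψ` is an open embedding and a local
  -- affine isomorphism.
  choose k hk using fun z => hΨ.surjective (Φ z) (hm z)
  have hb : Function.Bijective k := by
    refine ⟨fun z z' h => hΦ.injective ?_, fun z => ?_⟩
    · rw [← hk, ← hk, h]
    · obtain ⟨z', hz'⟩ := hΦ.surjective (Ψ z) (hΨ.proj z ▸ z.1.2)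
      exact ⟨z', hΨ.injective (by rw [hk, hz'])⟩
  have hka : IsLocalAffineIso (A × B) (A × B) k := fun z =>
    IsIsoAt.of_isLocalAffineIso_comp hΨ.affine hΨ.injective
      ((hΦ.affine.isIsoAt z).congr (Filter.Eventually.of_forall fun z => (hk z).symm))
  have hk' : ∀ z, (k z).1 = z.1 := fun z => Subtype.ext (by rw [← hΨ.proj, hk, hΦ.proj])
  obtain ⟨g, hg⟩ := exists_affAut_of_equiv (Equiv.ofBijective k hb) hka hk'
  have hg' : ∀ z, k z = (z.1, (g z.1).1 z.2) := hg
  refine ⟨g, fun z => by rw [← hg', hk], fun z => ?_⟩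
  exact (IsAffineAt.comp (isAffineAt_snd (V := A) (V' := B) _) (hka.isAffineMap.isAffineAt z)).congr
    (Filter.Eventually.of_forall fun z => congrArg Prod.snd (hg' z))

end

namespace AffBundle

variable {U U' : Opens N} {E : AffBundle A B F U} {E' : AffBundle A B F U'} {x : N}

theorem Frame.mem (φ : E.Frame x) : x ∈ U := by
  obtain ⟨φ, V, Φ, hx, hΦ, -⟩ := φ
  exact hΦ.le hx

theorem Frame.proj (φ : E.Frame x) (f : F) : E.proj (φ.1 f) = x := by
  obtain ⟨φ, V, Φ, hx, hΦ, hφ⟩ := φ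
  exact (congrArg E.proj (hφ f)).trans (hΦ.proj _)

theorem Frame.injective (φ : E.Frame x) : Function.Injective φ.1 := by
  obtain ⟨φ, V, Φ, hx, hΦ, hφ⟩ := φ
  intro f f' h
  refine congrArg Prod.snd (hΦ.injective (a₁ := (⟨x, hx⟩, f)) (a₂ := (⟨x, hx⟩, f')) ?_)
  rw [← hφ, ← hφ]
  exact h

theorem Frame.surjective (φ : E.Frame x) {e : E.total} (he : E.proj e = x) : ∃ f, φ.1 f = e := by
  obtain ⟨φ, V, Φ, hx, hΦ, hφ⟩ := φ
  subst he
  obtain ⟨⟨y, f⟩, hz⟩ := hΦ.surjective e hx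
  have hy : y = ⟨E.proj e, hx⟩ := Subtype.ext ((hΦ.proj (y, f)).symm.trans (congrArg E.proj hz))
  exact ⟨f, (hφ f).trans (by rw [← hy, hz])⟩

theorem exists_frame (E : AffBundle A B F U) (hx : x ∈ U) : Nonempty (E.Frame x) := by
  obtain ⟨V, Φ, hxV, hΦ⟩ := E.locally_trivial x hx
  exact ⟨E.frameOf hΦ ⟨x, hxV⟩⟩

/-- Composition of a frame with an affine automorphism of the fibre. -/
def Frame.comp (φ : E.Frame x) (g : affAut B F) : E.Frame x :=
  ⟨fun f => φ.1 (g.1 f), by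
    obtain ⟨φ, V, Φ, hx, hΦ, hφ⟩ := φ
    exact ⟨V, _, hx, hΦ.comp_aut g, fun f => hφ _⟩⟩

theorem Frame.exists_comp (φ ψ : E.Frame x) : ∃ g : affAut B F, ∀ f, ψ.1 f = φ.1 (g.1 f) := by
  obtain ⟨φ, V, Φ, hx, hΦ, hφ⟩ := φ
  obtain ⟨ψ, V', Ψ, hx', hΨ, hψ⟩ := ψ
  obtain ⟨g, hg, -⟩ := (hΨ.restrict (inf_le_right : V ⊓ V' ≤ V')).exists_transition
    (hΦ.restrict (inf_le_left : V ⊓ V' ≤ V))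
  refine ⟨g ⟨x, hx, hx'⟩, fun f => ?_⟩
  exact (hψ f).trans ((hg (⟨x, hx, hx'⟩, f)).trans (hφ _).symm)

/-- Affine isomorphisms over the base of a bundle with the part of another one over an open
subset. -/
structure IsEmbedding (E : AffBundle A B F U) (E' : AffBundle A B F U') (ψ : E.total → E'.total) :
    Prop where
  le : U ≤ U'
  injective : Function.Injective ψ
  affine : IsLocalAffineIso (A × B) (A × B) ψ
  proj : ∀ e, E'.proj (ψ e) = E.proj e
  surjective : ∀ e', E'.proj e' ∈ U → ∃ e, ψ e = e'

namespace IsEmbedding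

variable {ψ : E.total → E'.total}

theorem isTrivialization (hψ : IsEmbedding E E' ψ) {V : Opens N} {Φ : V × F → E.total}
    (hΦ : IsTrivialization A B E.proj U V Φ) :
    IsTrivialization A B E'.proj U' V fun z => ψ (Φ z) where
  le := hΦ.le.trans hψ.le
  proj z := by rw [hψ.proj, hΦ.proj]
  injective := hψ.injective.comp hΦ.injective
  surjective e he := by
    obtain ⟨e, rfl⟩ := hψ.surjective e (hΦ.le he)
    obtain ⟨z, rfl⟩ := hΦ.surjective e (hψ.proj e ▸ he)
    exact ⟨z, rfl⟩
  affine := hψ.affine.comp hΦ.affine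

theorem exists_isTrivialization (hψ : IsEmbedding E E' ψ) {V : Opens N} {Φ : V × F → E'.total}
    (hΦ : IsTrivialization A B E'.proj U' V Φ) (hV : V ≤ U) :
    ∃ Ψ : V × F → E.total, IsTrivialization A B E.proj U V Ψ ∧ ∀ z, ψ (Ψ z) = Φ z := by
  choose Ψ hΨ using fun z => hψ.surjective (Φ z) (hΦ.proj z ▸ hV z.1.2)
  refine ⟨Ψ, ⟨hV, fun z => ?_, fun z z' h => hΦ.injective ?_, fun e he => ?_, fun z => ?_⟩, hΨ⟩
  · rw [← hψ.proj, hΨ, hΦ.proj]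
  · rw [← hΨ, ← hΨ, h]
  · obtain ⟨z, hz⟩ := hΦ.surjective (ψ e) (hψ.proj e ▸ he)
    exact ⟨z, hψ.injective (by rw [hΨ, hz])⟩
  · exact IsIsoAt.of_isLocalAffineIso_comp hψ.affine hψ.injective
      ((hΦ.affine.isIsoAt z).congr (Filter.Eventually.of_forall fun z => (hΨ z).symm))

/-- The image of a frame. -/
def mapFrame (hψ : IsEmbedding E E' ψ) (φ : E.Frame x) : E'.Frame x :=
  ⟨fun f => ψ (φ.1 f), by
    obtain ⟨φ, V, Φ, hx, hΦ, hφ⟩ := φ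
    exact ⟨V, _, hx, hψ.isTrivialization hΦ, fun f => congrArg ψ (hφ f)⟩⟩

theorem exists_mapFrame (hψ : IsEmbedding E E' ψ) (hx : x ∈ U) (φ : E'.Frame x) :
    ∃ φ' : E.Frame x, hψ.mapFrame φ' = φ := by
  obtain ⟨φ, V, Φ, hxV, hΦ, hφ⟩ := φ
  obtain ⟨Ψ, hΨ, hΨ'⟩ := hψ.exists_isTrivialization
    (hΦ.restrict (inf_le_left : V ⊓ U ≤ V)) inf_le_right
  exact ⟨E.frameOf hΨ ⟨x, hxV, hx⟩, Subtype.ext (funext fun f =>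
    (hΨ' (⟨x, hxV, hx⟩, f)).trans (hφ f).symm)⟩

end IsEmbedding

end AffBundle

end Frames

/-! ### Sections of flat principal bundles -/

namespace FlatBundle

variable {G : Type u} [Group G] {X : Type u} [TopologicalSpace X] {P : FlatBundle G X}

theorem eq_one_of_smul_eq {g : G} {p : P.total} (h : MulOpposite.op g • p = p) : g = 1 :=
  MulOpposite.op_injective ((P.simply_transitive p p rfl).unique h.symm (one_smul _ p).symm)

theorem exists_smul {p p' : P.total} (h : P.proj p = P.proj p') :
    ∃ g : G, p' = MulOpposite.op g • p := by
  obtain ⟨g, hg, -⟩ := P.simply_transitive p p' h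
  exact ⟨g.unop, hg⟩

theorem exists_section (P : FlatBundle G X) (x : X) : ∃ (V : Opens X) (σ : V → P.total),
    x ∈ V ∧ Continuous σ ∧ ∀ y, P.proj (σ y) = y.1 := by
  obtain ⟨p, rfl⟩ := P.surjective x
  obtain ⟨e, hp, he⟩ := P.isCoveringMap.isLocalHomeomorph p
  refine ⟨⟨e.target, e.open_target⟩, fun y => e.symm y.1, ?_,
    continuousOn_iff_continuous_domRestrict.1 e.continuousOn_symm, fun y => ?_⟩
  · change P.proj p ∈ e.target
    rw [he]
    exact e.map_source hp
  · rw [he]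
    exact e.right_inv y.2

/-- The projection of a covering is locally injective, so lifts of the same map which agree at a
point agree nearby, with no connectedness assumption. -/
theorem eventually_eq {Y : Type*} [TopologicalSpace Y] {σ τ : Y → P.total}
    (h : ∀ y, P.proj (σ y) = P.proj (τ y)) {y₀ : Y} (hσ : ContinuousAt σ y₀)
    (hτ : ContinuousAt τ y₀) (h₀ : σ y₀ = τ y₀) : ∀ᶠ y in 𝓝 y₀, σ y = τ y := by
  obtain ⟨e, hp, he⟩ := P.isCoveringMap.isLocalHomeomorph (σ y₀)
  have hs := e.open_source.mem_nhds hp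
  filter_upwards [hσ.eventually hs, hτ.eventually (h₀ ▸ hs)] with y h1 h2
  refine e.injOn h1 h2 ?_
  rw [← he]
  exact h y

end FlatBundle

/-! ### Marked bundles: adapted trivializations, morphisms, products -/

section Marked

variable {A : Type v} [NormedAddCommGroup A] [NormedSpace ℝ A] [FiniteDimensional ℝ A]
  {B : Type w} [NormedAddCommGroup B] [NormedSpace ℝ B] [FiniteDimensional ℝ B]
  {N : Type u} [TopologicalSpace N] [ChartedSpace A N] [HasGroupoid N (affineGroupoid A)]
  {F : Type u} [TopologicalSpace F] [T2Space F] [ChartedSpace B F]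
  [HasGroupoid F (affineGroupoid B)] [CompleteAffine B F]

/-- The classes modulo translations of the members of an affine family of affine automorphisms are
locally constant. -/
theorem eventually_outer_eq {V : Opens N} {g : V → affAut B F}
    (hg : IsAffineMap (A × B) B fun w : V × F => (g w.1).1 w.2) (y₀ : V) :
    ∀ᶠ y in 𝓝 y₀, (g y : OuterGroup B F) = g y₀ := by
  obtain ⟨Γ, q, hq⟩ := CompleteAffine.exists_quotient (B := B) (F := F)
  obtain ⟨W, c, hyW, hWV, hc⟩ := exists_isConvexChart (A := A) y₀.2
  have := hc.preconnectedSpace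
  have hg' : IsAffineMap (A × B) B fun w : W × F => (g ⟨w.1.1, hWV w.1.2⟩).1 w.2 :=
    hg.comp (isLocalAffineIso_inclusion_prod hWV).isAffineMap
  filter_upwards [continuous_subtype_val.continuousAt.eventually (W.2.mem_nhds hyW)] with y hy
  rw [QuotientGroup.eq_iff_div_mem, div_eq_mul_inv]
  exact hq.mul_inv_mem_translations (g := fun y : W => g ⟨y.1, hWV y.2⟩) hc.affine hg' ⟨y₀.1, hyW⟩ ⟨y.1, hy⟩

namespace MarkedBundle

variable {P : FlatBundle (OuterGroup B F) N} {U : Opens N}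

theorem marking_frame_comp (X : MarkedBundle (A := A) P U) {x : N} (φ : X.Frame x)
    (g : affAut B F) :
    X.marking x (φ.comp g) = MulOpposite.op (g : OuterGroup B F) • X.marking x φ :=
  X.marking_comp x _ _ g fun _ => rfl

/-- Frames can be changed by any affine automorphism of `F`, and the classes of these act
transitively on the fibre of `P`. -/
theorem exists_frame_marking (X : MarkedBundle (A := A) P U) {p : P.total} {x : N} (hx : x ∈ U)
    (hp : P.proj p = x) : ∃ φ : X.Frame x, X.marking x φ = p := by
  obtain ⟨φ⟩ := X.toAffBundle.exists_frame hx
  obtain ⟨g, hg⟩ := FlatBundle.exists_smul (p := X.marking x φ) (p' := p)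
    (by rw [X.proj_marking, hp])
  obtain ⟨g, rfl⟩ := QuotientGroup.mk_surjective g
  exact ⟨φ.comp g, by rw [X.marking_frame_comp, hg]⟩

/-- Over a connected open subset, a trivialization can be adjusted to a given section of `P`. -/
theorem exists_isTrivialization_marking (X : MarkedBundle (A := A) P U) {V : Opens N}
    [PreconnectedSpace V] {Φ : V × F → X.total} (hΦ : IsTrivialization A B X.proj U V Φ)
    {σ : V → P.total} (hσ : ∀ y, P.proj (σ y) = y.1) (hc : Continuous σ) :
    ∃ (Ψ : V × F → X.total) (hΨ : IsTrivialization A B X.proj U V Ψ),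
      ∀ y, X.marking y.1 (X.frameOf hΨ y) = σ y := by
  rcases isEmpty_or_nonempty V with hV | ⟨⟨y₀⟩⟩
  · exact ⟨Φ, hΦ, fun y => hV.elim y⟩
  obtain ⟨g, hg⟩ := FlatBundle.exists_smul (p := X.marking y₀.1 (X.frameOf hΦ y₀)) (p' := σ y₀)
    (by rw [X.proj_marking, hσ])
  obtain ⟨g, rfl⟩ := QuotientGroup.mk_surjective g
  refine ⟨_, hΦ.comp_aut g, fun y => ?_⟩
  -- Both sides are continuous lifts of the inclusion of a connected set to the covering `P`, and
  -- `g` was chosen so that they agree at `y₀`.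
  refine congrFun (P.isCoveringMap.eq_of_comp_eq (X.continuous_marking V _ (hΦ.comp_aut g)) hc
    (funext fun y => ?_) y₀ ?_) y
  · exact (X.proj_marking _ _).trans (hσ y).symm
  · rw [hg]
    exact X.marking_frame_comp (X.frameOf hΦ y₀) g

theorem exists_local_trivialization_marking (X : MarkedBundle (A := A) P U) {x : N} {W : Opens N}
    (hx : x ∈ U) (hW : x ∈ W) {σ : W → P.total} (hσ : ∀ y, P.proj (σ y) = y.1)
    (hc : Continuous σ) :
    ∃ (V : Opens N) (hVW : V ≤ W) (Φ : V × F → X.total)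
      (hΦ : IsTrivialization A B X.proj U V Φ), x ∈ V ∧
      ∀ y, X.marking y.1 (X.frameOf hΦ y) = σ ⟨y.1, hVW y.2⟩ := by
  obtain ⟨V, Φ, hxV, hΦ⟩ := X.locally_trivial x hx
  obtain ⟨V', c, hxV', hV', hcV'⟩ := exists_isConvexChart (A := A) (O := V ⊓ W) ⟨hxV, hW⟩
  have := hcV'.preconnectedSpace
  obtain ⟨Ψ, hΨ, h⟩ := X.exists_isTrivialization_marking (hΦ.restrict (hV'.trans inf_le_left))
    (σ := fun y => σ ⟨y.1, (hV'.trans inf_le_right) y.2⟩) (fun y => hσ _)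
    (hc.comp (continuous_subtype_val.subtype_mk _))
  exact ⟨V', hV'.trans inf_le_right, Ψ, hΨ, hxV', h⟩

/-- Constructor for morphisms, where the compatibility with the markings is checked for one frame
at each point. -/
def homMk {X Y : MarkedBundle (A := A) P U} (k : X.total ≃ Y.total)
    (hk : IsLocalAffineIso (A × B) (A × B) k) (hp : ∀ e, Y.proj (k e) = X.proj e)
    (hm : ∀ x ∈ U, ∃ (φ : X.Frame x) (ψ : Y.Frame x), (∀ f, ψ.1 f = k (φ.1 f)) ∧
      Y.marking x ψ = X.marking x φ) : X ⟶ Y where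
  toEquiv := k
  affine := hk
  affine_symm := hk.symm
  proj := hp
  marking x φ ψ h := by
    obtain ⟨φ₀, ψ₀, h₀, hm₀⟩ := hm x φ.mem
    obtain ⟨g, hg⟩ := φ₀.exists_comp φ
    rw [X.marking_comp x φ₀ φ g hg, Y.marking_comp x ψ₀ ψ g fun f => ?_, hm₀]
    rw [h, hg, h₀]

theorem exists_hom_of_isTrivialization {X Y : MarkedBundle (A := A) P U} {Φ : U × F → X.total}
    {Ψ : U × F → Y.total} (hΦ : IsTrivialization A B X.proj U U Φ)
    (hΨ : IsTrivialization A B Y.proj U U Ψ)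
    (h : ∀ y : U, Y.marking y.1 (Y.frameOf hΨ y) = X.marking y.1 (X.frameOf hΦ y)) :
    Nonempty (X ⟶ Y) := by
  let i : U × F ≃ X.total := Equiv.ofBijective Φ
    ⟨hΦ.injective, fun e => hΦ.surjective e (X.proj_mem e)⟩
  let j : U × F ≃ Y.total := Equiv.ofBijective Ψ
    ⟨hΨ.injective, fun e => hΨ.surjective e (Y.proj_mem e)⟩
  have hi : IsLocalAffineIso (A × B) (A × B) i := hΦ.affine
  have hj : IsLocalAffineIso (A × B) (A × B) j := hΨ.affine
  refine ⟨homMk (i.symm.trans j) (hj.comp hi.symm) (fun e => ?_) fun x hx => ?_⟩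
  · obtain ⟨z, rfl⟩ := i.surjective e
    rw [Equiv.trans_apply, Equiv.symm_apply_apply]
    exact (hΨ.proj z).trans (hΦ.proj z).symm
  · refine ⟨X.frameOf hΦ ⟨x, hx⟩, Y.frameOf hΨ ⟨x, hx⟩, fun f => ?_, h ⟨x, hx⟩⟩
    exact (congrArg j (i.symm_apply_apply (⟨x, hx⟩, f))).symm

end MarkedBundle

variable (A) in
/-- The product bundle. -/
def productBundle (U : Opens N) : AffBundle A B F U where
  total := U × F
  proj z := z.1.1
  proj_mem z := z.1.2
  affine_proj z := IsAffineAt.comp (isIsoAt_val (V := A) _).isAffineAt (isAffineAt_fst z)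
  locally_trivial _ hx := ⟨U, id, hx, le_rfl, fun _ => rfl, Function.injective_id,
    fun e _ => ⟨e, rfl⟩, isLocalAffineIso_id⟩

theorem productBundle_isTrivialization (U : Opens N) :
    IsTrivialization A B (productBundle (A := A) (B := B) (F := F) U).proj U U id :=
  ⟨le_rfl, fun _ => rfl, Function.injective_id, fun e _ => ⟨e, rfl⟩, isLocalAffineIso_id⟩

theorem productBundle_exists_affAut {U : Opens N} {x : N}
    (φ : (productBundle (A := A) (B := B) (F := F) U).Frame x) :
    ∃ g : affAut B F, ∀ f, φ.1 f = ((⟨x, φ.mem⟩, g.1 f) : U × F) :=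
  ((productBundle (A := A) (B := B) (F := F) U).frameOf (productBundle_isTrivialization U)
    ⟨x, φ.mem⟩).exists_comp φ

/-- The product bundle, marked by a section of `P`. -/
def markedProduct (P : FlatBundle (OuterGroup B F) N) {U : Opens N} (σ : U → P.total)
    (hσ : ∀ y, P.proj (σ y) = y.1) (hc : Continuous σ) : MarkedBundle (A := A) P U where
  toAffBundle := productBundle A U
  marking x φ := MulOpposite.op
    ((productBundle_exists_affAut φ).choose : OuterGroup B F) • σ ⟨x, φ.mem⟩
  proj_marking x φ := by rw [P.proj_smul, hσ]
  marking_comp x φ ψ g h := by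
    have h1 := (productBundle_exists_affAut φ).choose_spec
    have h2 := (productBundle_exists_affAut ψ).choose_spec
    set g₁ := (productBundle_exists_affAut φ).choose
    set g₂ := (productBundle_exists_affAut ψ).choose
    have : g₂ = g₁ * g := by
      refine Subtype.ext (Equiv.ext fun f => ?_)
      have h3 : ((⟨x, ψ.mem⟩, g₂.1 f) : U × F) = (⟨x, φ.mem⟩, g₁.1 (g.1 f)) := by
        rw [← h1, ← h, ← h2]
      exact congrArg Prod.snd h3
    rw [this, QuotientGroup.mk_mul, MulOpposite.op_mul, mul_smul]
  continuous_marking V Φ hΦ := by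
    obtain ⟨g, hg, hga⟩ := hΦ.exists_transition
      ((productBundle_isTrivialization (A := A) (B := B) (F := F) U).restrict hΦ.le)
    -- The automorphism picked by choice is determined by the frame, so it is the transition map.
    have hm : ∀ y : V, (productBundle_exists_affAut
        ((productBundle (A := A) (B := B) (F := F) U).frameOf hΦ y)).choose = g y := by
      intro y
      have h1 := (productBundle_exists_affAut
        ((productBundle (A := A) (B := B) (F := F) U).frameOf hΦ y)).choose_spec
      refine Subtype.ext (Equiv.ext fun f => ?_)
      exact (congrArg Prod.snd (h1 f)).symm.trans (congrArg Prod.snd (hg (y, f)))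
    refine continuous_iff_continuousAt.2 fun y₀ => ?_
    -- The classes of the transition maps are locally constant, so near `y₀` the marking is `σ`
    -- moved by one fixed group element.
    have hcont : ContinuousAt (fun y : V => MulOpposite.op ((g y₀ : affAut B F) : OuterGroup B F) •
        σ ⟨y.1, hΦ.le y.2⟩) y₀ :=
      ((hc.comp (continuous_subtype_val.subtype_mk fun y : V => hΦ.le y.2)).const_smul
        (MulOpposite.op ((g y₀ : affAut B F) : OuterGroup B F))).continuousAt
    refine hcont.congr ?_
    filter_upwards [eventually_outer_eq hga y₀] with y hy
    rw [← hy, ← hm]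

end Marked

/-- Principal bundles with discrete structure group over a simply connected space are trivial: a
constant cocycle is the coboundary of a locally constant cochain. -/
theorem exists_locally_constant_cochain {X : Type*} [TopologicalSpace X] [SimplyConnectedSpace X]
    [LocallyPathConnectedSpace X] {G : Type*} [Group G] {ι : Type*} {V : ι → Set X}
    (hV : ∀ i, IsOpen (V i)) {idx : X → ι} (hidx : ∀ x, x ∈ V (idx x)) {t : ι → ι → G}
    (hself : ∀ i, (V i).Nonempty → t i i = 1)
    (hcomp : ∀ i j k, (V i ∩ V j ∩ V k).Nonempty → t k j * t j i = t k i) :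
    ∃ v : ι → X → G, (∀ i, ∀ x ∈ V i, ∀ᶠ y in 𝓝 x, v i y = v i x) ∧
      ∀ i j x, x ∈ V i → x ∈ V j → v j x = t j i * v i x := by
  let _ : TopologicalSpace G := ⊥
  have : DiscreteTopology G := ⟨rfl⟩
  -- The principal bundle of the cocycle, with coordinate changes given by left multiplication; its
  -- fibre is discrete, so it is a covering.
  let Z : FiberBundleCore ι X G :=
    { baseSet := V
      isOpen_baseSet := hV
      indexAt := idx
      mem_baseSet_at := hidx
      coordChange := fun i j _ g => t j i * g
      coordChange_self := fun i x hx g => by rw [hself i ⟨x, hx⟩, one_mul]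
      continuousOn_coordChange := fun i j =>
        ((continuous_of_discreteTopology (f := fun g : G => t j i * g)).comp
          continuous_snd).continuousOn
      coordChange_comp := fun i j k x hx g => by rw [← mul_assoc, hcomp i j k ⟨x, hx⟩] }
  have hcov : IsCoveringMap Z.proj := FiberBundle.isCoveringMap (F := G) (E := Z.Fiber)
  obtain ⟨x₀⟩ : Nonempty X := inferInstance
  -- A lift of the identity, that is, a global section; its coordinates in the local trivializations
  -- form the cochain.
  obtain ⟨s, ⟨-, hs⟩, -⟩ := hcov.existsUnique_continuousMap_lifts (ContinuousMap.id X) x₀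
    (⟨x₀, (1 : G)⟩ : Z.TotalSpace) rfl
  have hs' : ∀ x, (s x).1 = x := congrFun hs
  refine ⟨fun i x => (Z.localTriv i (s x)).2, fun i x hx => ?_, fun i j x hi hj => ?_⟩
  · have hm : s x ∈ (Z.localTriv i).source := by
      rw [FiberBundleCore.mem_localTriv_source, hs']
      exact hx
    have hc : ContinuousAt (fun y => (Z.localTriv i (s y)).2) x :=
      (((Z.localTriv i).toOpenPartialHomeomorph.continuousAt hm).comp s.continuous.continuousAt).snd
    exact hc.eventually (IsOpen.mem_nhds (isOpen_discrete {(Z.localTriv i (s x)).2}) rfl)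
  · let g : G := (s x).2
    change t j (idx (s x).1) * g = t j i * (t i (idx (s x).1) * g)
    rw [← mul_assoc, hcomp (idx (s x).1) i j ⟨x, ⟨by rw [hs']; exact hidx x, hi⟩, hj⟩]

/-! ### Triviality of bundles over the domains of convex charts -/

section Trivial

variable {A : Type v} [NormedAddCommGroup A] [NormedSpace ℝ A] [FiniteDimensional ℝ A]
  {B : Type w} [NormedAddCommGroup B] [NormedSpace ℝ B] [FiniteDimensional ℝ B]
  {N : Type u} [TopologicalSpace N] [ChartedSpace A N] [HasGroupoid N (affineGroupoid A)]
  {F : Type u} [TopologicalSpace F] [T2Space F] [ChartedSpace B F]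
  [HasGroupoid F (affineGroupoid B)] [CompleteAffine B F]

variable (A B F) in
/-- The group of affine automorphisms of a product over the first factor. -/
def prodAut (O : Opens N) : Subgroup (Equiv.Perm (O × F)) where
  carrier := {k | IsLocalAffineIso (A × B) (A × B) k ∧ ∀ z, (k z).1 = z.1}
  mul_mem' ha hb := ⟨ha.1.comp hb.1, fun z => (ha.2 _).trans (hb.2 z)⟩
  one_mem' := ⟨isLocalAffineIso_id, fun _ => rfl⟩
  inv_mem' {k} h := ⟨h.1.symm, fun z => by
    rw [← h.2]
    exact congrArg Prod.fst (k.apply_symm_apply z)⟩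

theorem CompleteAffine.connectedSpace (B : Type*) [NormedAddCommGroup B] [NormedSpace ℝ B]
    [FiniteDimensional ℝ B] (F : Type*) [TopologicalSpace F] [ChartedSpace B F]
    [CompleteAffine B F] : ConnectedSpace F := by
  obtain ⟨Γ, q, hq⟩ := CompleteAffine.exists_quotient (B := B) (F := F)
  have := hq.preconnectedSpace
  exact { toNonempty := ⟨q 0⟩ }

/-- This is the identity theorem on the connected manifold `O × F`. It reduces the cocycle
identities between extended transition maps to their validity on one overlap. -/
theorem prodAut_ext {O : Opens N} [PreconnectedSpace O] {k k' : prodAut A B F O} {y₀ : O}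
    (h : ∀ᶠ y in 𝓝 y₀, ∀ f, (k.1 (y, f)).2 = (k'.1 (y, f)).2) : k = k' := by
  have := CompleteAffine.connectedSpace B F
  have hk : ∀ k : prodAut A B F O, IsAffineMap (A × B) B fun z => (k.1 z).2 := fun k z =>
    IsAffineAt.comp (isAffineAt_snd (V := A) (V' := B) _) (k.2.1.isAffineMap.isAffineAt z)
  obtain ⟨f₀⟩ : Nonempty F := inferInstance
  have h2 := (hk k).eq_of_eventuallyEq (hk k') (x₀ := (y₀, f₀))
    ((continuousAt_fst.eventually h).mono fun z hz => hz z.2)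
  refine Subtype.ext (Equiv.ext fun z => Prod.ext ?_ (congrFun h2 z))
  rw [k.2.2, k'.2.2]

/-- Transition maps over connected open subsets of a chart domain extend to the domain. -/
theorem exists_prodAut {O W : Opens N} (hWO : W ≤ O) [PreconnectedSpace O]
    [PreconnectedSpace W] [Nonempty W] {c : O → A} (hc : IsLocalAffineIso A A c)
    {g g' : W → affAut B F}
    (hg : IsAffineMap (A × B) B fun z : W × F => (g z.1).1 z.2)
    (hg' : IsAffineMap (A × B) B fun z : W × F => (g' z.1).1 z.2)
    (h : ∀ y f, (g y).1 ((g' y).1 f) = f) (h' : ∀ y f, (g' y).1 ((g y).1 f) = f) :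
    ∃ k : prodAut A B F O, ∀ (y : W) f, (k.1 (⟨y.1, hWO y.2⟩, f)).2 = (g y).1 f := by
  obtain ⟨Γ, q, hq⟩ := CompleteAffine.exists_quotient (B := B) (F := F)
  have := CompleteAffine.connectedSpace B F
  obtain ⟨H, hH, hHg⟩ := hq.exists_extension hWO hc hg
  obtain ⟨H', hH', hHg'⟩ := hq.exists_extension hWO hc hg'
  -- That the two extensions are inverse to each other holds over `W`, and the identity theorem
  -- carries it to `O`.
  have key : ∀ {g g' : W → affAut B F} {H H' : O × F → F}, IsAffineMap (A × B) B H →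
      IsAffineMap (A × B) B H' → (∀ (y : W) f, H (⟨y.1, hWO y.2⟩, f) = (g y).1 f) →
      (∀ (y : W) f, H' (⟨y.1, hWO y.2⟩, f) = (g' y).1 f) →
      (∀ y f, (g y).1 ((g' y).1 f) = f) → ∀ z : O × F, H (z.1, H' z) = z.2 := by
    intro g g' H H' hH hH' hHg hHg' h
    obtain ⟨y₀⟩ := ‹Nonempty W›
    obtain ⟨f₀⟩ : Nonempty F := inferInstance
    have h1 : IsAffineMap (A × B) B fun z : O × F => H (z.1, H' z) := fun z =>
      IsAffineAt.comp (f := fun z : O × F => (z.1, H' z)) (hH.isAffineAt _)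
        ((isAffineAt_fst z).prodMk (hH'.isAffineAt z))
    refine congrFun (h1.eq_of_eventuallyEq (g := fun z : O × F => z.2)
      (fun z => isAffineAt_snd z) (x₀ := (⟨y₀.1, hWO y₀.2⟩, f₀)) ?_)
    have : ∀ᶠ z : O × F in 𝓝 (⟨y₀.1, hWO y₀.2⟩, f₀), z.1.1 ∈ W :=
      (continuous_subtype_val.comp continuous_fst).continuousAt.eventually (W.2.mem_nhds y₀.2)
    filter_upwards [this] with z hz
    have e1 := hHg' ⟨z.1.1, hz⟩ z.2
    have e2 := hHg ⟨z.1.1, hz⟩ ((g' ⟨z.1.1, hz⟩).1 z.2)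
    rw [h, ← e1] at e2
    exact e2
  have hl := key hH hH' hHg hHg' h
  have hr := key hH' hH hHg' hHg h'
  refine ⟨⟨⟨fun z => (z.1, H z), fun z => (z.1, H' z), fun z => Prod.ext rfl (hr z),
    fun z => Prod.ext rfl (hl z)⟩, fun z => ?_, fun z => rfl⟩, hHg⟩
  refine IsAffineAt.isIsoAt (g := fun z : O × F => (z.1, H' z))
    ((isAffineAt_fst z).prodMk (hH.isAffineAt z)) ((isAffineAt_fst _).prodMk (hH'.isAffineAt _))
    (Filter.Eventually.of_forall fun z => Prod.ext rfl (hr z))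
    (Filter.Eventually.of_forall fun z => Prod.ext rfl (hl z))

/-- Convexity in the common chart `c` makes the overlap connected, so a single automorphism of `O ×
F` describes the transition on all of it. -/
theorem IsTrivialization.exists_prodAut {E : Type u} [TopologicalSpace E] [ChartedSpace (A × B) E]
    {π : E → N} {U O V V' : Opens N} {c : O → A} (hc : IsConvexChart c) (hV : V ≤ O) (hV' : V' ≤ O)
    (hcV : IsConvexChart fun y : V => c ⟨y.1, hV y.2⟩)
    (hcV' : IsConvexChart fun y : V' => c ⟨y.1, hV' y.2⟩) {Φ : V × F → E} {Φ' : V' × F → E}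
    (hΦ : IsTrivialization A B π U V Φ) (hΦ' : IsTrivialization A B π U V' Φ')
    (hne : ((V : Set N) ∩ V').Nonempty) :
    ∃ k : prodAut A B F O, ∀ (y : N) (hy : y ∈ V) (hy' : y ∈ V') f,
      Φ' (⟨y, hy'⟩, f) = Φ (⟨y, hy⟩, (k.1 (⟨y, hV hy⟩, f)).2) := by
  have := hc.preconnectedSpace
  have := (hcV.inf hV hV' hcV' hc.injective).preconnectedSpace
  have : Nonempty ↥(V ⊓ V') := ⟨⟨hne.choose, hne.choose_spec⟩⟩
  have h1 := hΦ.restrict (inf_le_left : V ⊓ V' ≤ V)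
  have h2 := hΦ'.restrict (inf_le_right : V ⊓ V' ≤ V')
  obtain ⟨g, hg, hga⟩ := h2.exists_transition h1
  obtain ⟨g', hg', hga'⟩ := h1.exists_transition h2
  have e1 : ∀ y f, (g y).1 ((g' y).1 f) = f := fun y f =>
    congrArg Prod.snd (h1.injective (a₁ := (y, (g y).1 ((g' y).1 f))) (a₂ := (y, f))
      ((hg (y, (g' y).1 f)).symm.trans (hg' (y, f)).symm))
  have e2 : ∀ y f, (g' y).1 ((g y).1 f) = f := fun y f =>
    congrArg Prod.snd (h2.injective (a₁ := (y, (g' y).1 ((g y).1 f))) (a₂ := (y, f))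
      ((hg' (y, (g y).1 f)).symm.trans (hg (y, f)).symm))
  obtain ⟨k, hk⟩ := AffineGerbe.exists_prodAut (inf_le_left.trans hV) hc.affine hga hga' e1 e2
  refine ⟨k, fun y hy hy' f => (hg (⟨y, hy, hy'⟩, f)).trans ?_⟩
  rw [← hk ⟨y, hy, hy'⟩ f]

/-- Affinely locally trivial bundles are trivial over the domains of convex charts. -/
theorem AffBundle.exists_isTrivialization {U O : Opens N} (E : AffBundle A B F U) (hO : O ≤ U)
    {c : O → A} (hc : IsConvexChart c) :
    ∃ Φ : O × F → E.total, IsTrivialization A B E.proj U O Φ := by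
  classical
  rcases isEmpty_or_nonempty O with hO' | hO'
  · exact ⟨fun z => (hO'.false z.1).elim, hO, fun z => (hO'.false z.1).elim,
      fun z => (hO'.false z.1).elim, fun e he => (hO'.false ⟨_, he⟩).elim,
      fun z => (hO'.false z.1).elim⟩
  have hex : ∀ x : O, ∃ (V : Opens N) (hV : V ≤ O) (Φ : V × F → E.total), x.1 ∈ V ∧
      IsConvexChart (fun y : V => c ⟨y.1, hV y.2⟩) ∧ IsTrivialization A B E.proj U V Φ := by
    intro x
    obtain ⟨V, Φ, hxV, hΦ⟩ := E.locally_trivial x.1 (hO x.2)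
    obtain ⟨W, hW, hxW, hWV, hcW⟩ :=
      exists_isConvexChart_of_injective hc.affine hc.injective x.2 hxV
    exact ⟨W, hW, _, hxW, hcW, hΦ.restrict hWV⟩
  choose V hV Φ hxV hcV hΦ using hex
  have hk := fun a b => IsTrivialization.exists_prodAut hc (hV a) (hV b) (hcV a) (hcV b) (hΦ a)
    (hΦ b)
  -- The transitions become elements of one group of automorphisms of `O × F`, that is, a constant
  -- cocycle. Nothing depends on the value `1` given to empty overlaps.
  let t : O → O → prodAut A B F O := fun a b =>
    if h : ((V a : Set N) ∩ V b).Nonempty then (hk a b h).choose else 1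
  have ht : ∀ (a b : O) (y : N) (hy : y ∈ V a) (hy' : y ∈ V b) f,
      Φ b (⟨y, hy'⟩, f) = Φ a (⟨y, hy⟩, ((t a b).1 (⟨y, hV a hy⟩, f)).2) := by
    intro a b y hy hy' f
    have hne : ((V a : Set N) ∩ V b).Nonempty := ⟨y, hy, hy'⟩
    simp only [t, dif_pos hne]
    exact (hk a b hne).choose_spec y hy hy' f
  have hpre := hc.preconnectedSpace
  have hsc := hc.contractibleSpace
  have hlc := hc.locallyPathConnectedSpace
  have hfst : ∀ (k : prodAut A B F O) (y : O) (f : F), k.1 (y, f) = (y, (k.1 (y, f)).2) :=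
    fun k y f => Prod.ext (k.2.2 (y, f)) rfl
  have hinj : ∀ (a : O) (y : V a) {f f' : F}, Φ a (y, f) = Φ a (y, f') → f = f' :=
    fun a y f f' h => congrArg Prod.snd ((hΦ a).injective h)
  have hVo : ∀ a : O, IsOpen {y : O | y.1 ∈ V a} := fun a =>
    (V a).2.preimage continuous_subtype_val
  obtain ⟨v, hv, hvt⟩ := exists_locally_constant_cochain (X := O) (G := prodAut A B F O)
    (V := fun a : O => {y : O | y.1 ∈ V a}) hVo (idx := fun a => a) hxV (t := t)
    (fun a ⟨y, hy⟩ => prodAut_ext (y₀ := y) (by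
      filter_upwards [(hVo a).mem_nhds hy] with z hz f
      exact hinj a ⟨z.1, hz⟩ (ht a a z.1 hz hz f).symm))
    (fun i j k ⟨y, ⟨hi, hj⟩, hk⟩ => prodAut_ext (y₀ := y) (by
      filter_upwards [(hVo i).mem_nhds hi, (hVo j).mem_nhds hj, (hVo k).mem_nhds hk]
        with z zi zj zk f
      refine hinj k ⟨z.1, zk⟩ ?_
      rw [← ht k i z.1 zk zi f, ht j i z.1 zj zi f, ht k j z.1 zk zj]
      change Φ k (_, ((t k j).1 ((t j i).1 (z, f))).2) = _
      rw [hfst (t j i)]))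
  -- Over `y` the trivialization with index `y` is used, corrected by the cochain; `hΨ` says that
  -- any other index gives the same map.
  let Ψ : O × F → E.total := fun z => Φ z.1 (⟨z.1.1, hxV z.1⟩, ((v z.1 z.1).1 z).2)
  have hΨ : ∀ (a : O) (z : O × F) (hz : z.1.1 ∈ V a),
      Ψ z = Φ a (⟨z.1.1, hz⟩, ((v a z.1).1 z).2) := by
    intro a z hz
    have h1 := hvt z.1 a z.1 (hxV z.1) hz
    rw [h1]
    change Φ z.1 (_, ((v z.1 z.1).1 z).2) = Φ a (_, ((t a z.1).1 ((v z.1 z.1).1 z)).2)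
    rw [ht a z.1 z.1.1 hz (hxV z.1)]
    congr 3
    exact congrArg _ (Prod.ext ((v z.1 z.1).2.2 z).symm rfl)
  have hp : ∀ z, E.proj (Ψ z) = z.1 := fun z => (hΦ z.1).proj _
  refine ⟨Ψ, hO, hp, fun z z' h => ?_, fun e he => ?_, fun z => ?_⟩
  · have h1 : z.1 = z'.1 := Subtype.ext (by rw [← hp, ← hp, h])
    obtain ⟨y, f⟩ := z
    obtain ⟨y', f'⟩ := z'
    obtain rfl : y = y' := h1
    have h2 := hinj y ⟨y.1, hxV y⟩ h
    exact (v y y).1.injective (by rw [hfst _ y f, hfst _ y f', h2])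
  · obtain ⟨z, hz⟩ := (hΦ ⟨_, he⟩).surjective e (hxV ⟨_, he⟩)
    refine ⟨(v ⟨_, he⟩ ⟨_, he⟩).1.symm (⟨_, he⟩, z.2), ?_⟩
    have h1 : ((v ⟨_, he⟩ ⟨_, he⟩).1.symm (⟨_, he⟩, z.2)).1 = ⟨E.proj e, he⟩ := by
      rw [← (v ⟨_, he⟩ ⟨_, he⟩).2.2, Equiv.apply_symm_apply]
    have h2 : ((v ⟨_, he⟩ ⟨_, he⟩).1.symm (⟨_, he⟩, z.2)).1.1 ∈ V ⟨_, he⟩ := by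
      rw [h1]
      exact hxV ⟨_, he⟩
    rw [hΨ ⟨_, he⟩ _ h2]
    have h3 : v ⟨_, he⟩ ((v ⟨_, he⟩ ⟨_, he⟩).1.symm (⟨_, he⟩, z.2)).1 = v ⟨_, he⟩ ⟨_, he⟩ := by
      rw [h1]
    rw [h3, Equiv.apply_symm_apply]
    have h4 : ((⟨_, h2⟩, z.2) : V ⟨_, he⟩ × F) = z := by
      refine Prod.ext (Subtype.ext ?_) rfl
      refine (congrArg (fun t : O => t.1) h1).trans ?_
      rw [← (hΦ ⟨_, he⟩).proj z, hz]
    exact (congrArg (Φ ⟨_, he⟩) h4).trans hz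
  -- Near `y₀` the correction is constant, so `Ψ` is there the composite of `Φ y₀` with one affine
  -- automorphism of the product.
  · obtain ⟨y₀, f₀⟩ := z
    have h1 : IsIsoAt (A × B) (A × B) (fun z : V y₀ × F =>
        Φ y₀ (z.1, ((v y₀ y₀).1 (⟨z.1.1, hV y₀ z.1.2⟩, z.2)).2)) (⟨y₀.1, hxV y₀⟩, f₀) := by
      have hj : IsLocalAffineIso (A × B) (A × B)
          (fun z : V y₀ × F => (⟨z.1.1, hV y₀ z.1.2⟩, z.2) : V y₀ × F → O × F) :=
        isLocalAffineIso_inclusion_prod (hV y₀)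
      refine ((hΦ y₀).affine.isIsoAt _).comp ?_
      refine IsIsoAt.of_isLocalAffineIso_comp hj ?_ ?_
      · intro z z' h
        exact Prod.ext (Subtype.ext (congrArg (fun t : O × F => t.1.1) h))
          (congrArg (fun t : O × F => t.2) h)
      · refine IsIsoAt.congr (((v y₀ y₀).2.1.isIsoAt _).comp (hj.isIsoAt (⟨y₀.1, hxV y₀⟩, f₀)))
          (Filter.Eventually.of_forall fun z => ?_)
        exact hfst _ _ _
    have h2 := IsIsoAt.of_comp_isIsoAt (p := Ψ)
      ((isLocalAffineIso_inclusion_prod (hV y₀)).isIsoAt (⟨y₀.1, hxV y₀⟩, f₀)) (h1.congr ?_)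
    · exact h2
    · have hev : ∀ᶠ z : V y₀ × F in 𝓝 (⟨y₀.1, hxV y₀⟩, f₀),
          v y₀ ⟨z.1.1, hV y₀ z.1.2⟩ = v y₀ y₀ := by
        have hcont : Continuous fun z : V y₀ × F => (⟨z.1.1, hV y₀ z.1.2⟩ : O) := by fun_prop
        exact (hcont.continuousAt (x := (⟨y₀.1, hxV y₀⟩, f₀))).eventually
          (p := fun y => v y₀ y = v y₀ y₀) (hv y₀ y₀ (hxV y₀))
      filter_upwards [hev] with z hz
      rw [hΨ y₀ _ z.1.2, hz]

end Trivial

/-! ### Affine structure on a space covered by affine manifolds -/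

section Glue

variable {V : Type*} [NormedAddCommGroup V] [NormedSpace ℝ V] [FiniteDimensional ℝ V]
  {ι : Type*} {E : ι → Type*} [∀ i, TopologicalSpace (E i)] [∀ i, ChartedSpace V (E i)]
  [∀ i, HasGroupoid (E i) (affineGroupoid V)] {T : Type*} [TopologicalSpace T]

variable (V) in
/-- Open embeddings of affine manifolds in a space which cover it and whose transition maps are
affine. -/
structure IsAffineAtlas (ψ : ∀ i, E i → T) : Prop where
  isOpenEmbedding : ∀ i, IsOpenEmbedding (ψ i)
  surjective : ∀ t, ∃ i e, ψ i e = t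
  transition : ∀ i j (e : E i) (e' : E j), ψ i e = ψ j e' →
    ∃ τ : E i → E j, IsIsoAt V V τ e ∧ ∀ᶠ z in 𝓝 e, ψ j (τ z) = ψ i z

namespace IsAffineAtlas

variable {ψ : ∀ i, E i → T} (h : IsAffineAtlas V ψ)

/-- The charts of the glued manifold. -/
def chart (i : ι) (e : E i) : OpenPartialHomeomorph T V :=
  have : Nonempty (E i) := ⟨e⟩
  ((h.isOpenEmbedding i).toOpenPartialHomeomorph (ψ i)).symm.trans (chartAt V e)

theorem chart_apply (i : ι) (e z : E i) : h.chart i e (ψ i z) = chartAt V e z := by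
  have : Nonempty (E i) := ⟨e⟩
  exact congrArg (chartAt V e)
    (((h.isOpenEmbedding i).toOpenPartialHomeomorph (ψ i)).left_inv (Set.mem_univ z))

theorem chart_symm_apply (i : ι) (e : E i) (v : V) :
    (h.chart i e).symm v = ψ i ((chartAt V e).symm v) := rfl

theorem mem_chart_source (i : ι) (e z : E i) (hz : z ∈ (chartAt V e).source) :
    ψ i z ∈ (h.chart i e).source := by
  have : Nonempty (E i) := ⟨e⟩
  have h1 := ((h.isOpenEmbedding i).toOpenPartialHomeomorph (ψ i)).left_inv (Set.mem_univ z)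
  refine ⟨((h.isOpenEmbedding i).toOpenPartialHomeomorph (ψ i)).map_source (Set.mem_univ z), ?_⟩
  change ((h.isOpenEmbedding i).toOpenPartialHomeomorph (ψ i)).symm (ψ i z) ∈ (chartAt V e).source
  exact Set.mem_of_eq_of_mem (s := (chartAt V e).source) h1 hz

theorem exists_of_mem_chart_source {i : ι} {e : E i} {t : T} (ht : t ∈ (h.chart i e).source) :
    ∃ z ∈ (chartAt V e).source, ψ i z = t := by
  have : Nonempty (E i) := ⟨e⟩
  exact ⟨_, ht.2, ((h.isOpenEmbedding i).toOpenPartialHomeomorph (ψ i)).right_inv ht.1⟩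

/-- The manifold structure on the glued space. -/
@[reducible]
def chartedSpace : ChartedSpace V T where
  atlas := {c | ∃ i e, c = h.chart i e}
  chartAt t := h.chart (h.surjective t).choose (h.surjective t).choose_spec.choose
  mem_chart_source t := by
    have h1 := h.mem_chart_source _ _ _ (ChartedSpace.mem_chart_source (H := V)
      (h.surjective t).choose_spec.choose)
    rwa [(h.surjective t).choose_spec.choose_spec] at h1
  chart_mem_atlas t := ⟨_, _, rfl⟩

/-- A change between charts coming from `E i` and `E j` factors as a chart inverse, a local
transition map `τ` and a chart, all affine. -/
theorem hasGroupoid :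
    let _ := h.chartedSpace
    HasGroupoid T (affineGroupoid V) := by
  let _ := h.chartedSpace
  refine hasGroupoid_of_isAffineAt ?_
  rintro _ ⟨i, e, rfl⟩ _ ⟨j, e', rfl⟩ v hv
  have hv1 : v ∈ (chartAt V e).target := hv.1.1
  obtain ⟨z, hz, hz'⟩ := h.exists_of_mem_chart_source hv.2
  obtain ⟨τ, hτ, hτ'⟩ := h.transition i j ((chartAt V e).symm v) z hz'.symm
  have hτz : τ ((chartAt V e).symm v) = z :=
    (h.isOpenEmbedding j).injective (hτ'.self_of_nhds.trans hz'.symm)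
  have h1 := isAffineAt_chart_symm (M := E i) (ChartedSpace.chart_mem_atlas e) hv1
  have h2 : IsAffineAt V V (chartAt V e') (τ ((chartAt V e).symm v)) := by
    rw [hτz]
    exact isAffineAt_chart (ChartedSpace.chart_mem_atlas e') hz
  refine ((h2.comp hτ.isAffineAt).comp h1).congr ?_
  filter_upwards [((chartAt V e).symm.continuousAt hv1).eventually hτ'] with y hy
  rw [h.chart_symm_apply, ← hy, h.chart_apply]

/-- The preferred chart at `ψ i e` may come from another piece `E j`; the transition map brings it
back to `E i`. -/
theorem isLocalAffineIso (i : ι) :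
    let _ := h.chartedSpace
    IsLocalAffineIso V V (ψ i) := by
  intro _ e
  refine ⟨(h.isOpenEmbedding i).continuous.continuousAt, ?_⟩
  obtain ⟨j, e', h1, h2⟩ : ∃ j e', ψ j e' = ψ i e ∧ chartAt V (ψ i e) = h.chart j e' :=
    ⟨_, _, (h.surjective (ψ i e)).choose_spec.choose_spec, rfl⟩
  obtain ⟨τ, hτ, hτ'⟩ := h.transition i j e e' h1.symm
  have hτe : τ e = e' := (h.isOpenEmbedding j).injective (hτ'.self_of_nhds.trans h1.symm)
  obtain ⟨L, hL⟩ := hτ.2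
  refine ⟨L, ?_⟩
  filter_upwards [hL, hτ'] with y hy hy'
  rw [h2, ← hy', h.chart_apply, ← hy, hτe]

end IsAffineAtlas

end Glue

/-! ### Gluing marked bundles -/

section BundleGluing

variable {A : Type v} [NormedAddCommGroup A] [NormedSpace ℝ A] [FiniteDimensional ℝ A]
  {B : Type w} [NormedAddCommGroup B] [NormedSpace ℝ B] [FiniteDimensional ℝ B]
  {N : Type u} [TopologicalSpace N] [ChartedSpace A N]
  {F : Type u} [TopologicalSpace F] [ChartedSpace B F]

namespace MarkedBundle

variable {P : FlatBundle (OuterGroup B F) N} {U U' V : Opens N}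

theorem res_isEmbedding (X : MarkedBundle (A := A) P U) (h : V ≤ U) :
    AffBundle.IsEmbedding (X.resBundle h) X.toAffBundle (fun e : X.part V => e.1) where
  le := h
  injective := Subtype.val_injective
  affine := isLocalAffineIso_val _
  proj _ := rfl
  surjective e he := ⟨⟨e, he⟩, rfl⟩

section ResApp

variable {X : MarkedBundle (A := A) P U} {Y : MarkedBundle (A := A) P U'} {h : V ≤ U} {h' : V ≤ U'}
  (f : X.res h ⟶ Y.res h')

/-- Morphisms between restrictions, as maps defined on a part of the total space. -/
def resApp (e : X.total) (he : X.proj e ∈ V) : Y.total :=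
  (f.toEquiv (⟨e, he⟩ : X.part V) : Y.part V).1

theorem proj_resApp (e : X.total) (he : X.proj e ∈ V) : Y.proj (resApp f e he) = X.proj e :=
  f.proj (⟨e, he⟩ : X.part V)

theorem resApp_injective {e e' : X.total} {he : X.proj e ∈ V} {he' : X.proj e' ∈ V}
    (H : resApp f e he = resApp f e' he') : e = e' :=
  congrArg (fun e : X.part V => e.1) (f.toEquiv.injective (Subtype.ext H))

theorem resApp_surjective (e : Y.total) (he : Y.proj e ∈ V) : ∃ e' he', resApp f e' he' = e := by
  obtain ⟨e', h⟩ := f.toEquiv.surjective (⟨e, he⟩ : Y.part V)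
  exact ⟨(e' : X.part V).1, (e' : X.part V).2, congrArg (fun e : Y.part V => e.1) h⟩

/-- Affineness at `e` is stated for total maps. The value outside the part over `V` is arbitrary,
and harmless because that part is open. -/
theorem exists_isIsoAt_resApp (e : X.total) (he : X.proj e ∈ V) :
    ∃ τ : X.total → Y.total, IsIsoAt (A × B) (A × B) τ e ∧
      ∀ z hz, τ z = resApp f z hz := by
  classical
  let τ : X.total → Y.total := fun z =>
    if hz : X.proj z ∈ V then resApp f z hz else resApp f e he
  have hτ : ∀ z hz, τ z = resApp f z hz := fun z hz => dif_pos hz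
  refine ⟨τ, ?_, hτ⟩
  refine IsIsoAt.of_comp_isIsoAt (isIsoAt_val (V := A × B) (⟨e, he⟩ : X.part V)) ?_
  refine IsIsoAt.congr (IsIsoAt.comp (isIsoAt_val (V := A × B) (s := Y.part V) _)
    (f.affine.isIsoAt (⟨e, he⟩ : X.part V))) (Filter.Eventually.of_forall fun z => ?_)
  exact (hτ z.1 z.2).symm

theorem marking_resApp {x : N} (hx : x ∈ V) (φ : X.Frame x) (ψ : Y.Frame x)
    (H : ∀ f' h, ψ.1 f' = resApp f (φ.1 f') h) : Y.marking x ψ = X.marking x φ := by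
  obtain ⟨φ, rfl⟩ := (X.res_isEmbedding h).exists_mapFrame hx φ
  obtain ⟨ψ, rfl⟩ := (Y.res_isEmbedding h').exists_mapFrame hx ψ
  exact f.marking x φ ψ fun f' => Subtype.ext (H f' _)

end ResApp

/-- An affine isomorphism of `X` with the restriction of `Y`. -/
def homRes {X : MarkedBundle (A := A) P U} {Y : MarkedBundle (A := A) P U'}
    {ψ : X.total → Y.total} (hψ : AffBundle.IsEmbedding X.toAffBundle Y.toAffBundle ψ)
    (hm : ∀ (x : N) (φ : X.Frame x), Y.marking x (hψ.mapFrame φ) = X.marking x φ) :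
    X ⟶ Y.res hψ.le :=
  have hp : ∀ e, ψ e ∈ Y.part U := fun e => by
    change Y.proj (ψ e) ∈ U
    rw [hψ.proj]
    exact X.proj_mem e
  have hb : Function.Bijective fun e => (⟨ψ e, hp e⟩ : Y.part U) :=
    ⟨fun e e' h => hψ.injective (congrArg Subtype.val h),
      fun e => (hψ.surjective e.1 e.2).imp fun e' h => Subtype.ext h⟩
  have hk : IsLocalAffineIso (A × B) (A × B) (Equiv.ofBijective _ hb) :=
    hψ.affine.codRestrict (Y.part U) hp
  { toEquiv := Equiv.ofBijective (fun e => (⟨ψ e, hp e⟩ : Y.part U)) hb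
    affine := hk
    affine_symm := hk.symm
    proj := hψ.proj
    marking := fun x φ φ' h => by
      rw [← hm]
      exact congrArg (Y.marking x) (Subtype.ext (funext fun f => congrArg Subtype.val (h f))) }

variable (P U) in
/-- Bundles over the members of a cover of `U`, with compatible isomorphisms between their
restrictions. -/
structure GluingData where
  ι : Type u
  W : ι → Opens N
  le : ∀ i, W i ≤ U
  cover : ∀ x ∈ U, ∃ i, x ∈ W i
  obj : ∀ i, MarkedBundle (A := A) P (W i)
  hom : ∀ i j, (obj i).res (inf_le_left : W i ⊓ W j ≤ W i) ⟶
    (obj j).res (inf_le_right : W i ⊓ W j ≤ W j)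
  hom_self : ∀ i e h, resApp (hom i i) e h = e
  hom_comp : ∀ i j k e hj hk hjk, resApp (hom j k) (resApp (hom i j) e hj) hjk =
    resApp (hom i k) e hk

namespace GluingData

variable (G : GluingData (A := A) P U)

/-- Identification of points of the different bundles. -/
def Rel {i j : G.ι} (e : (G.obj i).total) (e' : (G.obj j).total) : Prop :=
  ∃ h, resApp (G.hom i j) e h = e'

variable {G} in
theorem Rel.symm {i j : G.ι} {e : (G.obj i).total} {e' : (G.obj j).total} (h : G.Rel e e') :
    G.Rel e' e := by
  obtain ⟨h, rfl⟩ := h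
  have hm : (G.obj j).proj (resApp (G.hom i j) e h) ∈ G.W j ⊓ G.W i := by
    rw [proj_resApp]
    exact h.symm
  exact ⟨hm, (G.hom_comp i j i e h ⟨h.1, h.1⟩ hm).trans (G.hom_self _ _ _)⟩

variable {G} in
theorem Rel.trans {i j k : G.ι} {e : (G.obj i).total} {e' : (G.obj j).total}
    {e'' : (G.obj k).total} (h : G.Rel e e') (h' : G.Rel e' e'') : G.Rel e e'' := by
  obtain ⟨h, rfl⟩ := h
  obtain ⟨h₂, rfl⟩ := h'
  have hm : (G.obj i).proj e ∈ G.W i ⊓ G.W k := by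
    have := h₂.2
    rw [proj_resApp] at this
    exact ⟨h.1, this⟩
  exact ⟨hm, (G.hom_comp i j k e h hm h₂).symm⟩

/-- The equivalence relation defining the glued bundle. -/
def setoid : Setoid (Σ i, (G.obj i).total) where
  r z z' := G.Rel z.2 z'.2
  iseqv := ⟨fun _ => ⟨⟨(G.obj _).proj_mem _, (G.obj _).proj_mem _⟩, G.hom_self _ _ _⟩,
    Rel.symm, Rel.trans⟩

/-- The total space of the glued bundle. -/
abbrev total : Type u := Quotient G.setoid

/-- The inclusion of the given bundles in the glued one. -/
def incl (i : G.ι) (e : (G.obj i).total) : G.total := Quotient.mk G.setoid ⟨i, e⟩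

variable {G}

theorem incl_eq_iff {i j : G.ι} {e : (G.obj i).total} {e' : (G.obj j).total} :
    G.incl i e = G.incl j e' ↔ ∃ h, resApp (G.hom i j) e h = e' :=
  Quotient.eq (r := G.setoid)

variable (G)

theorem incl_resApp {i j : G.ι} (e : (G.obj i).total) (h : (G.obj i).proj e ∈ G.W i ⊓ G.W j) :
    G.incl j (resApp (G.hom i j) e h) = G.incl i e :=
  (incl_eq_iff.2 ⟨h, rfl⟩).symm

theorem incl_injective (i : G.ι) : Function.Injective (G.incl i) := fun e e' h => by
  obtain ⟨h, h'⟩ := incl_eq_iff.1 h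
  rw [← h', G.hom_self]

theorem incl_surjective (t : G.total) : ∃ i e, G.incl i e = t := by
  obtain ⟨⟨i, e⟩, rfl⟩ := Quotient.exists_rep t
  exact ⟨i, e, rfl⟩

theorem isOpen_iff {s : Set G.total} : IsOpen s ↔ ∀ i, IsOpen (G.incl i ⁻¹' s) := by
  rw [← isQuotientMap_quotient_mk'.isOpen_preimage, isOpen_sigma_iff]
  rfl

theorem exists_transition (i j : G.ι) (e : (G.obj i).total) (e' : (G.obj j).total)
    (h : G.incl i e = G.incl j e') :
    ∃ τ : (G.obj i).total → (G.obj j).total, IsIsoAt (A × B) (A × B) τ e ∧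
      ∀ᶠ z in 𝓝 e, G.incl j (τ z) = G.incl i z := by
  obtain ⟨h, -⟩ := incl_eq_iff.1 h
  obtain ⟨τ, hτ, hτ'⟩ := exists_isIsoAt_resApp (G.hom i j) e h
  refine ⟨τ, hτ, ?_⟩
  filter_upwards [((G.obj i).part (G.W i ⊓ G.W j)).2.mem_nhds h] with z hz
  exact (congrArg (G.incl j) (hτ' z hz)).trans (G.incl_resApp z hz)

/-- Openness of an image is tested in each piece, where the local transition maps, being continuous,
pull it back to an open set. -/
theorem incl_isOpenEmbedding (i : G.ι) : IsOpenEmbedding (G.incl i) := by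
  refine .of_continuous_injective_isOpenMap
    (continuous_quotient_mk'.comp continuous_sigmaMk) (G.incl_injective i) fun O hO => ?_
  rw [isOpen_iff]
  intro j
  rw [isOpen_iff_mem_nhds]
  rintro e' ⟨e, he, h⟩
  obtain ⟨τ, hτ, hτ'⟩ := G.exists_transition j i e' e h.symm
  have h1 : τ e' = e := G.incl_injective i (hτ'.self_of_nhds.trans h.symm)
  filter_upwards [hτ', hτ.1.eventually (hO.mem_nhds (h1 ▸ he))] with z hz hz'
  exact ⟨τ z, hz', hz⟩

theorem isAffineAtlas : IsAffineAtlas (A × B) G.incl :=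
  ⟨G.incl_isOpenEmbedding, G.incl_surjective, G.exists_transition⟩

/-- The projection of the glued bundle. -/
def proj : G.total → N :=
  Quotient.lift (fun z => (G.obj z.1).proj z.2) (by
    rintro ⟨i, e⟩ ⟨j, e'⟩ ⟨h, h'⟩
    exact ((congrArg (G.obj j).proj h').symm.trans (proj_resApp _ _ _)).symm)

theorem exists_incl {t : G.total} {i : G.ι} (h : G.proj t ∈ G.W i) : ∃ e, G.incl i e = t := by
  obtain ⟨j, e, rfl⟩ := G.incl_surjective t
  exact ⟨_, G.incl_resApp e ⟨(G.obj j).proj_mem e, h⟩⟩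

theorem isTrivialization_incl {_ : ChartedSpace (A × B) G.total}
    (hincl : ∀ i, IsLocalAffineIso (A × B) (A × B) (G.incl i)) {i : G.ι} {V : Opens N}
    {Φ : V × F → (G.obj i).total} (hΦ : IsTrivialization A B (G.obj i).proj (G.W i) V Φ) :
    IsTrivialization A B G.proj U V fun z => G.incl i (Φ z) where
  le := hΦ.le.trans (G.le i)
  proj := hΦ.proj
  injective := (G.incl_injective i).comp hΦ.injective
  surjective t ht := by
    obtain ⟨e, rfl⟩ := G.exists_incl (hΦ.le ht)
    obtain ⟨z, rfl⟩ := hΦ.surjective e ht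
    exact ⟨z, rfl⟩
  affine := (hincl i).comp hΦ.affine

/-- The affine bundle obtained by gluing. -/
def bundle : AffBundle A B F U where
  total := G.total
  charted := G.isAffineAtlas.chartedSpace
  affine := G.isAffineAtlas.hasGroupoid
  proj := G.proj
  proj_mem t := by
    obtain ⟨i, e, rfl⟩ := G.incl_surjective t
    exact G.le i ((G.obj i).proj_mem e)
  affine_proj t := by
    let _ := G.isAffineAtlas.chartedSpace
    obtain ⟨i, e, rfl⟩ := G.incl_surjective t
    exact IsAffineAt.of_comp_isIsoAt (p := G.proj) ((G.isAffineAtlas.isLocalAffineIso i).isIsoAt e)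
      ((G.obj i).affine_proj.isAffineAt e)
  locally_trivial x hx := by
    obtain ⟨i, hi⟩ := G.cover x hx
    obtain ⟨V, Φ, hxV, hΦ⟩ := (G.obj i).locally_trivial x hi
    let _ := G.isAffineAtlas.chartedSpace
    exact ⟨V, _, hxV, G.isTrivialization_incl G.isAffineAtlas.isLocalAffineIso hΦ⟩

theorem incl_isEmbedding (i : G.ι) :
    AffBundle.IsEmbedding (G.obj i).toAffBundle G.bundle (G.incl i) where
  le := G.le i
  injective := G.incl_injective i
  affine := G.isAffineAtlas.isLocalAffineIso i
  proj _ := rfl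
  surjective _ h := G.exists_incl h

/-- The marking of the glued bundle. -/
def marking (x : N) (φ : G.bundle.Frame x) : P.total :=
  (G.obj (G.cover x φ.mem).choose).marking x
    ((G.incl_isEmbedding _).exists_mapFrame (G.cover x φ.mem).choose_spec φ).choose

/-- The gluing morphism carries one frame to the other and preserves markings. Hence the index and
the lifted frame chosen in `marking` do not matter. -/
theorem marking_eq_marking {x : N} {i j : G.ι} (φ : (G.obj i).Frame x) (φ' : (G.obj j).Frame x)
    (h : (G.incl_isEmbedding j).mapFrame φ' = (G.incl_isEmbedding i).mapFrame φ) :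
    (G.obj j).marking x φ' = (G.obj i).marking x φ := by
  refine marking_resApp (G.hom i j) ⟨φ.mem, φ'.mem⟩ φ φ' fun f _ => ?_
  have h2 : G.incl j (φ'.1 f) = G.incl i (φ.1 f) := congrFun (congrArg Subtype.val h) f
  obtain ⟨_, h3⟩ := incl_eq_iff.1 h2.symm
  exact h3.symm

theorem marking_mapFrame {x : N} (i : G.ι) (φ : (G.obj i).Frame x) :
    G.marking x ((G.incl_isEmbedding i).mapFrame φ) = (G.obj i).marking x φ :=
  G.marking_eq_marking _ _ ((G.incl_isEmbedding _).exists_mapFrame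
    (G.cover x ((G.incl_isEmbedding i).mapFrame φ).mem).choose_spec _).choose_spec

/-- The marked bundle obtained by gluing. -/
def glue : MarkedBundle (A := A) P U where
  toAffBundle := G.bundle
  marking := G.marking
  proj_marking x φ := by
    obtain ⟨i, hi⟩ := G.cover x φ.mem
    obtain ⟨φ, rfl⟩ := (G.incl_isEmbedding i).exists_mapFrame hi φ
    rw [G.marking_mapFrame, (G.obj i).proj_marking]
  marking_comp x φ ψ g h := by
    obtain ⟨i, hi⟩ := G.cover x φ.mem
    obtain ⟨φ, rfl⟩ := (G.incl_isEmbedding i).exists_mapFrame hi φ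
    obtain ⟨ψ, rfl⟩ := (G.incl_isEmbedding i).exists_mapFrame hi ψ
    rw [G.marking_mapFrame, G.marking_mapFrame]
    exact (G.obj i).marking_comp x φ ψ g fun f => G.incl_injective i (h f)
  continuous_marking V Φ hΦ := by
    rw [continuous_iff_continuousAt]
    intro x
    obtain ⟨i, hi⟩ := G.cover x.1 (hΦ.le x.2)
    obtain ⟨Ψ, hΨ, h⟩ := (G.incl_isEmbedding i).exists_isTrivialization
      (hΦ.restrict (inf_le_left : V ⊓ G.W i ≤ V)) inf_le_right
    have h1 := (G.obj i).continuous_marking _ _ hΨ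
    have h2 : IsOpenEmbedding fun y : ↥(V ⊓ G.W i) => (⟨y.1, y.2.1⟩ : V) :=
      (Opens.isOpenEmbedding_of_le (inf_le_left : V ⊓ G.W i ≤ V))
    refine (h2.continuousAt_iff (x := ⟨x.1, x.2, hi⟩)).1 ?_
    refine h1.continuousAt.congr (Filter.Eventually.of_forall fun y => ?_)
    refine (G.marking_mapFrame i _).symm.trans ?_
    exact congrArg (G.marking y.1) (Subtype.ext (funext fun f => h (y, f)))

/-- The given bundles are the restrictions of the glued one. -/
def homGlue (i : G.ι) : G.obj i ⟶ G.glue.res (G.le i) :=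
  homRes (Y := G.glue) (G.incl_isEmbedding i) fun _ φ => G.marking_mapFrame i φ

end GluingData

end MarkedBundle

end BundleGluing

/-! ### Descent for morphisms and objects -/

section Stack

variable {A : Type v} [NormedAddCommGroup A] [NormedSpace ℝ A] [FiniteDimensional ℝ A]
  {B : Type w} [NormedAddCommGroup B] [NormedSpace ℝ B] [FiniteDimensional ℝ B]
  {N : Type u} [TopologicalSpace N] [ChartedSpace A N]
  {F : Type u} [TopologicalSpace F] [ChartedSpace B F]

namespace MarkedBundle

variable {P : FlatBundle (OuterGroup B F) N} {U V W U' : Opens N}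

open Pseudofunctor.LocallyDiscreteOpToCat

/-- On points the coherence isomorphisms are the identity. Arrows of `Opens N` are unique, so `k`
may be taken to be the composite, where `mapComp'` reduces to `mapComp`. -/
theorem mapComp'_hom_apply (f : V ⟶ U) (g : W ⟶ V) (k : W ⟶ U)
    (h : f.op.toLoc ≫ g.op.toLoc = k.op.toLoc) (X : MarkedBundle (A := A) P U) (e : X.part W) :
    Hom.toEquiv (X := X.res k.le) (Y := (X.res f.le).res g.le)
      (((bundleStack A P).mapComp' f.op.toLoc g.op.toLoc k.op.toLoc h).hom.toNatTrans.app X) e =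
      (⟨⟨e.1, g.le e.2⟩, e.2⟩ : (X.res f.le).part W) := by
  obtain rfl : k = g ≫ f := Subsingleton.elim _ _
  change Hom.toEquiv (X := X.res _) (Y := (X.res f.le).res g.le)
      (((bundleStack A P).mapComp' f.op.toLoc g.op.toLoc (f.op.toLoc ≫ g.op.toLoc)
        rfl).hom.toNatTrans.app X) e = _
  rw [Pseudofunctor.mapComp'_eq_mapComp]
  rfl

theorem mapComp'_inv_apply (f : V ⟶ U) (g : W ⟶ V) (k : W ⟶ U)
    (h : f.op.toLoc ≫ g.op.toLoc = k.op.toLoc) (X : MarkedBundle (A := A) P U)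
    (e : (X.res f.le).part W) :
    Hom.toEquiv (X := (X.res f.le).res g.le) (Y := X.res k.le)
      (((bundleStack A P).mapComp' f.op.toLoc g.op.toLoc k.op.toLoc h).inv.toNatTrans.app X) e =
      (⟨(e.1 : X.part V).1, e.2⟩ : X.part W) := by
  obtain rfl : k = g ≫ f := Subsingleton.elim _ _
  change Hom.toEquiv (X := (X.res f.le).res g.le) (Y := X.res _)
      (((bundleStack A P).mapComp' f.op.toLoc g.op.toLoc (f.op.toLoc ≫ g.op.toLoc)
        rfl).inv.toNatTrans.app X) e = _
  rw [Pseudofunctor.mapComp'_eq_mapComp]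
  rfl

/-- Pulling back conjugates a restriction by coherence isomorphisms, which do nothing on points.
Identities between arrows of the pseudofunctor thus become identities between maps of sets. -/
theorem resApp_pullHom {X : MarkedBundle (A := A) P U} {Y : MarkedBundle (A := A) P U'}
    {f : V ⟶ U} {f' : V ⟶ U'} (φ : X.res f.le ⟶ Y.res f'.le) (g : W ⟶ V) (k : W ⟶ U)
    (k' : W ⟶ U') (h : g ≫ f = k) (h' : g ≫ f' = k') (e : X.total) (he : X.proj e ∈ W) :
    resApp (X := X) (Y := Y) (h := k.le) (h' := k'.le)
      (pullHom (F := bundleStack A P) (f₁ := f) (f₂ := f') (M₁ := X) (M₂ := Y) φ g k k' h h') e he =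
      resApp φ e (g.le he) := by
  have h1 := mapComp'_hom_apply f g k (by rw [← h]; rfl) X ⟨e, he⟩
  have h2 := mapComp'_inv_apply f' g k' (by rw [← h']; rfl) Y
    ((resHom φ g.le).toEquiv (⟨⟨e, g.le he⟩, he⟩ : (X.res f.le).part W))
  refine (congrArg (fun e : Y.part W => e.1) (?_ : _ = _)).trans
    (congrArg (fun e : Y.part W => e.1) h2)
  exact congrArg (fun e => Hom.toEquiv (X := (Y.res f'.le).res g.le) (Y := Y.res k'.le)
      (((bundleStack A P).mapComp' f'.op.toLoc g.op.toLoc k'.op.toLoc (by rw [← h']; rfl)).inv.toNatTrans.app Y) ((resHom φ g.le).toEquiv e)) h1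

/-- Bijectivity of the glued map comes from its preserving the projection: points with the same
image lie over the same member of the cover, where one of the given isomorphisms applies. Affineness
is local. -/
theorem exists_hom_of_cover {ι : Type*} {W : ι → Opens N} {le : ∀ i, W i ≤ U}
    (cover : ∀ x ∈ U, ∃ i, x ∈ W i) {X Y : MarkedBundle (A := A) P U}
    (f : ∀ i, X.res (le i) ⟶ Y.res (le i))
    (hf : ∀ i j e hi hj, resApp (f i) e hi = resApp (f j) e hj) :
    ∃ k : X ⟶ Y, ∀ i e h, k.toEquiv e = resApp (f i) e h := by
  choose idx hidx using cover
  let k : X.total → Y.total := fun e =>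
    resApp (f (idx _ (X.proj_mem e))) e (hidx _ (X.proj_mem e))
  have hk : ∀ i e h, k e = resApp (f i) e h := fun i e h => hf _ _ _ _ _
  have hp : ∀ e, Y.proj (k e) = X.proj e := fun e => proj_resApp _ _ _
  have hb : Function.Bijective k := by
    refine ⟨fun e e' h => ?_, fun e => ?_⟩
    · have h1 := hidx _ (X.proj_mem e)
      have h2 := hk _ e h1
      rw [h, hk _ e' (by rwa [← hp, ← h, hp])] at h2
      exact (resApp_injective _ h2).symm
    · obtain ⟨e', he', h⟩ := resApp_surjective (f (idx _ (Y.proj_mem e))) e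
        (hidx _ (Y.proj_mem e))
      exact ⟨e', (hk _ e' he').trans h⟩
  have hka : IsLocalAffineIso (A × B) (A × B) (Equiv.ofBijective k hb) := fun e => by
    have h1 := hidx _ (X.proj_mem e)
    obtain ⟨τ, hτ, hτ'⟩ := exists_isIsoAt_resApp (f _) e h1
    refine hτ.congr ?_
    filter_upwards [(X.part _).2.mem_nhds h1] with z hz
    exact (hτ' z hz).trans (hk _ z hz).symm
  exact ⟨{ toEquiv := Equiv.ofBijective k hb
           affine := hka
           affine_symm := hka.symm
           proj := hp
           marking := fun x φ ψ h => marking_resApp (f _) (hidx x φ.mem) φ ψ fun f' hf' =>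
            (h f').trans (hk _ _ hf') }, hk⟩

section Descent

variable {ι : Type u} {W : ι → Opens N} (f : ∀ i, W i ⟶ U)

open Pseudofunctor

theorem ofObj_hom_apply (X : MarkedBundle (A := A) P U) {Y : Opens N} (q : Y ⟶ U) {i j : ι}
    (g : Y ⟶ W i) (g' : Y ⟶ W j) (h : g ≫ f i = q) (h' : g' ≫ f j = q)
    (e : (X.res (f i).le).part Y) :
    Hom.toEquiv (X := (X.res (f i).le).res g.le) (Y := (X.res (f j).le).res g'.le)
      ((DescentData.ofObj (F := bundleStack A P) (f := f) X).hom q g g' h h') e =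
      (⟨⟨(e.1 : X.part (W i)).1, g'.le e.2⟩, e.2⟩ : (X.res (f j).le).part Y) := by
  have h1 := mapComp'_inv_apply (f i) g q (by rw [← h]; rfl) X e
  have h2 := mapComp'_hom_apply (f j) g' q (by rw [← h']; rfl) X
    ⟨(e.1 : X.part (W i)).1, e.2⟩
  exact (congrArg (Hom.toEquiv (X := X.res q.le) (Y := (X.res (f j).le).res g'.le)
    (((bundleStack A P).mapComp' (f j).op.toLoc g'.op.toLoc q.op.toLoc
      (by rw [← h']; rfl)).hom.toNatTrans.app X)) h1).trans h2

variable {f}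

theorem descentData_hom_comm {X Y : MarkedBundle (A := A) P U}
    (ψ : DescentData.ofObj (F := bundleStack A P) (f := f) X ⟶
      DescentData.ofObj (F := bundleStack A P) (f := f) Y) (i j : ι) (e : X.total)
    (hi : X.proj e ∈ W i) (hj : X.proj e ∈ W j) :
    resApp (X := X) (Y := Y) (h := (f i).le) (h' := (f i).le) (ψ.hom i) e hi =
      resApp (X := X) (Y := Y) (h := (f j).le) (h' := (f j).le) (ψ.hom j) e hj := by
  let g : W i ⊓ W j ⟶ W i := homOfLE inf_le_left
  let g' : W i ⊓ W j ⟶ W j := homOfLE inf_le_right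
  have h1 := congrArg (fun k => Hom.toEquiv (X := (X.res (f i).le).res g.le)
    (Y := (Y.res (f j).le).res g'.le) k (⟨⟨e, hi⟩, ⟨hi, hj⟩⟩ : (X.res (f i).le).part (W i ⊓ W j)))
    (ψ.comm (g ≫ f i) g g' rfl (Subsingleton.elim _ _))
  have h2 := ofObj_hom_apply f X (g ≫ f i) g g' rfl (Subsingleton.elim _ _) ⟨⟨e, hi⟩, ⟨hi, hj⟩⟩
  have h3 := ofObj_hom_apply f Y (g ≫ f i) g g' rfl (Subsingleton.elim _ _)
    ((resHom (X := X.res (f i).le) (Y := Y.res (f i).le) (ψ.hom i) g.le).toEquiv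
      (⟨⟨e, hi⟩, ⟨hi, hj⟩⟩ : (X.res (f i).le).part (W i ⊓ W j)))
  have h4 := congrArg (resHom (X := X.res (f j).le) (Y := Y.res (f j).le) (ψ.hom j) g'.le).toEquiv
    h2
  exact congrArg (fun e : (Y.res (f j).le).part (W i ⊓ W j) => (e.1 : Y.part (W j)).1)
    (h3.symm.trans (h1.trans h4))

variable (D : (bundleStack A P).DescentData f)

/-- The objects of a descent datum. -/
abbrev descentObj (i : ι) : MarkedBundle (A := A) P (W i) := D.obj i

/-- The isomorphisms of a descent datum. -/
abbrev descentHom {Y : Opens N} {i j : ι} (h : Y ≤ W i) (h' : Y ≤ W j) :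
    (descentObj D i).res h ⟶ (descentObj D j).res h' :=
  D.hom (homOfLE (h.trans (f i).le)) (homOfLE h) (homOfLE h') (Subsingleton.elim _ _)
    (Subsingleton.elim _ _)

/-- The pullback compatibility of a descent datum, read on points: the arrows over pairwise
intersections determine all the others. -/
theorem resApp_descentHom {Y Z : Opens N} {i j : ι} (h : Y ≤ W i) (h' : Y ≤ W j) (k : Z ≤ Y)
    (e : (descentObj D i).total) (he : (descentObj D i).proj e ∈ Z) :
    resApp (descentHom D (k.trans h) (k.trans h')) e he = resApp (descentHom D h h') e (k he) := by
  rw [← resApp_pullHom (descentHom D h h') (homOfLE k) (homOfLE (k.trans h))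
    (homOfLE (k.trans h')) (Subsingleton.elim _ _) (Subsingleton.elim _ _) e he]
  exact congrArg (fun t => resApp (X := descentObj D i) (Y := descentObj D j) (h := k.trans h)
    (h' := k.trans h') t e he) (D.pullHom_hom (homOfLE k) _ _ (Subsingleton.elim _ _) _ _
      (Subsingleton.elim _ _) (Subsingleton.elim _ _) _ _ (Subsingleton.elim _ _)
      (Subsingleton.elim _ _)).symm

/-- The gluing data defined by a descent datum. -/
def gluingData (cover : ∀ x ∈ U, ∃ i, x ∈ W i) : GluingData (A := A) P U where
  ι := ι
  W := W
  le i := (f i).le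
  cover := cover
  obj := descentObj D
  hom i j := descentHom D inf_le_left inf_le_right
  hom_self i e h :=
    congrArg (fun k => resApp (X := descentObj D i) (Y := descentObj D i)
      (h := (inf_le_left : W i ⊓ W i ≤ W i)) (h' := (inf_le_left : W i ⊓ W i ≤ W i)) k e h)
      (D.hom_self (homOfLE (inf_le_left.trans (f i).le)) (homOfLE inf_le_left)
        (Subsingleton.elim (homOfLE (inf_le_left : W i ⊓ W i ≤ W i) ≫ f i) _))
  hom_comp i j k e hj hk hjk := by
    have h12 : W i ⊓ W j ⊓ W k ≤ W i ⊓ W j := inf_le_left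
    have h13 : W i ⊓ W j ⊓ W k ≤ W i ⊓ W k := le_inf (inf_le_left.trans inf_le_left) inf_le_right
    have h23 : W i ⊓ W j ⊓ W k ≤ W j ⊓ W k := le_inf (inf_le_left.trans inf_le_right) inf_le_right
    have he : (descentObj D i).proj e ∈ W i ⊓ W j ⊓ W k := ⟨hj, hk.2⟩
    rw [← resApp_descentHom D _ _ h13 e he]
    have he' : (descentObj D j).proj (resApp (descentHom D inf_le_left inf_le_right) e hj) ∈
        W i ⊓ W j ⊓ W k := by
      rwa [proj_resApp]
    rw [← resApp_descentHom D _ _ h23 _ he']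
    refine Eq.trans ?_ (congrArg (fun t => resApp (X := descentObj D i) (Y := descentObj D k)
      (h := h13.trans inf_le_left) (h' := h13.trans inf_le_right) t e he)
      (D.hom_comp (homOfLE (h13.trans (inf_le_left.trans (f i).le))) _
        (homOfLE (h12.trans inf_le_right)) _ (Subsingleton.elim _ _) (Subsingleton.elim _ _)
        (Subsingleton.elim _ _)))
    have h1 := resApp_descentHom D (inf_le_left : W i ⊓ W j ≤ W i) inf_le_right h12 e he
    refine congrArg Subtype.val (congrArg (descentHom D (h23.trans inf_le_left)
      (h23.trans inf_le_right)).toEquiv (Subtype.ext (h1.symm : _ = _) : (_ : (descentObj D j).part (W i ⊓ W j ⊓ W k)) = _))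

-- Morphisms are maps, so they are determined locally and glue by `exists_hom_of_cover`; a descent
-- datum is effective through the glued bundle and the isomorphisms `GluingData.homGlue`.
variable (f) in
theorem isEquivalence_toDescentData (cover : ∀ x ∈ U, ∃ i, x ∈ W i) :
    ((bundleStack A P).toDescentData f).IsEquivalence where
  faithful := ⟨fun {X Y : MarkedBundle (A := A) P U} k k' h => by
    refine hom_ext (X := X) (Y := Y) fun e => ?_
    obtain ⟨i, hi⟩ := cover _ (X.proj_mem e)
    have h1 : resHom (X := X) (Y := Y) k (f i).le = resHom (X := X) (Y := Y) k' (f i).le :=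
      congrArg (fun ψ => DescentData.Hom.hom ψ i) h
    exact congrArg (fun t => resApp t e hi) h1⟩
  full := ⟨fun {X Y : MarkedBundle (A := A) P U} ψ => by
    obtain ⟨k, hk⟩ := exists_hom_of_cover (X := X) (Y := Y) (le := fun i => (f i).le) cover
      (fun i => ψ.hom i) (fun i j e hi hj => descentData_hom_comm ψ i j e hi hj)
    exact ⟨k, DescentData.hom_ext fun i => hom_ext (X := X.res (f i).le) (Y := Y.res (f i).le)
      fun e : X.part (W i) => Subtype.ext (hk i e.1 e.2)⟩⟩
  essSurj := ⟨fun D => ⟨(gluingData D cover).glue, ⟨Iso.symm (DescentData.isoMk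
    (fun i => Hom.toIso ((gluingData D cover).homGlue i)) (by
      intro Y q i j g g' h h'
      let G := gluingData D cover
      refine hom_ext (X := (descentObj D i).res g.le) (Y := (G.glue.res (f j).le).res g'.le)
        fun e : (descentObj D i).part Y => ?_
      have h1 := ofObj_hom_apply f G.glue q g g' h h'
        ((resHom (X := descentObj D i) (Y := G.glue.res (f i).le) (G.homGlue i) g.le).toEquiv e)
      refine h1.trans (Subtype.ext (Subtype.ext ?_))
      -- The arrow over `Y` restricts the one over `W i ⊓ W j`, and the latter relates points which
      -- are identified in the quotient.
      have h2 := resApp_descentHom D (inf_le_left : W i ⊓ W j ≤ W i) inf_le_right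
        (le_inf g.le g'.le) e.1 e.2
      refine Eq.trans ?_ (congrArg (G.incl j) h2.symm)
      exact (G.incl_resApp e.1 (le_inf g.le g'.le e.2)).symm))⟩⟩⟩

end Descent

variable (A P) in
theorem isStack_bundleStack : (bundleStack A P).IsStack (Opens.grothendieckTopology N) :=
  Pseudofunctor.IsStack.of_isStackFor fun U R hR =>
    (Pseudofunctor.isStackFor_iff _ _).2 <| isEquivalence_toDescentData _ fun x hx => by
      obtain ⟨V, g, hg, hxV⟩ := hR x hx
      exact ⟨⟨Over.mk g, hg⟩, hxV⟩

end MarkedBundle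

end Stack

/-! ### Local existence and local uniqueness of objects -/

section Gerbe

variable {A : Type v} [NormedAddCommGroup A] [NormedSpace ℝ A] [FiniteDimensional ℝ A]
  {B : Type w} [NormedAddCommGroup B] [NormedSpace ℝ B] [FiniteDimensional ℝ B]
  {N : Type u} [TopologicalSpace N] [ChartedSpace A N] [HasGroupoid N (affineGroupoid A)]
  {F : Type u} [TopologicalSpace F] [T2Space F] [ChartedSpace B F]
  [HasGroupoid F (affineGroupoid B)] [CompleteAffine B F]

namespace MarkedBundle

variable {P : FlatBundle (OuterGroup B F) N} {U V : Opens N}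

/-- Bundles with the same trivial underlying affine bundle are isomorphic. -/
theorem nonempty_hom_of_isTrivialization {X Y : MarkedBundle (A := A) P U} {Φ : U × F → X.total}
    {Ψ : U × F → Y.total} (hΦ : IsTrivialization A B X.proj U U Φ)
    (hΨ : IsTrivialization A B Y.proj U U Ψ) : Nonempty (X ⟶ Y) := by
  let σ := fun y : U => X.marking y.1 (X.frameOf hΦ y)
  let τ := fun y : U => Y.marking y.1 (Y.frameOf hΨ y)
  have hσ : Continuous σ := X.continuous_marking U Φ hΦ
  have hτ : Continuous τ := Y.continuous_marking U Ψ hΨ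
  have hp : ∀ y, P.proj (σ y) = P.proj (τ y) := fun y =>
    (X.proj_marking _ _).trans (Y.proj_marking _ _).symm
  choose g₁ hg₁ using fun y => FlatBundle.exists_smul (hp y)
  -- The representative depends only on the class, so a locally constant class has a locally
  -- constant representative. The resulting change of frame `k` is then locally a product of affine
  -- maps, even if `U` is not connected.
  let g : U → affAut B F := fun y => Quotient.out (g₁ y)
  have hg : ∀ y, (g y : OuterGroup B F) = g₁ y := fun y => Quotient.out_eq (g₁ y)
  have hloc : ∀ y₀ : U, ∀ᶠ y in 𝓝 y₀, g y = g y₀ := by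
    intro y₀
    -- Two lifts to the covering `P` which agree at `y₀` agree nearby; freeness of the action then
    -- makes the class `g₁` locally constant.
    have h1 : ∀ᶠ y in 𝓝 y₀, τ y = MulOpposite.op (g₁ y₀) • σ y :=
      FlatBundle.eventually_eq (fun y => by rw [P.proj_smul, hp]) hτ.continuousAt
        (hσ.const_smul _).continuousAt (hg₁ y₀)
    filter_upwards [h1] with y hy
    have h2 : g₁ y = g₁ y₀ := by
      rw [hg₁ y] at hy
      obtain ⟨_, _, h3⟩ := P.simply_transitive (σ y) (MulOpposite.op (g₁ y) • σ y)
        (by rw [P.proj_smul])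
      exact MulOpposite.op_injective ((h3 _ rfl).trans (h3 _ hy).symm)
    change Quotient.out _ = Quotient.out _
    rw [h2]
  let k : U × F ≃ U × F :=
    { toFun := fun z => (z.1, (g z.1).1 z.2)
      invFun := fun z => (z.1, (g z.1).1.symm z.2)
      left_inv := fun z => Prod.ext rfl ((g z.1).1.symm_apply_apply z.2)
      right_inv := fun z => Prod.ext rfl ((g z.1).1.apply_symm_apply z.2) }
  have hk : IsLocalAffineIso (A × B) (A × B) k := fun z => by
    refine IsIsoAt.congr (IsIsoAt.prodMap (A := A) (B := B) (f := fun y : U => y) (g := (g z.1).1)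
      (x := z) (isIsoAt_id _) ((g z.1).2.1.isIsoAt _)) ?_
    filter_upwards [continuousAt_fst.eventually (hloc z.1)] with w hw
    exact Prod.ext rfl (by rw [← hw]; rfl)
  refine exists_hom_of_isTrivialization (hΦ.comp_equiv k hk fun _ => rfl) hΨ fun y => ?_
  refine (hg₁ y).trans ?_
  rw [← hg]
  exact (X.marking_comp y.1 _ _ (g y) fun f => rfl).symm

theorem exists_isTrivialization_res (X : MarkedBundle (A := A) P U) {Φ : U × F → X.total}
    (hΦ : IsTrivialization A B X.proj U U Φ) (h : V ≤ U) :
    ∃ Ψ : V × F → X.part V, IsTrivialization A B (X.res h).proj V V Ψ := by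
  obtain ⟨Ψ, hΨ, -⟩ := (X.res_isEmbedding h).exists_isTrivialization (hΦ.restrict h) le_rfl
  exact ⟨Ψ, hΨ⟩

theorem markedProduct_isTrivialization (σ : U → P.total) (hσ : ∀ y, P.proj (σ y) = y.1)
    (hc : Continuous σ) :
    IsTrivialization A B (markedProduct (A := A) P σ hσ hc).proj U U
      (id : U × F → (productBundle (B := B) A U).total) :=
  productBundle_isTrivialization U

end MarkedBundle

variable (A)

/-- Each point has a convex chart neighbourhood over which `P` has a section: the marked product is
an object there, and any two objects are trivial, hence isomorphic. -/
theorem isGerbe_bundleStack (P : FlatBundle (OuterGroup B F) N) : IsGerbe (bundleStack A P) where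
  isStack := MarkedBundle.isStack_bundleStack A P
  isIso U X Y f := (MarkedBundle.Hom.toIso (X := X) (Y := Y) f).isIso_hom
  locally_connected U x hx := by
    obtain ⟨W, σ, hxW, hc, hσ⟩ := P.exists_section x
    obtain ⟨V, c, hxV, hV, hcV⟩ := exists_isConvexChart (A := A) (O := U ⊓ W) ⟨hx, hxW⟩
    refine ⟨V, hxV, hV.trans inf_le_left, ⟨markedProduct (A := A) P
      (fun y : V => σ ⟨y.1, (hV y.2).2⟩) (fun y => hσ _)
      (hc.comp (continuous_subtype_val.subtype_mk _))⟩, ?_⟩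
    intro (X : MarkedBundle (A := A) P V) (Y : MarkedBundle (A := A) P V)
    obtain ⟨Φ, hΦ⟩ := X.exists_isTrivialization le_rfl hcV
    obtain ⟨Ψ, hΨ⟩ := Y.exists_isTrivialization le_rfl hcV
    exact MarkedBundle.nonempty_hom_of_isTrivialization hΦ hΨ

/-- Marked products over the domains of sections of `P` suffice: their restrictions to overlaps are
still trivial, so they are isomorphic there whatever the topology of the overlap. -/
theorem nonempty_localObjects (P : FlatBundle (OuterGroup B F) N) :
    Nonempty (LocalObjects (bundleStack A P)) := by
  choose W σ hx hc hσ using P.exists_section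
  let X : ∀ x : N, MarkedBundle (A := A) P (W x) := fun x =>
    markedProduct P (σ x) (hσ x) (hc x)
  have hX : ∀ x {V : Opens N} (h : V ≤ W x), ∃ Ψ : V × F → (X x).part V,
      IsTrivialization A B ((X x).res h).proj V V Ψ := fun x V h =>
    (X x).exists_isTrivialization_res
      (MarkedBundle.markedProduct_isTrivialization (σ x) (hσ x) (hc x)) h
  have hiso : ∀ i j, Nonempty ((X j).res (inf_le_right : W i ⊓ W j ≤ W j) ⟶
      (X i).res (inf_le_left : W i ⊓ W j ≤ W i)) := fun i j =>
    MarkedBundle.nonempty_hom_of_isTrivialization (hX j _).choose_spec (hX i _).choose_spec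
  exact ⟨{
    ι := N
    U := W
    cover := top_le_iff.1 fun x _ => Opens.mem_iSup.2 ⟨x, hx x⟩
    obj := X
    iso := fun i j => MarkedBundle.Hom.toIso (hiso i j).some }⟩

end Gerbe

/-! ### The sheaf property of the band -/

section Sheaf

variable {A : Type v} [NormedAddCommGroup A] [NormedSpace ℝ A] [FiniteDimensional ℝ A]
  {B : Type w} [NormedAddCommGroup B] [NormedSpace ℝ B] [FiniteDimensional ℝ B]
  {N : Type u} [TopologicalSpace N] [ChartedSpace A N] [HasGroupoid N (affineGroupoid A)]
  {F : Type u} [TopologicalSpace F] [T2Space F] [ChartedSpace B F]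
  [HasGroupoid F (affineGroupoid B)] [CompleteAffine B F]

variable (A) in
theorem IsAffineTranslationMap.of_locally {W : Opens N} {s : W → translations B F}
    (h : ∀ x : W, ∃ (V : Opens N) (hV : V ≤ W), x.1 ∈ V ∧
      IsAffineTranslationMap A fun y : V => s ⟨y.1, hV y.2⟩) : IsAffineTranslationMap A s := by
  intro Γ q hq x
  obtain ⟨V, hV, hx, hs⟩ := h x
  obtain ⟨a, ha⟩ := hs Γ q hq ⟨x.1, hx⟩
  refine ⟨a, ?_⟩
  have h1 := (Opens.isOpenEmbedding_of_le hV).map_nhds_eq ⟨x.1, hx⟩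
  change ∀ᶠ y in 𝓝 (Set.inclusion hV ⟨x.1, hx⟩), _
  rw [← h1, Filter.eventually_map]
  exact ha

variable (A)

/-- Sections are families of values subject to a condition which is local on the base, so values are
glued pointwise. -/
theorem isSheaf_affineSectionsPresheaf (P : FlatBundle (OuterGroup B F) N) :
    Presheaf.IsSheaf (Opens.grothendieckTopology N) (affineSectionsPresheaf A P) := by
  refine (TopCat.Presheaf.isSheaf_iff_isSheaf_comp (X := TopCat.of N) (forget CommGrpCat)
    (affineSectionsPresheaf A P)).2 ?_
  refine TopCat.Presheaf.isSheaf_of_isSheafUniqueGluing_types _ fun ι U sf hsf => ?_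
  let t : ∀ i, affineSections A P (U i) := sf
  have ht : ∀ (i j : ι) (x : N) (hi : x ∈ U i) (hj : x ∈ U j),
      (t i).1 ⟨x, hi⟩ = (t j).1 ⟨x, hj⟩ := fun i j x hi hj =>
    congrArg (fun s : affineSections A P (U i ⊓ U j) => s.1 ⟨x, hi, hj⟩) (hsf i j)
  have hmem : ∀ x : ↥(iSup U), ∃ i, x.1 ∈ U i := fun x => Opens.mem_iSup.1 x.2
  choose idx hidx using hmem
  have hle : ∀ i, U i ≤ iSup U := le_iSup U
  let s : affineSections A P (iSup U) := ⟨fun x => (t (idx x)).1 ⟨x.1, hidx x⟩,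
    fun W hW σ hσ hc => by
      refine IsAffineTranslationMap.of_locally A fun x => ?_
      have hi := hidx ⟨x.1, hW x.2⟩
      refine ⟨W ⊓ U _, inf_le_left, ⟨x.2, hi⟩, ?_⟩
      have h1 := (t (idx ⟨x.1, hW x.2⟩)).2 (W ⊓ U _) inf_le_right (fun y => σ ⟨y.1, y.2.1⟩)
        (fun y => hσ _) (hc.comp (continuous_subtype_val.subtype_mk _))
      refine cast (congrArg (IsAffineTranslationMap A) (funext fun y => ?_)) h1
      exact congrFun (congrArg Subtype.val (ht _ _ y.1 y.2.2 (hidx ⟨y.1, hW y.2.1⟩))) _⟩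
  refine ⟨s, fun i => Subtype.ext (funext fun x => ?_), fun s' hs' => ?_⟩
  · exact ht _ _ x.1 _ _
  · let s'' : affineSections A P (iSup U) := s'
    refine Subtype.ext (a1 := s'') (a2 := s) (funext fun x => ?_)
    exact congrArg (fun r : affineSections A P (U (idx x)) => r.1 ⟨x.1, hidx x⟩) (hs' (idx x))

end Sheaf

/-! ### Automorphisms of bundles and affine sections of the band -/

section Banding

variable {A : Type v} [NormedAddCommGroup A] [NormedSpace ℝ A] [FiniteDimensional ℝ A]
  {B : Type w} [NormedAddCommGroup B] [NormedSpace ℝ B] [FiniteDimensional ℝ B]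
  {N : Type u} [TopologicalSpace N] [ChartedSpace A N] [HasGroupoid N (affineGroupoid A)]
  {F : Type u} [TopologicalSpace F] [T2Space F] [ChartedSpace B F]
  [HasGroupoid F (affineGroupoid B)] [CompleteAffine B F]

variable {P : FlatBundle (OuterGroup B F) N} {U V : Opens N}

/-- Changing the frame by `g` conjugates the value of `s` by `g`, and the two effects cancel. So the
action on the fibre is independent of the frame. -/
theorem affineSections_apply_comp (s : affineSections A P U) (X : MarkedBundle (A := A) P U) {x : N}
    (hx : x ∈ U) (φ ψ : X.Frame x) (g : affAut B F) (h : ∀ f, ψ.1 f = φ.1 (g.1 f)) (f : F) :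
    ψ.1 (((s.1 ⟨x, hx⟩).1 ⟨X.marking x ψ, X.proj_marking x ψ⟩).1.1 f) =
      φ.1 (((s.1 ⟨x, hx⟩).1 ⟨X.marking x φ, X.proj_marking x φ⟩).1.1 (g.1 f)) := by
  rw [h, (s.1 ⟨x, hx⟩).2 ⟨X.marking x φ, X.proj_marking x φ⟩ ⟨X.marking x ψ, X.proj_marking x ψ⟩ g
    (X.marking_comp x φ ψ g h)]
  exact congrArg φ.1 (g.1.apply_symm_apply _)

namespace MarkedBundle

theorem exists_frame_apply (X : MarkedBundle (A := A) P U) (e : X.total) :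
    ∃ (φ : X.Frame (X.proj e)) (f : F), φ.1 f = e := by
  obtain ⟨φ⟩ := X.toAffBundle.exists_frame (X.proj_mem e)
  exact ⟨φ, φ.surjective rfl⟩

theorem exists_eq_frame_apply (X : MarkedBundle (A := A) P U) (e : X.total) :
    ∃ (x : N) (φ : X.Frame x) (f : F), φ.1 f = e :=
  ⟨_, X.exists_frame_apply e⟩

/-- The action of the affine sections of the band on the total space of a bundle. -/
def secAct (s : affineSections A P U) (X : MarkedBundle (A := A) P U) (e : X.total) : X.total :=
  (X.exists_frame_apply e).choose.1 (((s.1 ⟨X.proj e, X.proj_mem e⟩).1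
    ⟨X.marking _ (X.exists_frame_apply e).choose, X.proj_marking _ _⟩).1.1
      (X.exists_frame_apply e).choose_spec.choose)

theorem secAct_frame (s : affineSections A P U) (X : MarkedBundle (A := A) P U) {x : N}
    (hx : x ∈ U) (φ : X.Frame x) (f : F) :
    secAct s X (φ.1 f) =
      φ.1 (((s.1 ⟨x, hx⟩).1 ⟨X.marking x φ, X.proj_marking x φ⟩).1.1 f) := by
  obtain ⟨e, he⟩ : ∃ e, e = φ.1 f := ⟨_, rfl⟩
  obtain rfl : X.proj e = x := he ▸ φ.proj f
  have h1 := (X.exists_frame_apply e).choose_spec.choose_spec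
  rw [← he]
  obtain ⟨g, hg⟩ := φ.exists_comp (X.exists_frame_apply e).choose
  refine (affineSections_apply_comp s X hx φ _ g hg _).trans ?_
  rw [φ.injective (((hg _).symm.trans h1).trans he)]

theorem secAct_mul (s t : affineSections A P U) (X : MarkedBundle (A := A) P U) (e : X.total) :
    secAct (s * t) X e = secAct s X (secAct t X e) := by
  obtain ⟨x, φ, f, rfl⟩ := X.exists_eq_frame_apply e
  rw [secAct_frame _ X φ.mem, secAct_frame _ X φ.mem, secAct_frame _ X φ.mem]
  rfl

theorem secAct_one (X : MarkedBundle (A := A) P U) (e : X.total) :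
    secAct (1 : affineSections A P U) X e = e := by
  obtain ⟨φ, f, h⟩ := X.exists_frame_apply e
  rw [← h, secAct_frame _ X φ.mem]
  rfl

theorem proj_secAct (s : affineSections A P U) (X : MarkedBundle (A := A) P U) (e : X.total) :
    X.proj (secAct s X e) = X.proj e := by
  obtain ⟨φ, f, h⟩ := X.exists_frame_apply e
  have h1 := secAct_frame s X φ.mem φ f
  rw [h] at h1
  rw [h1, φ.proj]

/-- The frames of a local trivialization are marked by a flat section of `P`, through which `s` is
an affine translation map; the same applies to `s⁻¹`, which gives the inverse. -/
theorem isLocalAffineIso_secAct (s : affineSections A P U) (X : MarkedBundle (A := A) P U) :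
    IsLocalAffineIso (A × B) (A × B) (secAct s X) := by
  obtain ⟨Γ, q, hq⟩ := CompleteAffine.exists_quotient (B := B) (F := F)
  intro e
  obtain ⟨V, Φ, hV, hΦ⟩ := X.locally_trivial (X.proj e) (X.proj_mem e)
  obtain ⟨z, rfl⟩ := hΦ.surjective e hV
  let σ := fun y : V => X.marking y.1 (X.frameOf hΦ y)
  have hσ : ∀ y, P.proj (σ y) = y.1 := fun y => X.proj_marking _ _
  have hc : Continuous σ := X.continuous_marking V Φ hΦ
  let k : affineSections A P U → V × F → F := fun s w =>
    ((s.1 ⟨w.1.1, hΦ.le w.1.2⟩).1 ⟨σ w.1, hσ w.1⟩).1.1 w.2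
  have hk : ∀ s, IsAffineMap (A × B) B (k s) := fun s =>
    IsAffineTranslationMap.isAffineMap hq (s.2 V hΦ.le σ hσ hc)
  have h1 : ∀ (s : affineSections A P U) w, secAct s X (Φ w) = Φ (w.1, k s w) := fun s w =>
    secAct_frame s X (hΦ.le w.1.2) (X.frameOf hΦ w.1) w.2
  have h2 : ∀ (s : affineSections A P U) w, k s⁻¹ (w.1, k s w) = w.2 := fun s w =>
    ((s.1 ⟨w.1.1, hΦ.le w.1.2⟩).1 ⟨σ w.1, hσ w.1⟩).1.1.symm_apply_apply w.2
  have h3 : ∀ (s : affineSections A P U) w, k s (w.1, k s⁻¹ w) = w.2 := fun s w =>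
    ((s.1 ⟨w.1.1, hΦ.le w.1.2⟩).1 ⟨σ w.1, hσ w.1⟩).1.1.apply_symm_apply w.2
  refine IsIsoAt.of_comp_isIsoAt (hΦ.affine.isIsoAt z) (IsIsoAt.congr (IsIsoAt.comp
    (f := fun w : V × F => (w.1, k s w)) (hΦ.affine.isIsoAt _) ?_)
    (Filter.Eventually.of_forall fun w => (h1 s w).symm))
  exact IsAffineAt.isIsoAt (g := fun w : V × F => (w.1, k s⁻¹ w))
    ((isAffineAt_fst z).prodMk ((hk s).isAffineAt z))
    ((isAffineAt_fst _).prodMk ((hk s⁻¹).isAffineAt _))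
    (Filter.Eventually.of_forall fun w => Prod.ext rfl (h2 s w))
    (Filter.Eventually.of_forall fun w => Prod.ext rfl (h3 s w))

/-- The automorphism of a bundle defined by an affine section of the band. -/
def secHom (s : affineSections A P U) (X : MarkedBundle (A := A) P U) : X ⟶ X :=
  homMk (X := X) (Y := X)
    { toFun := secAct s X
      invFun := secAct s⁻¹ X
      left_inv := fun e => by rw [← secAct_mul, inv_mul_cancel, secAct_one]
      right_inv := fun e => by rw [← secAct_mul, mul_inv_cancel, secAct_one] }
    (isLocalAffineIso_secAct s X) (proj_secAct s X) fun x hx => by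
      obtain ⟨φ⟩ := X.toAffBundle.exists_frame hx
      set t := (s.1 ⟨x, hx⟩).1 ⟨X.marking x φ, X.proj_marking x φ⟩ with ht
      refine ⟨φ, φ.comp t.1, fun f => (secAct_frame s X hx φ f).symm, ?_⟩
      -- A translation has trivial class, so it does not move the marking.
      rw [X.marking_frame_comp, (QuotientGroup.eq_one_iff t.1).2 t.2, MulOpposite.op_one, one_smul]

theorem secHom_apply (s : affineSections A P U) (X : MarkedBundle (A := A) P U) (e : X.total) :
    (secHom s X).toEquiv e = secAct s X e := rfl

theorem secHom_mul (s t : affineSections A P U) (X : MarkedBundle (A := A) P U) :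
    secHom (s * t) X = secHom t X ≫ secHom s X :=
  hom_ext fun e => secAct_mul s t X e

/-- Every point of a fibre of `P` over `U` is the marking of an injective frame, through which the
value of the section is recovered. -/
theorem secHom_injective (X : MarkedBundle (A := A) P U) :
    Function.Injective fun s : affineSections A P U => secHom s X := by
  intro s t h
  refine Subtype.ext (funext fun x => Subtype.ext (funext fun p => Subtype.ext (Subtype.ext
    (Equiv.ext fun f => ?_))))
  obtain ⟨φ, hφ⟩ := X.exists_frame_marking x.2 p.2
  have hp : p = ⟨X.marking x.1 φ, X.proj_marking x.1 φ⟩ := Subtype.ext hφ.symm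
  have h1 : secAct s X (φ.1 f) = secAct t X (φ.1 f) :=
    congrArg (fun k : X ⟶ X => k.toEquiv (φ.1 f)) h
  rw [secAct_frame s X x.2, secAct_frame t X x.2] at h1
  rw [hp]
  exact φ.injective h1

/-- The image of a frame has the same marking; as the action on `P` is free, the automorphism
relating the two frames has trivial class. -/
theorem exists_translation_of_hom {X : MarkedBundle (A := A) P U} (α : X ⟶ X) {x : N}
    (φ : X.Frame x) : ∃ t : translations B F, ∀ f, α.toEquiv (φ.1 f) = φ.1 (t.1.1 f) := by
  obtain ⟨ψ, hψ⟩ := Hom.exists_frame α φ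
  have hm := α.marking x φ ψ hψ
  obtain ⟨g, hg⟩ := φ.exists_comp ψ
  rw [X.marking_comp x φ ψ g hg] at hm
  refine ⟨⟨g, (QuotientGroup.eq_one_iff g).1 (FlatBundle.eq_one_of_smul_eq hm)⟩, fun f => ?_⟩
  rw [← hψ, hg]

/-- Frames with the same marking differ by a translation, and translations commute, so the
translation read in one such frame is read in all of them. -/
theorem existsUnique_translation {X : MarkedBundle (A := A) P U} (α : X ⟶ X) {x : N} (hx : x ∈ U)
    (p : {p : P.total // P.proj p = x}) : ∃! t : translations B F,
      ∀ φ : X.Frame x, X.marking x φ = p.1 → ∀ f, α.toEquiv (φ.1 f) = φ.1 (t.1.1 f) := by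
  obtain ⟨φ, hφ⟩ := X.exists_frame_marking hx p.2
  obtain ⟨t, ht⟩ := exists_translation_of_hom α φ
  refine ⟨t, fun φ' hφ' f => ?_, fun t' ht' => ?_⟩
  · obtain ⟨g, hg⟩ := φ.exists_comp φ'
    have hm := X.marking_comp x φ φ' g hg
    rw [hφ, hφ'] at hm
    have hgt := (QuotientGroup.eq_one_iff g).1 (FlatBundle.eq_one_of_smul_eq hm.symm)
    have hcomm : t.1.1 (g.1 f) = g.1 (t.1.1 f) :=
      congrArg (fun r : translations B F => r.1.1 f) (mul_comm t ⟨g, hgt⟩)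
    rw [hg, ht, hg, hcomm]
  · refine Subtype.ext (Subtype.ext (Equiv.ext fun f => φ.injective ?_))
    rw [← ht' φ hφ, ht]

/-- The section of the band defined by an automorphism. -/
def homSec {X : MarkedBundle (A := A) P U} (α : X ⟶ X) (x : U) : adFibre P x.1 :=
  ⟨fun p => (existsUnique_translation α x.2 p).choose, by
    intro p p' g h
    obtain ⟨φ, hφ⟩ := X.exists_frame_marking x.2 p.2
    have h1 := (existsUnique_translation α x.2 p).choose_spec.1 φ hφ
    have h2 := (existsUnique_translation α x.2 p').choose_spec.1 (φ.comp g)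
      (by rw [X.marking_frame_comp, hφ, h])
    refine Subtype.ext (Equiv.ext fun f => ?_)
    have h3 : φ.1 (g.1 ((existsUnique_translation α x.2 p').choose.1.1 f)) = _ := (h2 f).symm
    have h4 := φ.injective (h3.trans (h1 (g.1 f)))
    exact (Equiv.eq_symm_apply g.1).2 h4⟩

theorem homSec_frame {X : MarkedBundle (A := A) P U} (α : X ⟶ X) {x : N} (hx : x ∈ U)
    (p : {p : P.total // P.proj p = x}) (φ : X.Frame x) (hφ : X.marking x φ = p.1) (f : F) :
    φ.1 (((homSec α ⟨x, hx⟩).1 p).1.1 f) = α.toEquiv (φ.1 f) :=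
  ((existsUnique_translation α hx p).choose_spec.1 φ hφ f).symm

/-- In a trivialization adapted to `σ` the morphism is an affine family `g` of automorphisms. By
rigidity `g y * (g y₀)⁻¹` is a translation affine in `y`, and `g y₀` is itself a translation. -/
theorem homSec_mem {X : MarkedBundle (A := A) P U} (α : X ⟶ X) :
    homSec α ∈ affineSections A P U := by
  obtain ⟨Γ, q, hq⟩ := CompleteAffine.exists_quotient (B := B) (F := F)
  intro W hW σ hσ hc
  refine IsAffineTranslationMap.of_locally A fun x => ?_
  obtain ⟨V₁, hV₁, Φ₁, hΦ₁, hx₁, hm₁⟩ := X.exists_local_trivialization_marking (hW x.2) x.2 hσ hc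
  obtain ⟨V, c, hxV, hV, hcV⟩ := exists_isConvexChart (A := A) hx₁
  have := hcV.preconnectedSpace
  refine ⟨V, hV.trans hV₁, hxV, ?_⟩
  have hΦ := hΦ₁.restrict hV
  set Φ : V × F → X.total := fun z => Φ₁ (⟨z.1.1, hV z.1.2⟩, z.2)
  have hm : ∀ y : V, X.marking y.1 (X.frameOf hΦ y) = σ ⟨y.1, hV₁ (hV y.2)⟩ := fun y =>
    hm₁ ⟨y.1, hV y.2⟩
  have hαΦ : IsTrivialization A B X.proj U V fun z => α.toEquiv (Φ z) :=
    AffBundle.IsEmbedding.isTrivialization (E := X.toAffBundle) (E' := X.toAffBundle)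
      ⟨le_rfl, α.toEquiv.injective, α.affine, α.proj,
        fun e _ => α.toEquiv.surjective e⟩ hΦ
  obtain ⟨g, hg, hga⟩ := hαΦ.exists_transition hΦ
  let t : V → translations B F := fun y =>
    (homSec α ⟨y.1, hW (hV₁ (hV y.2))⟩).1 ⟨σ ⟨y.1, hV₁ (hV y.2)⟩, hσ _⟩
  have ht : ∀ y, (t y).1 = g y := fun y => Subtype.ext (Equiv.ext fun f => by
    refine congrArg Prod.snd (hΦ.injective (a₁ := (y, (t y).1.1 f)) (a₂ := (y, (g y).1 f)) ?_)
    rw [← hg (y, f)]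
    exact homSec_frame α _ _ (X.frameOf hΦ y) (hm y) f)
  change IsAffineTranslationMap A t
  refine hq.isAffineTranslationMap fun y₀ => ?_
  obtain ⟨a, ha⟩ := hq.exists_translation hcV.affine hga y₀
  obtain ⟨b, hb⟩ := (t y₀).2 Γ q hq
  obtain ⟨-, L, hL⟩ := hcV.affine y₀
  -- The vector of `g y * (g y₀)⁻¹`, rewritten from the coordinate `c` to the preferred chart by
  -- `L`, plus the vector `b` of `g y₀`.
  refine ⟨a.comp (L : A →ᵃ[ℝ] A) + AffineMap.const ℝ A b, ?_⟩
  filter_upwards [hL] with y hy z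
  have hy' : c y = L (chartAt A y₀ y) := hy
  have h1 := ha y (b + z)
  rw [← hb, ht] at h1
  have h2 : (g y).1 (q z) = q (a (c y) + (b + z)) := by
    rw [← h1]
    exact congrArg (g y).1 ((g y₀).1.symm_apply_apply (q z)).symm
  rw [ht, h2, hy', ← add_assoc]
  rfl

theorem secHom_homSec {X : MarkedBundle (A := A) P U} (α : X ⟶ X) :
    secHom ⟨homSec α, homSec_mem α⟩ X = α := by
  refine hom_ext fun e => ?_
  obtain ⟨φ, f, h⟩ := X.exists_frame_apply e
  rw [secHom_apply, ← h, secAct_frame _ X φ.mem]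
  exact homSec_frame α _ _ φ rfl f

/-- The automorphisms of a bundle are the affine sections of the band. -/
def secEquiv (X : MarkedBundle (A := A) P U) : affineSections A P U ≃* End X where
  toFun s := secHom s X
  invFun α := ⟨homSec α, homSec_mem α⟩
  left_inv _ := secHom_injective X (secHom_homSec _)
  right_inv := secHom_homSec
  map_mul' s t := secHom_mul s t X

end MarkedBundle

variable (A P) in
/-- The bundles are bounded by the sheaf of affine sections of the bundle of translation groups. -/
def bundleBanding : Banding (bundleStack A P) (affineSectionsPresheaf A P) where
  iso {U} X := MarkedBundle.secEquiv (A := A) (P := P) (U := U) X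
  iso_restr {U V} h X s := by
    let X : MarkedBundle (A := A) P U := X
    let s : affineSections A P U := s
    refine MarkedBundle.hom_ext (X := X.res h) (Y := X.res h) fun e => ?_
    obtain ⟨x, φ, f, rfl⟩ := (X.res h).exists_eq_frame_apply e
    refine Eq.trans ?_
      (MarkedBundle.secAct_frame (affineSectionsRes A P h s) (X.res h) φ.mem φ f).symm
    exact Subtype.ext (MarkedBundle.secAct_frame s X (h φ.mem) (X.frameVal h φ) f)
  iso_comp {U} X Y k s := by
    let X : MarkedBundle (A := A) P U := X
    let Y : MarkedBundle (A := A) P U := Y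
    let s : affineSections A P U := s
    let k : X ⟶ Y := k
    refine MarkedBundle.hom_ext (X := X) (Y := Y) fun e => ?_
    obtain ⟨φ, f, h⟩ := X.exists_frame_apply e
    obtain ⟨ψ, hψ⟩ := MarkedBundle.Hom.exists_frame k φ
    change k.toEquiv (MarkedBundle.secAct s X e) = MarkedBundle.secAct s Y (k.toEquiv e)
    rw [← h, MarkedBundle.secAct_frame s X φ.mem, ← hψ, ← hψ, MarkedBundle.secAct_frame s Y φ.mem]
    simp only [k.marking _ φ ψ hψ]

end Banding

/-! ### Cohomologous cocycles form an equivalence relation -/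

section Cech

variable {X : Type u} [TopologicalSpace X] {L : (Opens X)ᵒᵖ ⥤ CommGrpCat.{u}}

theorem secRes_secRes {U V W : Opens X} (h : V ≤ U) (k : W ≤ V) (s : L.obj (op U)) :
    secRes k (secRes h s) = secRes (k.trans h) s := by
  change ((L.map (homOfLE h).op) ≫ (L.map (homOfLE k).op)).hom s = _
  rw [← L.map_comp]
  rfl

theorem secRes_inv {U V : Opens X} (h : V ≤ U) (s : L.obj (op U)) :
    secRes h s⁻¹ = (secRes h s)⁻¹ :=
  map_inv (L.map (homOfLE h).op).hom s

namespace CechCocycle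

variable (c : CechCocycle L)

/-- The values of a cocycle on smaller open subsets. -/
def on {W : Opens X} {i j k : c.ι} (hi : W ≤ c.U i) (hj : W ≤ c.U j) (hk : W ≤ c.U k) :
    L.obj (op W) :=
  secRes (le_inf (le_inf hi hj) hk) (c.val i j k)

theorem secRes_on {W W' : Opens X} {i j k : c.ι} (hi : W ≤ c.U i) (hj : W ≤ c.U j)
    (hk : W ≤ c.U k) (h : W' ≤ W) :
    secRes h (c.on hi hj hk) = c.on (h.trans hi) (h.trans hj) (h.trans hk) :=
  secRes_secRes _ _ _

theorem on_cocycle {W : Opens X} {i j k l : c.ι} (hi : W ≤ c.U i) (hj : W ≤ c.U j)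
    (hk : W ≤ c.U k) (hl : W ≤ c.U l) :
    c.on hj hk hl * c.on hi hj hl = c.on hi hk hl * c.on hi hj hk :=
  c.isCocycle i j k l W hi hj hk hl

end CechCocycle

/-- Cohomologous cocycles, on arbitrary smaller open subsets. -/
theorem cohomologous_of {c d : CechCocycle L} {κ : Type u} {W : κ → Opens X} (hW : ⨆ a, W a = ⊤)
    {σ : κ → c.ι} (hσ : ∀ a, W a ≤ c.U (σ a)) {τ : κ → d.ι} (hτ : ∀ a, W a ≤ d.U (τ a))
    (s : ∀ (a a' : κ), L.obj (op (W a ⊓ W a')))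
    (H : ∀ (a a' a'' : κ) (O : Opens X) (h : O ≤ W a) (h' : O ≤ W a') (h'' : O ≤ W a''),
      c.on (h.trans (hσ a)) (h'.trans (hσ a')) (h''.trans (hσ a'')) =
        d.on (h.trans (hτ a)) (h'.trans (hτ a')) (h''.trans (hτ a'')) *
          (secRes (le_inf h h') (s a a') * secRes (le_inf h' h'') (s a' a'') *
            (secRes (le_inf h h'') (s a a''))⁻¹)) :
    Cohomologous c d :=
  ⟨κ, W, hW, σ, hσ, τ, hτ, s, fun a a' a'' => H a a' a'' _ (inf_le_left.trans inf_le_left)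
    (inf_le_left.trans inf_le_right) inf_le_right⟩

theorem Cohomologous.exists_on {c d : CechCocycle L} (h : Cohomologous c d) :
    ∃ (κ : Type u) (W : κ → Opens X) (_ : ⨆ a, W a = ⊤) (σ : κ → c.ι)
      (hσ : ∀ a, W a ≤ c.U (σ a)) (τ : κ → d.ι) (hτ : ∀ a, W a ≤ d.U (τ a))
      (s : ∀ (a a' : κ), L.obj (op (W a ⊓ W a'))),
      ∀ (a a' a'' : κ) (O : Opens X) (h : O ≤ W a) (h' : O ≤ W a') (h'' : O ≤ W a''),
        c.on (h.trans (hσ a)) (h'.trans (hσ a')) (h''.trans (hσ a'')) =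
          d.on (h.trans (hτ a)) (h'.trans (hτ a')) (h''.trans (hτ a'')) *
            (secRes (le_inf h h') (s a a') * secRes (le_inf h' h'') (s a' a'') *
              (secRes (le_inf h h'') (s a a''))⁻¹) := by
  obtain ⟨κ, W, hW, σ, hσ, τ, hτ, s, H⟩ := h
  refine ⟨κ, W, hW, σ, hσ, τ, hτ, s, fun a a' a'' O h h' h'' => ?_⟩
  have h1 := congrArg (secRes (le_inf (le_inf h h') h'')) (H a a' a'')
  simp only [map_mul, map_inv, secRes_secRes] at h1
  exact h1

theorem Cohomologous.refl (c : CechCocycle L) : Cohomologous c c :=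
  cohomologous_of c.cover (σ := id) (fun _ => le_rfl) (τ := id) (fun _ => le_rfl)
    (fun _ _ => 1) fun a a' a'' O h h' h'' => by simp

theorem Cohomologous.symm {c d : CechCocycle L} (h : Cohomologous c d) : Cohomologous d c := by
  obtain ⟨κ, W, hW, σ, hσ, τ, hτ, s, H⟩ := h.exists_on
  refine cohomologous_of hW hτ hσ (fun a a' => (s a a')⁻¹) fun a a' a'' O h h' h'' => ?_
  rw [H a a' a'' O h h' h'', secRes_inv, secRes_inv, secRes_inv, ← mul_inv, ← mul_inv,
    mul_inv_cancel_right]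

/-- The algebra behind the fact that the restrictions of a cocycle along two refinement maps are
cohomologous. -/
theorem homotopy_identity {G : Type*} [AddCommGroup G]
    {s012 s12 s02 s01 t12 t012 u0 u1 v1 v2 : G}
    (h1 : s012 + s02 = s12 + s01) (h2 : u1 + v1 = s12 + u0) (h3 : t12 + v1 = v2 + t012) :
    s012 = t012 + ((s01 - u0) + (u1 - t12) - (s02 - v2)) := by
  have e1 : s012 = s12 + s01 - s02 := eq_sub_of_add_eq h1
  have e2 : s12 = u1 + v1 - u0 := eq_sub_of_add_eq h2.symm
  have e3 : t012 = t12 + v1 - v2 := by rw [h3]; abel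
  rw [e1, e2, e3]
  abel

/-- On the product refinement `d` occurs through two refinement maps, `τ` and `σ'`. Their difference
is a coboundary by the usual simplicial homotopy, which enters the new cochain. -/
theorem Cohomologous.trans {c d e : CechCocycle L} (h : Cohomologous c d)
    (h' : Cohomologous d e) : Cohomologous c e := by
  obtain ⟨κ, W, hW, σ, hσ, τ, hτ, s, H⟩ := h.exists_on
  obtain ⟨κ', W', hW', σ', hσ', τ', hτ', s', H'⟩ := h'.exists_on
  let Y : κ × κ' → Opens X := fun a => W a.1 ⊓ W' a.2
  have hl : ∀ a, Y a ≤ W a.1 := fun a => inf_le_left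
  have hr : ∀ a, Y a ≤ W' a.2 := fun a => inf_le_right
  have hτ₁ : ∀ a, Y a ≤ d.U (τ a.1) := fun a => (hl a).trans (hτ _)
  have hσ₁ : ∀ a, Y a ≤ d.U (σ' a.2) := fun a => (hr a).trans (hσ' _)
  refine cohomologous_of (W := Y) (top_le_iff.1 fun x _ => ?_) (fun a => (hl a).trans (hσ _))
    (fun a => (hr a).trans (hτ' _)) (fun a a' =>
      secRes (inf_le_inf (hl a) (hl a')) (s a.1 a'.1) *
      secRes (inf_le_inf (hr a) (hr a')) (s' a.2 a'.2) *
      (d.on (inf_le_left.trans (hσ₁ a)) (inf_le_left.trans (hτ₁ a)) (inf_le_right.trans (hτ₁ a')) /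
        d.on (inf_le_left.trans (hσ₁ a)) (inf_le_right.trans (hσ₁ a'))
          (inf_le_right.trans (hτ₁ a')))) fun a a' a'' O h h' h'' => ?_
  · obtain ⟨a, ha⟩ := Opens.mem_iSup.1 (hW.symm ▸ Opens.mem_top x)
    obtain ⟨b, hb⟩ := Opens.mem_iSup.1 (hW'.symm ▸ Opens.mem_top x)
    exact Opens.mem_iSup.2 ⟨(a, b), ha, hb⟩
  · simp only [map_mul, map_div, secRes_secRes, CechCocycle.secRes_on]
    rw [H _ _ _ O (h.trans (hl a)) (h'.trans (hl a')) (h''.trans (hl a''))]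
    have E := H' _ _ _ O (h.trans (hr a)) (h'.trans (hr a')) (h''.trans (hr a''))
    have T0 := h.trans (hτ₁ a)
    have T1 := h'.trans (hτ₁ a')
    have T2 := h''.trans (hτ₁ a'')
    have S0 := h.trans (hσ₁ a)
    have S1 := h'.trans (hσ₁ a')
    have S2 := h''.trans (hσ₁ a'')
    -- The three instances of the cocycle identity of `d` on the prism between the two refinement
    -- maps, read additively.
    have K := homotopy_identity (G := Additive (L.obj (op O))) (d.on_cocycle S0 T0 T1 T2)
      (d.on_cocycle S0 S1 T1 T2) (d.on_cocycle S0 S1 S2 T2)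
    have K' : d.on T0 T1 T2 = d.on S0 S1 S2 * (d.on S0 T0 T1 / d.on S0 S1 T1 *
      (d.on S1 T1 T2 / d.on S1 S2 T2) / (d.on S0 T0 T2 / d.on S0 S2 T2)) := K
    rw [K', E]
    simp only [div_eq_mul_inv, mul_inv]
    ac_rfl

end Cech

/-! ### The class of a gerbe with commutative band -/

section GerbeClass

variable {X : Type u} [TopologicalSpace X]
  {C : Pseudofunctor (LocallyDiscrete (Opens X)ᵒᵖ) Cat.{v', u'}}

section RestrHom

variable {U U' U'' V W : Opens X} {a : Fib C U} {b : Fib C U'} {c : Fib C U''} {h : V ≤ U}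
  {h' : V ≤ U'} {h'' : V ≤ U''}

open Pseudofunctor.LocallyDiscreteOpToCat

theorem restrHom_comp (f : (restr C h).obj a ⟶ (restr C h').obj b)
    (g : (restr C h').obj b ⟶ (restr C h'').obj c) (k : W ≤ V) :
    restrHom (f ≫ g) k = restrHom f k ≫ restrHom g k := by
  simp [restrHom, pullHom, ← Cat.Hom₂.comp_app_assoc]

theorem restrHom_id (k : W ≤ V) :
    restrHom (𝟙 ((restr C h).obj a)) k = 𝟙 ((restr C (k.trans h)).obj a) := by
  simp [restrHom, pullHom, ← Cat.Hom₂.comp_app]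

theorem restrHom_restrHom (f : (restr C h).obj a ⟶ (restr C h').obj b) (k : W ≤ V)
    {W' : Opens X} (k' : W' ≤ W) :
    restrHom (restrHom f k) k' = restrHom f (k'.trans k) :=
  pullHom_pullHom _ _ _ _ _ _ _ _ _ _ _

variable {L : (Opens X)ᵒᵖ ⥤ CommGrpCat.{u}} (β : Banding C L)

/-- The band commutes with every arrow, in particular with the coherence isomorphisms inside
`restrHom`, so these cancel. -/
theorem restrHom_iso (s : L.obj (op V)) (k : W ≤ V) :
    restrHom (h := h) (h' := h) (β.iso ((restr C h).obj a) s) k =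
      β.iso ((restr C (k.trans h)).obj a) (secRes k s) := by
  have h1 := β.iso_restr k ((restr C h).obj a) s
  have h2 := β.iso_comp _ _ ((C.mapComp' (homOfLE h).op.toLoc (homOfLE k).op.toLoc
    (homOfLE (k.trans h)).op.toLoc (by rfl)).hom.toNatTrans.app a) (secRes k s)
  simp only [restrHom, pullHom]
  rw [h1, ← Category.assoc]
  refine (congrArg (· ≫ _) h2.symm).trans ?_
  rw [Category.assoc]
  simp [← Cat.Hom₂.comp_app]

end RestrHom

namespace Banding

variable {L : (Opens X)ᵒᵖ ⥤ CommGrpCat.{u}} (β : Banding C L) {U : Opens X} {a b c : Fib C U}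

/-- The action of the sections of the band on the arrows. -/
def act (s : L.obj (op U)) (f : a ⟶ b) : a ⟶ b :=
  (β.iso a s : a ⟶ a) ≫ f

/-- Multiplication in `End` is composition in the opposite order; commutativity of the band absorbs
the reversal. -/
theorem act_mul (s t : L.obj (op U)) (f : a ⟶ b) : β.act (s * t) f = β.act s (β.act t f) := by
  rw [mul_comm]
  simp only [act, map_mul, End.mul_def, Category.assoc]

theorem act_comp (s : L.obj (op U)) (f : a ⟶ b) (g : b ⟶ c) :
    β.act s f ≫ g = β.act s (f ≫ g) :=
  Category.assoc _ _ _

theorem comp_act (s : L.obj (op U)) (f : a ⟶ b) (g : b ⟶ c) :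
    f ≫ β.act s g = β.act s (f ≫ g) := by
  simp only [act]
  rw [← Category.assoc, ← β.iso_comp, Category.assoc]

theorem act_injective (f : a ⟶ b) [IsIso f] {s t : L.obj (op U)} (h : β.act s f = β.act t f) :
    s = t :=
  (β.iso a).injective ((cancel_mono f).1 h)

theorem exists_act (f g : a ⟶ b) [IsIso f] : ∃ s, g = β.act s f :=
  ⟨(β.iso a).symm (g ≫ inv f), by simp [act]⟩

theorem restrHom_act {U U' V W : Opens X} {a : Fib C U} {b : Fib C U'} {h : V ≤ U} {h' : V ≤ U'}
    (s : L.obj (op V)) (f : (restr C h).obj a ⟶ (restr C h').obj b) (k : W ≤ V) :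
    restrHom (β.act s f) k = β.act (secRes k s) (restrHom f k) := by
  rw [act, restrHom_comp, restrHom_iso, act]

/-- The composite `v₂ ≫ u₁₂' ≫ u₀₁'` is computed in two ways and the action on the invertible arrow
`u₀₂ ≫ v₀` is cancelled. -/
theorem mul_eq_mul_of_comp_eq {p q r p' q' r' : Fib C U} {u₀₁ : q ⟶ p} {u₁₂ : r ⟶ q}
    {u₀₂ : r ⟶ p} {u₀₁' : q' ⟶ p'} {u₁₂' : r' ⟶ q'} {u₀₂' : r' ⟶ p'} {v₀ : p ⟶ p'} {v₁ : q ⟶ q'}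
    {v₂ : r ⟶ r'} [IsIso u₀₂] [IsIso v₀] {c c' s₀₁ s₁₂ s₀₂ : L.obj (op U)}
    (hc : u₁₂ ≫ u₀₁ = β.act c u₀₂) (hc' : u₁₂' ≫ u₀₁' = β.act c' u₀₂')
    (h₀₁ : v₁ ≫ u₀₁' = β.act s₀₁ (u₀₁ ≫ v₀)) (h₁₂ : v₂ ≫ u₁₂' = β.act s₁₂ (u₁₂ ≫ v₁))
    (h₀₂ : v₂ ≫ u₀₂' = β.act s₀₂ (u₀₂ ≫ v₀)) : s₁₂ * s₀₁ * c = c' * s₀₂ := by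
  refine β.act_injective (u₀₂ ≫ v₀) ?_
  rw [β.act_mul, β.act_mul, β.act_mul, ← h₀₂, ← β.comp_act c', ← hc', ← Category.assoc, h₁₂,
    β.act_comp, Category.assoc, h₀₁, β.comp_act, ← β.act_comp c, ← hc, Category.assoc]

end Banding

instance {U U' V W : Opens X} {a : Fib C U} {b : Fib C U'} {h : V ≤ U} {h' : V ≤ U'}
    (f : (restr C h).obj a ⟶ (restr C h').obj b) [IsIso f] (k : W ≤ V) :
    IsIso (restrHom f k) :=
  ⟨restrHom (inv f) k, by rw [← restrHom_comp, IsIso.hom_inv_id, restrHom_id], by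
    rw [← restrHom_comp, IsIso.inv_hom_id, restrHom_id]⟩

/-- Objects over the members of a cover of the space, with compatible isomorphisms between their
restrictions, come from an object over the space. -/
theorem IsGerbe.exists_object (hC : IsGerbe C) {κ : Type u} {W U : κ → Opens X}
    (hW : ⨆ a, W a = ⊤) (hσ : ∀ a, W a ≤ U a) (x : ∀ a, Fib C (U a))
    (w : ∀ (a a' : κ) (O : Opens X) (k : O ≤ W a) (k' : O ≤ W a'),
      (restr C (k.trans (hσ a))).obj (x a) ⟶ (restr C (k'.trans (hσ a'))).obj (x a'))
    (w_comp : ∀ (a a' a'' : κ) (O : Opens X) (k : O ≤ W a) (k' : O ≤ W a') (k'' : O ≤ W a''),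
      w a a' O k k' ≫ w a' a'' O k' k'' = w a a'' O k k'')
    (w_restr : ∀ (a a' : κ) (O O' : Opens X) (k : O ≤ W a) (k' : O ≤ W a') (l : O' ≤ O),
      restrHom (w a a' O k k') l = w a a' O' (l.trans k) (l.trans k')) :
    Nonempty (Fib C ⊤) := by
  let b : ∀ a, Fib C (W a) := fun a => (restr C (hσ a)).obj (x a)
  -- Restricting in one step or in two gives objects that are only isomorphic; `t` transports the
  -- arrows `w` to arrows `T` between restrictions of `b`.
  let t : ∀ a, (restr C (le_refl (W a))).obj (b a) ≅ (restr C (hσ a)).obj (x a) := fun a =>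
    (Cat.Hom.toNatIso (C.mapId _)).app (b a)
  let T : ∀ (a a' : κ) {O : Opens X} (k : O ≤ W a) (k' : O ≤ W a'),
      (restr C k).obj (b a) ⟶ (restr C k').obj (b a') := fun a a' O k k' =>
    restrHom (t a).hom k ≫ w a a' O k k' ≫ restrHom (t a').inv k'
  have T_restr : ∀ (a a' : κ) {O O' : Opens X} (k : O ≤ W a) (k' : O ≤ W a') (l : O' ≤ O),
      restrHom (T a a' k k') l = T a a' (l.trans k) (l.trans k') := by
    intro a a' O O' k k' l
    refine (restrHom_comp _ _ _).trans (congrArg₂ (· ≫ ·) (restrHom_restrHom _ _ _) ?_)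
    exact (restrHom_comp _ _ _).trans (congrArg₂ (· ≫ ·) (w_restr _ _ _ _ _ _ _)
      (restrHom_restrHom _ _ _))
  have t_inv_hom : ∀ (a : κ) {O : Opens X} (k : O ≤ W a),
      restrHom (t a).inv k ≫ restrHom (t a).hom k = 𝟙 _ := fun a O k => by
    rw [← restrHom_comp, Iso.inv_hom_id, restrHom_id]
  have T_comp : ∀ (a a' a'' : κ) {O : Opens X} (k : O ≤ W a) (k' : O ≤ W a') (k'' : O ≤ W a''),
      T a a' k k' ≫ T a' a'' k' k'' = T a a'' k k'' := by
    intro a a' a'' O k k' k''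
    dsimp only [T]
    simp only [Category.assoc]
    rw [reassoc_of% (t_inv_hom a' k'), reassoc_of% (w_comp a a' a'' O k k' k'')]
  have T_self : ∀ (a : κ) {O : Opens X} (k : O ≤ W a), T a a k k = 𝟙 _ := by
    intro a O k
    have := hC.isIso _ _ _ (T a a k k)
    -- An idempotent isomorphism is the identity.
    exact (cancel_epi (T a a k k)).1 ((T_comp a a a k k k).trans (Category.comp_id _).symm)
  let f : ∀ a, W a ⟶ (⊤ : Opens X) := fun a => homOfLE le_top
  let Δ : C.DescentData f :=
    { obj := b
      hom := fun O q a a' k k' _ _ => T a a' k.le k'.le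
      pullHom_hom := fun O' O l q q' _ a a' k k' _ _ _ _ _ _ => T_restr a a' k.le k'.le l.le
      hom_self := fun O q a k _ => T_self a k.le
      hom_comp := fun O q a a' a'' k k' k'' _ _ _ => T_comp a a' a'' k.le k'.le k''.le }
  have := hC.isStack
  have := C.isEquivalence_toDescentData (J := Opens.grothendieckTopology X) f (by
    intro y _
    obtain ⟨a, ha⟩ := Opens.mem_iSup.1 (hW.symm ▸ Opens.mem_top y)
    exact ⟨W a, f a, Sieve.ofArrows_mk _ _ a, ha⟩)
  exact ⟨(C.toDescentData f).objPreimage Δ⟩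

namespace LocalObjects

variable {L : (Opens X)ᵒᵖ ⥤ CommGrpCat.{u}} (β : Banding C L) (D : LocalObjects C)

/-- The given isomorphisms on smaller open subsets. -/
def hom {W : Opens X} {i j : D.ι} (hi : W ≤ D.U i) (hj : W ≤ D.U j) :
    (restr C hj).obj (D.obj j) ⟶ (restr C hi).obj (D.obj i) :=
  restrHom (D.iso i j).hom (le_inf hi hj)

instance {W : Opens X} {i j : D.ι} (hi : W ≤ D.U i) (hj : W ≤ D.U j) : IsIso (D.hom hi hj) :=
  inferInstanceAs (IsIso (restrHom (D.iso i j).hom (le_inf hi hj)))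

theorem restrHom_hom {W W' : Opens X} {i j : D.ι} (hi : W ≤ D.U i) (hj : W ≤ D.U j) (k : W' ≤ W) :
    restrHom (D.hom hi hj) k = D.hom (k.trans hi) (k.trans hj) :=
  restrHom_restrHom _ _ _

theorem hom_comp {W : Opens X} {i j k : D.ι} (hi : W ≤ D.U i) (hj : W ≤ D.U j) (hk : W ≤ D.U k) :
    D.hom hj hk ≫ D.hom hi hj =
      β.act (secRes (le_inf (le_inf hi hj) hk) (D.cochain β i j k)) (D.hom hi hk) := by
  have h1 : D.hom (i := j) (j := k) (W := D.U i ⊓ D.U j ⊓ D.U k) (inf_le_left.trans inf_le_right)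
      inf_le_right ≫ D.hom (i := i) (inf_le_left.trans inf_le_left)
        (inf_le_left.trans inf_le_right) =
      β.act (D.cochain β i j k) (D.hom (inf_le_left.trans inf_le_left) inf_le_right) := by
    rw [Banding.act, cochain, MulEquiv.apply_symm_apply]
    simp only [triangle, hom, Category.assoc]
    rw [← restrHom_comp (D.iso i k).inv, Iso.inv_hom_id, restrHom_id, Category.comp_id]
  have h2 := congrArg (fun f => restrHom f (le_inf (le_inf hi hj) hk)) h1
  simpa only [restrHom_comp, restrHom_hom, Banding.restrHom_act] using h2

/-- The two bracketings of `u_ij u_jk u_kl` give the two sides, as multiples of `u_il`. -/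
theorem isCechCocycle_cochain : IsCechCocycle (D.cochain β) := by
  intro i j k l W hi hj hk hl
  refine β.act_injective (D.hom hi hl) ?_
  rw [mul_comm (secRes _ (D.cochain β i k l)), β.act_mul, β.act_mul, ← D.hom_comp β hi hj hl,
    ← D.hom_comp β hi hk hl, ← β.act_comp, ← β.comp_act, ← D.hom_comp β hj hk hl, ← D.hom_comp β hi hj hk, Category.assoc]

/-- The classifying cocycle. -/
def cocycle : CechCocycle L :=
  ⟨D.ι, D.U, D.cover, D.cochain β, D.isCechCocycle_cochain β⟩

theorem exists_mem (x : X) : ∃ i, x ∈ D.U i :=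
  Opens.mem_iSup.1 (D.cover.symm ▸ Opens.mem_top x)

theorem hom_comp_on {W : Opens X} {i j k : D.ι} (hi : W ≤ D.U i) (hj : W ≤ D.U j)
    (hk : W ≤ D.U k) :
    D.hom hj hk ≫ D.hom hi hj = β.act ((D.cocycle β).on hi hj hk) (D.hom hi hk) :=
  D.hom_comp β hi hj hk

/-- The class of the cocycle does not depend on the choices. -/
theorem cohomologous_cocycle (hC : IsGerbe C) (D' : LocalObjects C) :
    Cohomologous (D.cocycle β) (D'.cocycle β) := by
  choose i hi using D.exists_mem
  choose i' hi' using D'.exists_mem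
  choose W hxW hW _ hWc using fun x : X => hC.locally_connected (D.U (i x) ⊓ D'.U (i' x)) x
    ⟨hi x, hi' x⟩
  have hσ : ∀ x, W x ≤ D.U (i x) := fun x => (hW x).trans inf_le_left
  have hτ : ∀ x, W x ≤ D'.U (i' x) := fun x => (hW x).trans inf_le_right
  -- Comparison isomorphisms between the two systems of objects, available locally because any two
  -- objects over `W x` are isomorphic.
  let v := fun x => (hWc x ((restr C (hσ x)).obj (D.obj (i x)))
    ((restr C (hτ x)).obj (D'.obj (i' x)))).some
  have := hC.isIso
  -- The two ways around the square formed by the comparison isomorphisms and the given ones differ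
  -- by a section of the band.
  choose s hs using fun x y => β.exists_act
    (D.hom (W := W x ⊓ W y) (inf_le_left.trans (hσ x)) (inf_le_right.trans (hσ y)) ≫
      restrHom (v x) inf_le_left)
    (restrHom (v y) inf_le_right ≫
      D'.hom (inf_le_left.trans (hτ x)) (inf_le_right.trans (hτ y)))
  have hs' : ∀ (x y : X) (O : Opens X) (hx : O ≤ W x) (hy : O ≤ W y),
      restrHom (v y) hy ≫ D'.hom (hx.trans (hτ x)) (hy.trans (hτ y)) =
        β.act (secRes (le_inf hx hy) (s x y))
          (D.hom (hx.trans (hσ x)) (hy.trans (hσ y)) ≫ restrHom (v x) hx) := by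
    intro x y O hx hy
    have h1 := congrArg (fun f => restrHom f (le_inf hx hy)) (hs x y)
    simpa only [restrHom_comp, restrHom_hom, Banding.restrHom_act, restrHom_restrHom] using h1
  refine cohomologous_of (top_le_iff.1 fun x _ => Opens.mem_iSup.2 ⟨x, hxW x⟩) hσ hτ
    (fun x y => (s x y)⁻¹) fun x y z O hx hy hz => ?_
  have h1 := β.mul_eq_mul_of_comp_eq
    (D.hom_comp_on β (hx.trans (hσ x)) (hy.trans (hσ y)) (hz.trans (hσ z)))
    (D'.hom_comp_on β (hx.trans (hτ x)) (hy.trans (hτ y)) (hz.trans (hτ z)))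
    (hs' x y O hx hy) (hs' y z O hy hz) (hs' x z O hx hz)
  refine (eq_inv_mul_of_mul_eq h1).trans ?_
  rw [secRes_inv, secRes_inv, secRes_inv, inv_inv, mul_inv]
  ac_rfl

variable {D} in
/-- If the cocycle is a coboundary, there is an object over the whole space. -/
theorem exists_object (hC : IsGerbe C) (h : Quot.mk Cohomologous (D.cocycle β) = (1 : CechH2 L)) :
    Nonempty (Fib C ⊤) := by
  -- Equality in `Quot` only gives the generated equivalence; since the relation is already one, an
  -- actual cobounding cochain is obtained.
  have h0 : Equivalence (Cohomologous (L := L)) :=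
    ⟨Cohomologous.refl, Cohomologous.symm, Cohomologous.trans⟩
  obtain ⟨κ, W, hW, σ, hσ, s, H⟩ : ∃ (κ : Type u) (W : κ → Opens X) (_ : ⨆ a, W a = ⊤)
      (σ : κ → D.ι) (hσ : ∀ a, W a ≤ D.U (σ a)) (s : ∀ (a a' : κ), L.obj (op (W a ⊓ W a'))),
      ∀ (a a' a'' : κ) (O : Opens X) (h : O ≤ W a) (h' : O ≤ W a') (h'' : O ≤ W a''),
        (D.cocycle β).on (i := σ a) (h.trans (hσ a)) (h'.trans (hσ a')) (h''.trans (hσ a'')) =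
          secRes (le_inf h h') (s a a') * secRes (le_inf h' h'') (s a' a'') *
            (secRes (le_inf h h'') (s a a''))⁻¹ := by
    obtain ⟨κ, W, hW, σ, hσ, τ, hτ, s, H⟩ :=
      (h0.eqvGen_iff.1 (Quot.eqvGen_exact h)).exists_on
    exact ⟨κ, W, hW, σ, hσ, s, fun a a' a'' O h h' h'' => (H a a' a'' O h h' h'').trans
      ((congrArg (· * _) (map_one _)).trans (one_mul _))⟩
  -- Dividing the isomorphisms by the cobounding cochain makes them compatible. The arrow from index
  -- `a` to `a'` is `u_{a'a}`, which explains the order in `s a' a`.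
  refine hC.exists_object hW hσ (fun a => D.obj (σ a)) (fun a a' O k k' =>
    β.act (secRes (le_inf k' k) (s a' a))⁻¹ (D.hom (k'.trans (hσ a')) (k.trans (hσ a)))) ?_ ?_
  · intro a a' a'' O k k' k''
    rw [β.comp_act, β.act_comp, D.hom_comp_on β, ← β.act_mul, ← β.act_mul, H a'' a' a O k'' k' k]
    congr 1
    rw [mul_comm (secRes (le_inf k'' k') (s a'' a')), mul_assoc, ← mul_assoc _⁻¹ (_ * _),
      inv_mul_cancel_left, inv_mul_cancel_left]
  · intro a a' O O' k k' l
    rw [β.restrHom_act, D.restrHom_hom, secRes_inv, secRes_secRes]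

/-- The cover by the whole space, with the given object and its identity, has cochain `1`, and the
class does not depend on the choices. -/
theorem class_eq_one_of_object (hC : IsGerbe C) (a : Fib C ⊤) :
    Quot.mk Cohomologous (D.cocycle β) = (1 : CechH2 L) := by
  let D' : LocalObjects C :=
    { ι := PUnit
      U := fun _ => ⊤
      cover := by simp
      obj := fun _ => a
      iso := fun _ _ => Iso.refl _ }
  refine (Quot.sound (D.cohomologous_cocycle β hC D')).trans ?_
  have h : D'.cochain β = fun _ _ _ => 1 := by
    funext i j k
    rw [cochain, MulEquiv.symm_apply_eq, map_one]
    have h1 := restrHom_id (C := C) (a := a) (h := (inf_le_left : (⊤ ⊓ ⊤ : Opens X) ≤ ⊤))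
      (inf_le_left : (⊤ ⊓ ⊤ ⊓ ⊤ : Opens X) ≤ ⊤ ⊓ ⊤)
    refine (congrArg₂ (· ≫ ·) h1 (congrArg₂ (· ≫ ·) h1 h1)).trans ?_
    exact (Category.id_comp _).trans (Category.id_comp _)
  refine congrArg (Quot.mk _) ?_
  rw [cocycle]
  congr 1

end LocalObjects

end GerbeClass

end AffineGerbe

/-! ### The theorem -/

open AffineGerbe TopologicalSpace CategoryTheory in
theorem proposition5p0p3
    {A : Type*} [NormedAddCommGroup A] [NormedSpace ℝ A] [FiniteDimensional ℝ A]
    {B : Type*} [NormedAddCommGroup B] [NormedSpace ℝ B] [FiniteDimensional ℝ B]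
    {N : Type u} [TopologicalSpace N] [T2Space N] [CompactSpace N] [ChartedSpace A N]
    [HasGroupoid N (affineGroupoid A)] [CompleteAffine A N]
    {F : Type u} [TopologicalSpace F] [T2Space F] [CompactSpace F] [ChartedSpace B F]
    [HasGroupoid F (affineGroupoid B)] [CompleteAffine B F]
    (P : FlatBundle (OuterGroup B F) N) :
    IsGerbe (bundleStack A P) ∧
      Presheaf.IsSheaf (Opens.grothendieckTopology N) (affineSectionsPresheaf A P) ∧
      ∃ β : Banding (bundleStack A P) (affineSectionsPresheaf A P),
        (∀ (U : Opens N) (E : MarkedBundle (A := A) P U) (s : affineSections A P U) (x : N)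
          (hx : x ∈ U) (φ : E.Frame x) (f : F),
            MarkedBundle.Hom.toEquiv (X := E) (Y := E)
              (β.iso (U := U) E s) (φ.1 f) =
              φ.1 (((s.1 ⟨x, hx⟩).1 ⟨E.marking x φ, E.proj_marking x φ⟩).1.1 f)) ∧
        ∃ κ : CechH2 (affineSectionsPresheaf A P),
          IsGerbeClass β κ ∧ (κ = 1 ↔ Nonempty (MarkedBundle (A := A) P ⊤)) := by
  have hC := isGerbe_bundleStack A P
  obtain ⟨D⟩ := nonempty_localObjects A P
  refine ⟨hC, isSheaf_affineSectionsPresheaf A P, bundleBanding A P,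
    fun U E s x hx φ f => MarkedBundle.secAct_frame s E hx φ f,
    Quot.mk _ (D.cocycle (bundleBanding A P)), ⟨⟨D⟩, fun D' => ?_⟩,
    fun h => LocalObjects.exists_object _ hC h,
    fun ⟨E⟩ => LocalObjects.class_eq_one_of_object _ D hC E⟩
  exact ⟨D'.isCechCocycle_cochain _, Quot.sound (D'.cohomologous_cocycle _ hC D)⟩
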